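/- Setting. Logarithms are to base $2$. Let $m=2^r$ with $r\ge1$, $0<\beta<1$, $\alpha=\sqrt{1-\beta^2}$, where $\beta^2=O(1/m)$ (for instance $\beta\approx1/\sqrt{8m}$), $R=\begin{pmatrix}\alpha&\beta\\ \beta&-\alpha\end{pmatrix}$, $P=\mathrm{diag}(1,i)$, and let the target be a finite-dimensional system in a unit state $|\zeta\rangle$. For $x\in\{0,1\}^m$ let $W^{(K)}_x=V_mG_{m-1}V_{m-1}\cdots G_0V_0$, where the driving evolutions $V_j$ are unitary and $G_j$ is the unitary query $Q$ if $x_j=1$ and fewer than $K$ of the bits before $x_j$ are one, and $G_j=I$ otherwise. Uncompressed scheme. Prepare $(PR)^{\otimes m}|0^m\rangle|\zeta\rangle$, apply $\sum_x|x\rangle\langle x|\otimes W^{(K)}_x$ with some $K\ge k'$ ($K=k'$ is the segment circuit with at most $k'$ queries, $K\ge m$ the one without a cap), apply $R^{\otimes m}$ to the control qubits and measure them in the computational basis. Compressed scheme. For $n\le m$ encode $x=0^{s_1}1\cdots0^{s_h}10^t\in\{0,1\}^n$ with $h\le k+1$ as $C^k_n|x\rangle=|s_1,\dots,s_h,n,\dots,n\rangle\in(\mathbb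 C^{m+1})^{\otimes(k+1)}$. Let $q$ be a power of two with $q\ge m+\beta^{-2}\log(1/\varepsilon)$, let $|\phi_p\rangle=\sum_{s<p}\beta\alpha^s|s\rangle+\alpha^p|p\rangle$, and let $A$ be the circuit with $A|0\rangle=|\phi_q\rangle$ (a one-qubit gate $|0\rangle\mapsto\sqrt{1-\alpha^{2q}}|0\rangle+\alpha^q|1\rangle$ on the leading qubit, then controlled on it being $0$ the gates $\frac1{\sqrt{1+\gamma^2}}\begin{pmatrix}1&-\gamma\\ \gamma&1\end{pmatrix}$ with $\gamma=\alpha^{2^j}$ on the qubits of significance $2^j$). The preparation procedure yields, on registers and error flag, the unit vector $$|v_n\rangle=\sum_{|x|\le k}\alpha^{n-|x|}\beta^{|x|}\,C^k_n|x\rangle\otimes A^\dagger|\phi_{q-t(x)}\rangle+\sum_{|x|=k+1}\alpha^{s_1+\cdots+s_{k+1}}\beta^{k+1}\,C^k_n|x\rangle\otimes|0\rangle ,$$ where $x$ ranges over $\{0,1\}^n$ and $t(x)$ is the number of trailing zeros of $x$. The scheme prepares $|v_m\rangle|\zeta\rangle$, applies $\sum_{|x|\le k+1}i^{|x|}C^k_m|x\rangle\langle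 x|(C^k_m)^\dagger\otimes W^{(k')}_x$, discards the flag, and measures recursively. On a register holding $n$ encoded qubits it appends a flag in state $|0\rangle$, measures $\{|v_n\rangle\langle v_n|,\,I-|v_n\rangle\langle v_n|\}$ and discards the flag. On the first result it reports $n$ zeros. On the second result it reports a one if $n=1$, and otherwise splits $C^k_n|x_1x_2\rangle\mapsto C^k_{n/2}|x_1\rangle\otimes C^k_{n/2}|x_2\rangle$ and measures the two halves in turn. It stops as soon as $k'$ ones have been located, and reports zeros for the remaining positions. Let $p_{\mathbf b}$ be the probability of result $\mathbf b\in\{0,1\}^m$ and $\rho_{\mathbf b}$ the state of the target after it, with superscript $\circ$ for the uncompressed and $c$ for the compressed scheme, and let $$D_{\rm av}=\sum_{\mathbf b}\bigl\|p^{\circ}_{\mathbf b}\rho^{\circ}_{\mathbf b}-p^{c}_{\mathbf b}\rho^{c}_{\mathbf b}\bigr\|_{\rm tr}.$$ Theorem (improved error bounds). Let $0<\varepsilon,\varepsilon'<1/2$, and let the cutoffs be chosen as $k=\Theta\bigl(\frac{\log(1/\varepsilon)}{\log\log(1/\varepsilon)}\bigr)$ and $k'=\Theta\bigl(\frac{\log(1/\varepsilon')}{\log\log(1/\varepsilon')}\bigr)$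 with sufficiently large implied constants. If $\varepsilon=O(1/(k'\log m))$, then $$D_{\rm av}=O(\varepsilon'+\varepsilon\log m).$$ Precisely: there is an absolute constant $a>0$ such that for all $B,c$ there is $C=C(B,c)$ such that, for all parameters as above with $\beta^2m\le B$, $k\ge a\frac{\log(1/\varepsilon)}{\log\log(1/\varepsilon)}$, $k'\ge a\frac{\log(1/\varepsilon')}{\log\log(1/\varepsilon')}$ and $\varepsilon\,k'\log m\le c$, one has $D_{\rm av}\le C(\varepsilon'+\varepsilon\log m)$. -/

import Mathlib

open scoped Matrix Kronecker

noncomputable section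

namespace CompressedQuery

universe u

/-! ### Bit strings -/

/-- Bit strings of length `n`. -/
abbrev Bits (n : ℕ) := Fin n → Fin 2

/-- Hamming weight. -/
def wt {n : ℕ} (x : Bits n) : ℕ := (Finset.univ.filter fun j => x j = 1).card

/-- The number of ones strictly before position `j` (positions are counted from `0`). -/
def onesBefore {n : ℕ} (x : Bits n) (j : ℕ) : ℕ :=
  (Finset.univ.filter fun i : Fin n => i.val < j ∧ x i = 1).card

/-- Writing `x = 0^{s 0} 1 0^{s 1} 1 ⋯ 0^{s (h-1)} 1 0^t` with `h = wt x`, this is `s i` for `i < h`,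
and it is `t` for `i = h`. -/
def gap {n : ℕ} (x : Bits n) (i : ℕ) : ℕ :=
  (Finset.univ.filter fun j : Fin n => x j = 0 ∧ onesBefore x j.val = i).card

/-- The first half of a string of length `2 ^ (r + 1)`. -/
def fstHalf {r : ℕ} (x : Bits (2 ^ (r + 1))) : Bits (2 ^ r) :=
  fun i => x ⟨i.val, by have := i.isLt; rw [pow_succ]; omega⟩

/-- The second half of a string of length `2 ^ (r + 1)`. -/
def sndHalf {r : ℕ} (x : Bits (2 ^ (r + 1))) : Bits (2 ^ r) :=
  fun i => x ⟨2 ^ r + i.val, by have := i.isLt; rw [pow_succ]; omega⟩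

/-! ### Linear algebra -/

/-- The trace norm: the sum of the singular values. -/
def traceNorm {T : Type u} [Fintype T] [DecidableEq T] (A : Matrix T T ℂ) : ℝ :=
  ∑ i, √((Matrix.isHermitian_conjTranspose_mul_self A).eigenvalues i)

/-- The (unnormalised) pure state `|v⟩⟨v|`. -/
def proj {A : Type u} (v : A → ℂ) : Matrix A A ℂ := Matrix.vecMulVec v (star v)

/-- The partial trace over the first factor. -/
def trFst {A : Type*} {E : Type u} [Fintype A] (σ : Matrix (A × E) (A × E) ℂ) : Matrix E E ℂ :=
  Matrix.of fun e e' => ∑ a, σ (a, e) (a, e')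

/-- `(K ⊗ I) σ (K ⊗ I)†`. -/
def conjFst {A B : Type*} {E : Type u} [Fintype B] [Fintype E] [DecidableEq E]
    (K : Matrix A B ℂ) (σ : Matrix (B × E) (B × E) ℂ) : Matrix (A × E) (A × E) ℂ :=
  (K ⊗ₖ (1 : Matrix E E ℂ)) * σ * (K ⊗ₖ (1 : Matrix E E ℂ))ᴴ

/-- The `n`-fold tensor power of a one-qubit operator. -/
def tpow (A : Matrix (Fin 2) (Fin 2) ℂ) (n : ℕ) : Matrix (Bits n) (Bits n) ℂ :=
  Matrix.of fun x y => ∏ j, A (x j) (y j)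

/-! ### The segment circuit on uncompressed control qubits -/

/-- `α`, with `α ^ 2 + β ^ 2 = 1`. -/
def alpha (β : ℝ) : ℝ := √(1 - β ^ 2)

def gateR (β : ℝ) : Matrix (Fin 2) (Fin 2) ℂ :=
  !![(alpha β : ℂ), (β : ℂ); (β : ℂ), -(alpha β : ℂ)]

def gateP : Matrix (Fin 2) (Fin 2) ℂ := !![1, 0; 0, Complex.I]

/-- The operation on the target controlled by the string `x`, up to time step `j`: the driving
evolutions `V 0, …, V j`, with a query `Q` between `V i` and `V (i + 1)` if `x i = 1`, as long as
fewer than `cap` queries have been made before. -/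
def segment {n : ℕ} {T : Type u} [Fintype T] [DecidableEq T] (V : ℕ → Matrix T T ℂ)
    (Q : Matrix T T ℂ) (cap : ℕ) (x : Bits n) : ℕ → Matrix T T ℂ
  | 0 => V 0
  | j + 1 => V (j + 1) *
      (if (∃ h : j < n, x ⟨j, h⟩ = 1) ∧ onesBefore x j < cap then Q else 1) *
        segment V Q cap x j

/-- The target operation of the whole segment controlled by the string `x`. -/
def targetOp {n : ℕ} {T : Type u} [Fintype T] [DecidableEq T] (V : ℕ → Matrix T T ℂ)
    (Q : Matrix T T ℂ) (cap : ℕ) (x : Bits n) : Matrix T T ℂ :=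
  segment V Q cap x n

/-- The controlled target operation on uncompressed control qubits. -/
def uncCtrl (n : ℕ) {T : Type u} [Fintype T] [DecidableEq T] (V : ℕ → Matrix T T ℂ)
    (Q : Matrix T T ℂ) (cap : ℕ) : Matrix (Bits n × T) (Bits n × T) ℂ :=
  Matrix.of fun p p' => if p.1 = p'.1 then targetOp V Q cap p.1 p.2 p'.2 else 0

/-- The joint state `R^{⊗n} · Ctrl · (P R)^{⊗n} |0^n⟩|ζ⟩` just before the control qubits are measured
in the computational basis. -/
def uncState (β : ℝ) (n : ℕ) {T : Type u} [Fintype T] [DecidableEq T] (V : ℕ → Matrix T T ℂ)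
    (Q : Matrix T T ℂ) (cap : ℕ) (ζ : T → ℂ) : Bits n × T → ℂ :=
  (tpow (gateR β) n ⊗ₖ (1 : Matrix T T ℂ)) *ᵥ
    (uncCtrl n V Q cap *ᵥ
      ((tpow (gateP * gateR β) n ⊗ₖ (1 : Matrix T T ℂ)) *ᵥ
        fun p => if p.1 = 0 then ζ p.2 else 0))

/-- `p_b ρ_b` for the uncompressed scheme: the probability of the result `b` times the state of the
target after that result. -/
def uncOut (β : ℝ) (n : ℕ) {T : Type u} [Fintype T] [DecidableEq T] (V : ℕ → Matrix T T ℂ)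
    (Q : Matrix T T ℂ) (cap : ℕ) (ζ : T → ℂ) (b : Bits n) : Matrix T T ℂ :=
  proj fun t => uncState β n V Q cap ζ (b, t)

/-! ### The succinct encoding -/

/-- The computational basis of the `k + 1` registers `(ℂ^{m+1})^{⊗(k+1)}`. -/
abbrev Reg (k m : ℕ) := Fin (k + 1) → Fin (m + 1)

/-- The encoding `C_n^k`, stored in registers of dimension `m + 1` where `n ≤ m`:
`x ↦ (s 0, …, s (h-1), n, …, n)`; if `wt x > k + 1` only the first `k + 1` ones are encoded. -/
def enc (k m : ℕ) {n : ℕ} (x : Bits n) : Reg k m :=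
  fun i => if i.val < wt x then Fin.ofNat (m + 1) (gap x i.val) else Fin.ofNat (m + 1) n

/-! ### Preparation of the succinct state

`q = 2 ^ ρ`, and a register of the preparation procedure consists of `ρ + 1` qubits. -/

/-- Computational basis of `ρ + 1` qubits; the first component is the most significant qubit. -/
abbrev Flag (ρ : ℕ) := Fin 2 × (Fin ρ → Fin 2)

/-- The number in `{0, …, 2 ^ (ρ + 1) - 1}` that a basis state represents. -/
def flagVal {ρ : ℕ} (f : Flag ρ) : ℕ := f.1.val * 2 ^ ρ + ∑ j, (f.2 j).val * 2 ^ j.val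

/-- The exponential superposition `|φ_p⟩ = ∑_{s<p} β α^s |s⟩ + α^p |p⟩`. -/
def expState (β : ℝ) (ρ p : ℕ) : Flag ρ → ℂ := fun f =>
  if flagVal f < p then ((β * alpha β ^ flagVal f : ℝ) : ℂ)
  else if flagVal f = p then ((alpha β ^ p : ℝ) : ℂ) else 0

/-- The one-qubit gate `M(γ)`. -/
def gateM (γ : ℝ) : Matrix (Fin 2) (Fin 2) ℂ :=
  ((1 / √(1 + γ ^ 2) : ℝ) : ℂ) • !![1, -(γ : ℂ); (γ : ℂ), 1]

/-- The one-qubit gate taking `|0⟩` to `√(1-α^{2q}) |0⟩ + α^q |1⟩`. -/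
def gateW (β : ℝ) (ρ : ℕ) : Matrix (Fin 2) (Fin 2) ℂ :=
  !![(√(1 - alpha β ^ (2 * 2 ^ ρ)) : ℂ), -((alpha β ^ (2 ^ ρ) : ℝ) : ℂ);
     ((alpha β ^ (2 ^ ρ) : ℝ) : ℂ), (√(1 - alpha β ^ (2 * 2 ^ ρ)) : ℂ)]

/-- The circuit preparing `|φ_q⟩` from `|0⟩`: `gateW` on the first qubit, then `M(α^{2^j})` on the
qubit of significance `2 ^ j`, for all `j < ρ`, controlled by the first qubit being `0`. -/
def expPrep (β : ℝ) (ρ : ℕ) : Matrix (Flag ρ) (Flag ρ) ℂ :=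
  Matrix.of fun f g => gateW β ρ f.1 g.1 *
    (if f.1 = 0 then ∏ j : Fin ρ, gateM (alpha β ^ (2 ^ j.val)) (f.2 j) (g.2 j)
     else if f.2 = g.2 then 1 else 0)

/-- The amplitude of the codeword of `x`, `wt x ≤ k + 1`, in the succinct state: `α^{n-|x|} β^{|x|}` if
`|x| ≤ k`, and `α^{s 0 + ⋯ + s k} β^{k+1}` if `|x| = k + 1`. -/
def prepAmp (β : ℝ) (k : ℕ) {n : ℕ} (x : Bits n) : ℝ :=
  if wt x ≤ k then alpha β ^ (n - wt x) * β ^ wt x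
  else alpha β ^ (∑ i ∈ Finset.range (k + 1), gap x i) * β ^ (k + 1)

/-- The state of the error-flag register that goes with the codeword of `x`. If `|x| ≤ k`, it is what
is left of register `|x| + 1`, in the state `|φ_{q-t}⟩` with `t` the number of trailing zeros of `x`,
when the preparation of `|φ_q⟩` is inverted on it. If `|x| = k + 1`, it is `|0⟩`. -/
def prepFlag (β : ℝ) (k ρ : ℕ) {n : ℕ} (x : Bits n) : Flag ρ → ℂ :=
  if wt x ≤ k then (expPrep β ρ)ᴴ *ᵥ expState β ρ (2 ^ ρ - gap x (wt x))
  else fun f => if f = 0 then 1 else 0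

/-- The state `Ũ_n C_n^k|0^n⟩|0⟩` of the registers and the error flag that the preparation
procedure yields (exponential superpositions in `k + 1` registers, then clean-up). -/
def prepVec (β : ℝ) (k m ρ n : ℕ) : Reg k m × Flag ρ → ℂ := fun p =>
  ∑ x : Bits n, if wt x ≤ k + 1 ∧ enc k m x = p.1
    then (prepAmp β k x : ℂ) * prepFlag β k ρ x p.2 else 0

/-! ### The compressed scheme -/

/-- Phase gates, driving operations and queries on the compressed control register. -/
def compCtrl (k m n : ℕ) {T : Type u} [Fintype T] [DecidableEq T] (V : ℕ → Matrix T T ℂ)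
    (Q : Matrix T T ℂ) (cap : ℕ) : Matrix (Reg k m × T) (Reg k m × T) ℂ :=
  Matrix.of fun p p' => ∑ x : Bits n,
    if wt x ≤ k + 1 ∧ enc k m x = p.1 ∧ enc k m x = p'.1
    then Complex.I ^ wt x * targetOp V Q cap x p.2 p'.2 else 0

/-- The state of the compressed control register and the target before the measurement (the error
flag of the preparation is traced out). -/
def compState (β : ℝ) (k m ρ n : ℕ) {T : Type u} [Fintype T] [DecidableEq T]
    (V : ℕ → Matrix T T ℂ) (Q : Matrix T T ℂ) (cap : ℕ) (ζ : T → ℂ) :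
    Matrix (Reg k m × T) (Reg k m × T) ℂ :=
  ∑ f : Flag ρ, proj (compCtrl k m n V Q cap *ᵥ fun p => prepVec β k m ρ n (p.1, f) * ζ p.2)

/-- The two projections, for results `0` and `1`, of the elementary measurement on registers and a
fresh error flag: with `Π = C|0^n⟩⟨0^n|C† ⊗ |0⟩⟨0|`, these are `Ũ_n Π Ũ_n† = |v⟩⟨v|`
for `v = Ũ_n C|0^n⟩|0⟩`, and its complement. -/
def measOp (β : ℝ) (k m ρ n : ℕ) (d : Fin 2) :
    Matrix (Reg k m × Flag ρ) (Reg k m × Flag ρ) ℂ :=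
  if d = 0 then proj (prepVec β k m ρ n) else 1 - proj (prepVec β k m ρ n)

/-- The unnormalised state after result `d` of the elementary measurement: the flag is appended in
`|0⟩`, the projection is applied, and the flag is traced out. -/
def measStep (β : ℝ) (k m ρ n : ℕ) {E : Type u} [Fintype E] [DecidableEq E] (d : Fin 2)
    (σ : Matrix (Reg k m × E) (Reg k m × E) ℂ) : Matrix (Reg k m × E) (Reg k m × E) ℂ :=
  ∑ f : Flag ρ, conjFst (Matrix.of fun c c' => measOp β k m ρ n d (c, f) (c', 0)) σ

/-- The splitting `C_{2n}^k|x₁x₂⟩ ↦ C_n^k|x₁⟩ ⊗ C_n^k|x₂⟩` on codewords, `n = 2 ^ r`. -/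
def splitOp (k m r : ℕ) : Matrix (Reg k m × Reg k m) (Reg k m) ℂ :=
  Matrix.of fun p c => ∑ x : Bits (2 ^ (r + 1)),
    if wt x ≤ k + 1 ∧ enc k m x = c ∧ enc k m (fstHalf x) = p.1 ∧ enc k m (sndHalf x) = p.2
    then 1 else 0

/-- Apply the splitting to the first register. -/
def split (k m r : ℕ) {E : Type u} [Fintype E] [DecidableEq E]
    (σ : Matrix (Reg k m × E) (Reg k m × E) ℂ) :
    Matrix (Reg k m × (Reg k m × E)) (Reg k m × (Reg k m × E)) ℂ :=
  (conjFst (splitOp k m r) σ).submatrix (Equiv.prodAssoc _ _ _).symm (Equiv.prodAssoc _ _ _).symm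

/-- The recursive measurement of a register holding `2 ^ r` encoded qubits, which stops when `budget`
ones have been located (the remaining positions are then reported as zeros). For a joint state `σ` of
the register and the rest of the system, `measure r budget σ b` is the probability of the result `b`
times the state of the rest after that result. -/
def measure (β : ℝ) (k m ρ : ℕ) : (r : ℕ) → (budget : ℕ) → {E : Type u} → [Fintype E] →
    [DecidableEq E] → Matrix (Reg k m × E) (Reg k m × E) ℂ → Bits (2 ^ r) → Matrix E E ℂ
  | _, 0, _, _, _, σ, b => if b = 0 then trFst σ else 0
  | 0, _ + 1, _, _, _, σ, b => trFst (measStep β k m ρ 1 (b 0) σ)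
  | r + 1, budget + 1, _, _, _, σ, b =>
      (if b = 0 then trFst (measStep β k m ρ (2 ^ (r + 1)) 0 σ) else 0) +
        measure β k m ρ r (budget + 1 - wt (fstHalf b))
          (measure β k m ρ r (budget + 1)
            (split k m r (measStep β k m ρ (2 ^ (r + 1)) 1 σ)) (fstHalf b))
          (sndHalf b)

/-- `p_b ρ_b` for the compressed scheme with `m = 2 ^ r` control qubits, at most `k'` queries and at
most `k'` located ones. -/
def compOut (β : ℝ) (k k' ρ r : ℕ) {T : Type u} [Fintype T] [DecidableEq T]
    (V : ℕ → Matrix T T ℂ) (Q : Matrix T T ℂ) (ζ : T → ℂ) (b : Bits (2 ^ r)) : Matrix T T ℂ :=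
  measure β k (2 ^ r) ρ r k' (compState β k (2 ^ r) ρ (2 ^ r) V Q k' ζ) b

/-- `D_av = ∑_b ‖p_b^∘ ρ_b^∘ - p_b^c ρ_b^c‖_tr`; `cap` bounds the number of queries in the
uncompressed circuit. -/
def Dav (β : ℝ) (k k' cap ρ r : ℕ) {T : Type u} [Fintype T] [DecidableEq T]
    (V : ℕ → Matrix T T ℂ) (Q : Matrix T T ℂ) (ζ : T → ℂ) : ℝ :=
  ∑ b : Bits (2 ^ r), traceNorm (uncOut β (2 ^ r) V Q cap ζ b - compOut β k k' ρ r V Q ζ b)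

/-- `log (1/ε) / log log (1/ε)`, logarithms to base `2`. -/
def cutoff (ε : ℝ) : ℝ := Real.logb 2 (1 / ε) / Real.logb 2 (Real.logb 2 (1 / ε))

end CompressedQuery

end

/-!
The output of the recursive measurement is studied in the Heisenberg picture. Whatever system the
register is entangled with, the measurement acts on the register through a family of positive
matrices summing to the identity, its effects (`measure_eq_effectOut`, `sum_treeEffect`), so it
suffices to compare effects. Conjugating by the isometric encoding turns the register effects
*exactly* into the effects of a recursive measurement on uncompressed qubits, because splitting a
codeword is splitting a bit string and no string that survives the first projection has more than
`k + 1` ones (`regEffect_pullback`). In the basis rotated by `R^{⊗n}` the state `R^{⊗n}|0^n⟩` that an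
elementary measurement is meant to test for is the basis vector `|0^n⟩`. With exact tests the whole
recursive measurement is therefore diagonal there: it reads off the bit string and forgets the ones
that come after the first `k'` (`locateEffect`), which is the uncompressed measurement on strings of
weight at most `k'`.

The schemes are separated by the cap on the number of queries, the stop after `k'` located ones, the
imperfect elementary measurements and the imperfect preparation (`Dav_le`).

* The cap and the stop matter only on strings of weight more than `k'`, the cap before and the stop
  after the final rotation. Each marginal "the bits in `S` are one" has probability at most
  `(4 β²)^|S|` after it, whatever the target does in between (`rotVec_marginal_le`), and probability
  `β^(2|S|)` before it, so a union bound over `S` bounds the weight of these strings by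
  `(4 β² m)^(k'+1) / (k'+1)!` (`tail_le`).
* The state that is really tested for is `|v_n⟩`, a unit vector (`sum_prepAmp_full`,
  `prepFlag_norm`). Its component with the flag at `0` differs from the product state in the Poisson
  tail beyond `k` ones and in the amplitude, between `1 - α^{2(q-t)}` and `1`, that inverting the
  preparation of `|φ_q⟩` on `|φ_{q-t}⟩` leaves at `0`; both differences are small by the choice of
  `k` and `q` (`sum_prepCoeff_sub_bitAmp_le`, `alpha_pow_le`). The remaining components have weight
  `O(ε)`, and as the flag is discarded they enter linearly and not through their square root. So
  every elementary measurement costs `O(ε)` (`effectsClose_krausOf`).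
* The recursion makes at most `1 + 2 r |x|` elementary measurements on the basis state `x`, and the
  errors add up to the *operator* `errOp`, diagonal with entries proportional to these numbers
  (`effectsClose_treeEffect`). Its expectation involves only the mean weight, at most `4 β² m`
  (`mean_wt_le`), and not the cap `k'`. Hence all measurements together cost `O(ε log m)`.
* Starting from `|v_m⟩` in place of the product state costs `O(ε)` once more.

The cutoffs enter through `N^N / N! ≤ e^N`: if `N` exceeds a multiple of `log(1/ε) / log log(1/ε)`
then `N^N ≥ ε⁻⁴`, so that `A^N / N! = O(ε²)` for every fixed `A` (`pow_div_factorial_le_of_cutoff`).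

Differences of outputs are always recorded as differences of positive matrices with small total
trace (`EffectsClose`, `OutputsClose`); such pairs compose along the recursion, and they bound the
trace norm by `traceNorm_sub_le`.
-/

noncomputable section

namespace CompressedQuery

universe u

set_option linter.unusedSectionVars false

open scoped MatrixOrder ComplexOrder

/-! ### The trace norm of a difference of positive matrices -/

theorem traceNorm_sub_le {T : Type u} [Fintype T] [DecidableEq T] {P N : Matrix T T ℂ}
    (hP : P.PosSemidef) (hN : N.PosSemidef) :
    traceNorm (P - N) ≤ (P.trace + N.trace).re := by
  set A := P - N with hA
  set h := Matrix.isHermitian_conjTranspose_mul_self A with hh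
  set lam := h.eigenvalues with hlam
  have hlam0 : ∀ i, 0 ≤ lam i := Matrix.eigenvalues_conjTranspose_mul_self_nonneg A
  set V : Matrix T T ℂ := h.eigenvectorUnitary.1 with hV
  have hVV : Vᴴ * V = 1 := Matrix.mem_unitaryGroup_iff'.mp h.eigenvectorUnitary.2
  have hVV' : V * Vᴴ = 1 := Matrix.mem_unitaryGroup_iff.mp h.eigenvectorUnitary.2
  have hsp : Aᴴ * A = V * Matrix.diagonal (fun i => (lam i : ℂ)) * Vᴴ := by
    have := h.spectral_theorem
    rw [Unitary.conjStarAlgAut_apply] at this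
    exact this
  set D : Matrix T T ℂ := Matrix.diagonal (fun i => (((√(lam i))⁻¹ : ℝ) : ℂ)) with hD
  have hDh : Dᴴ = D := by
    rw [hD, Matrix.diagonal_conjTranspose]; congr 1; ext i; simp
  set W := A * V * D with hW
  have hWA : Wᴴ * A * V = Matrix.diagonal (fun i => ((√(lam i) : ℝ) : ℂ)) := by
    have : Wᴴ * A * V = D * (Vᴴ * (Aᴴ * A) * V) := by
      rw [hW, Matrix.conjTranspose_mul, Matrix.conjTranspose_mul, hDh]
      simp only [Matrix.mul_assoc]
    rw [this, hsp]
    have e : Vᴴ * (V * Matrix.diagonal (fun i => (lam i : ℂ)) * Vᴴ) * V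
        = (Vᴴ * V) * Matrix.diagonal (fun i => (lam i : ℂ)) * (Vᴴ * V) := by
      simp only [Matrix.mul_assoc]
    rw [e, hVV, Matrix.one_mul, Matrix.mul_one, hD, Matrix.diagonal_mul_diagonal]
    congr 1; ext i
    rw [← Complex.ofReal_mul]
    congr 1
    rcases (hlam0 i).eq_or_lt with h0 | h0
    · simp [← h0]
    · nth_rw 2 [← Real.mul_self_sqrt h0.le]
      have := (Real.sqrt_pos.mpr h0).ne'
      field_simp
  have hWW : Wᴴ * W = Matrix.diagonal (fun i => if lam i = 0 then (0 : ℂ) else 1) := by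
    have : Wᴴ * W = Wᴴ * A * V * D := by rw [hW]; simp only [Matrix.mul_assoc]
    rw [this, hWA, hD, Matrix.diagonal_mul_diagonal]
    congr 1; ext i
    split_ifs with h0
    · simp [h0]
    · have h1 : √(lam i) ≠ 0 := (Real.sqrt_pos.mpr (lt_of_le_of_ne (hlam0 i) (Ne.symm h0))).ne'
      rw [← Complex.ofReal_mul, mul_inv_cancel₀ h1, Complex.ofReal_one]
  have hWD : W * (Wᴴ * W) = W := by
    rw [hWW]
    conv_lhs => rw [hW]
    conv_rhs => rw [hW]
    rw [Matrix.mul_assoc, hD, Matrix.diagonal_mul_diagonal]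
    congr 2; ext i
    split_ifs with h0 <;> simp [h0]
  set F := W * Wᴴ with hF
  have hFh : Fᴴ = F := by simp [hF]
  have hFF : F * F = F := by
    calc F * F = W * (Wᴴ * W) * Wᴴ := by simp only [hF, Matrix.mul_assoc]
      _ = F := by rw [hWD]
  have key : ∀ X : Matrix T T ℂ, X.PosSemidef → (Wᴴ * X * W).trace.re ≤ X.trace.re := by
    intro X hX
    have h1 := (hX.conjTranspose_mul_mul_same (1 - F)).trace_nonneg
    have h2 : ((1 - F)ᴴ * X * (1 - F)).trace = X.trace - (Wᴴ * X * W).trace := by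
      have e1 : ((1 - F)ᴴ * X * (1 - F)).trace = (X * ((1 - F) * (1 - F))).trace := by
        rw [Matrix.conjTranspose_sub, hFh, Matrix.conjTranspose_one, Matrix.mul_assoc,
          Matrix.trace_mul_comm, Matrix.mul_assoc]
      have e2 : (1 - F) * (1 - F) = 1 - F := by
        rw [Matrix.sub_mul, Matrix.mul_sub, Matrix.mul_sub, hFF]; simp
      have e3 : (Wᴴ * X * W).trace = (X * F).trace := by
        rw [Matrix.mul_assoc, Matrix.trace_mul_comm, Matrix.mul_assoc]
      rw [e1, e2, e3, Matrix.mul_sub, Matrix.mul_one, Matrix.trace_sub]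
    rw [h2] at h1
    have := (Complex.le_def.mp h1).1
    simp only [Complex.zero_re, Complex.sub_re] at this
    linarith
  have keyV : ∀ X : Matrix T T ℂ, (Vᴴ * X * V).trace = X.trace := by
    intro X
    rw [Matrix.mul_assoc, Matrix.trace_mul_comm, Matrix.mul_assoc, hVV', Matrix.mul_one]
  have cross : ∀ X : Matrix T T ℂ, X.PosSemidef →
      (Vᴴ * X * W).trace.re = (Wᴴ * X * V).trace.re := by
    intro X hX
    have : (Vᴴ * X * W) = (Wᴴ * X * V)ᴴ := by
      rw [Matrix.conjTranspose_mul, Matrix.conjTranspose_mul, hX.1.eq,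
        Matrix.conjTranspose_conjTranspose, Matrix.mul_assoc]
    rw [this, Matrix.trace_conjTranspose]; simp
  have hPc := (Complex.le_def.mp (hP.conjTranspose_mul_mul_same (V - W)).trace_nonneg).1
  have hNc := (Complex.le_def.mp (hN.conjTranspose_mul_mul_same (V + W)).trace_nonneg).1
  simp only [Matrix.conjTranspose_sub, Matrix.conjTranspose_add, Matrix.sub_mul, Matrix.mul_sub,
    Matrix.add_mul, Matrix.mul_add, Matrix.trace_sub, Matrix.trace_add, Complex.sub_re,
    Complex.add_re, Complex.zero_re, keyV, cross P hP, cross N hN] at hPc hNc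
  have htn : traceNorm A = (Wᴴ * A * V).trace.re := by
    rw [hWA, Matrix.trace_diagonal, ← Complex.ofReal_sum, Complex.ofReal_re]
    rfl
  have hsplit : (Wᴴ * A * V).trace.re = (Wᴴ * P * V).trace.re - (Wᴴ * N * V).trace.re := by
    rw [hA, Matrix.mul_sub, Matrix.sub_mul, Matrix.trace_sub, Complex.sub_re]
  have k1 := key P hP
  have k2 := key N hN
  rw [htn, hsplit, Complex.add_re]
  linarith

/-! ### Outputs of a measurement given by effects -/

section Effects

variable {A B E ι : Type*} [Fintype A] [Fintype B]

/-- The unnormalised state of the second system when a destructive measurement of the first system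
gives the outcome of the effect `G`, namely the partial trace of `(G ⊗ 1) σ`. -/
def effectOut (G : Matrix A A ℂ) (σ : Matrix (A × E) (A × E) ℂ) : Matrix E E ℂ :=
  Matrix.of fun e e' => ∑ x, ∑ a, G x a * σ (a, e) (x, e')

theorem effectOut_apply (G : Matrix A A ℂ) (σ : Matrix (A × E) (A × E) ℂ) (e e' : E) :
    effectOut G σ e e' = ∑ x, ∑ a, G x a * σ (a, e) (x, e') := rfl

theorem effectOut_add (G H : Matrix A A ℂ) (σ : Matrix (A × E) (A × E) ℂ) :
    effectOut (G + H) σ = effectOut G σ + effectOut H σ := by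
  ext; simp [effectOut_apply, add_mul, Finset.sum_add_distrib]

theorem effectOut_sub (G H : Matrix A A ℂ) (σ : Matrix (A × E) (A × E) ℂ) :
    effectOut (G - H) σ = effectOut G σ - effectOut H σ := by
  ext; simp [effectOut_apply, sub_mul, Finset.sum_sub_distrib]

theorem effectOut_sub_right (G : Matrix A A ℂ) (σ τ : Matrix (A × E) (A × E) ℂ) :
    effectOut G (σ - τ) = effectOut G σ - effectOut G τ := by
  ext; simp [effectOut_apply, mul_sub, Finset.sum_sub_distrib]

theorem effectOut_zero (σ : Matrix (A × E) (A × E) ℂ) : effectOut 0 σ = 0 := by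
  ext; simp [effectOut_apply]

theorem effectOut_sum (s : Finset ι) (G : ι → Matrix A A ℂ) (σ : Matrix (A × E) (A × E) ℂ) :
    effectOut (∑ i ∈ s, G i) σ = ∑ i ∈ s, effectOut (G i) σ := by
  classical
  induction s using Finset.induction_on with
  | empty => simp [effectOut_zero]
  | insert i s hi ih => rw [Finset.sum_insert hi, Finset.sum_insert hi, effectOut_add, ih]

theorem effectOut_sum_right (s : Finset ι) (G : Matrix A A ℂ)
    (σ : ι → Matrix (A × E) (A × E) ℂ) :
    effectOut G (∑ i ∈ s, σ i) = ∑ i ∈ s, effectOut G (σ i) := by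
  ext e e'
  simp only [effectOut_apply, Matrix.sum_apply, Finset.mul_sum]
  rw [Finset.sum_comm]
  rw [Finset.sum_congr rfl fun x _ => Finset.sum_comm]
  rw [Finset.sum_comm]
  rw [Finset.sum_comm]
  rw [Finset.sum_comm]
  exact Finset.sum_congr rfl fun i _ => Finset.sum_comm

theorem trFst_eq_effectOut [DecidableEq A] (σ : Matrix (A × E) (A × E) ℂ) :
    trFst σ = effectOut 1 σ := by
  ext; simp [effectOut_apply, trFst, Matrix.one_apply]

theorem trFst_posSemidef {σ : Matrix (A × E) (A × E) ℂ} (h : σ.PosSemidef) :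
    (trFst σ).PosSemidef := by
  have : trFst σ = ∑ a, σ.submatrix (fun e => (a, e)) (fun e => (a, e)) := by
    ext; simp [trFst, Matrix.sum_apply]
  rw [this]
  exact Matrix.posSemidef_sum _ fun a _ => h.submatrix _

theorem conjFst_apply [Fintype E] [DecidableEq E] (K : Matrix A B ℂ) (σ : Matrix (B × E) (B × E) ℂ)
    (a a' : A) (e e' : E) :
    conjFst K σ (a, e) (a', e') = ∑ b, ∑ b', K a b * σ (b, e) (b', e') * star (K a' b') := by
  simp only [conjFst, Matrix.mul_apply, Matrix.conjTranspose_apply, Matrix.kronecker_apply,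
    Fintype.sum_prod_type, Matrix.one_apply, Finset.sum_mul, mul_ite, mul_one, mul_zero, ite_mul,
    zero_mul, Finset.sum_ite_eq, Finset.mem_univ, if_true, apply_ite (star : ℂ → ℂ), star_zero]
  simp only [Finset.sum_ite_irrel, Finset.sum_const_zero, Finset.sum_ite_eq, Finset.mem_univ,
      if_true]
  exact Finset.sum_comm

theorem effectOut_conjFst [Fintype E] [DecidableEq E] (G : Matrix A A ℂ) (K : Matrix A B ℂ)
    (σ : Matrix (B × E) (B × E) ℂ) :
    effectOut G (conjFst K σ) = effectOut (Kᴴ * G * K) σ := by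
  ext e e'
  simp only [effectOut_apply, conjFst_apply, Matrix.mul_apply, Matrix.conjTranspose_apply,
    Finset.sum_mul, Finset.mul_sum]
  rw [← Fintype.sum_prod_type', ← Fintype.sum_prod_type', ← Fintype.sum_prod_type',
    ← Fintype.sum_prod_type', ← Fintype.sum_prod_type', ← Fintype.sum_prod_type']
  refine Fintype.sum_equiv ⟨fun p => (((p.2, p.1.2), p.1.1.2), p.1.1.1),
    fun p => (((p.2, p.1.2), p.1.1.2), p.1.1.1), fun _ => rfl, fun _ => rfl⟩ _ _ ?_
  rintro ⟨⟨⟨x, a⟩, b⟩, b'⟩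
  simp
  ring

theorem effectOut_effectOut (G : Matrix A A ℂ) (H : Matrix B B ℂ)
    (τ : Matrix ((A × B) × E) ((A × B) × E) ℂ) :
    effectOut H (effectOut G
      (τ.submatrix (Equiv.prodAssoc _ _ _).symm (Equiv.prodAssoc _ _ _).symm))
      = effectOut (G ⊗ₖ H) τ := by
  ext e e'
  simp only [effectOut_apply, Matrix.submatrix_apply, Equiv.prodAssoc_symm_apply,
    Fintype.sum_prod_type, Matrix.kronecker_apply, Finset.mul_sum]
  rw [← Fintype.sum_prod_type', ← Fintype.sum_prod_type', ← Fintype.sum_prod_type',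
    ← Fintype.sum_prod_type', ← Fintype.sum_prod_type', ← Fintype.sum_prod_type']
  refine Fintype.sum_equiv ⟨fun p => (((p.1.2, p.1.1.1), p.2), p.1.1.2),
    fun p => (((p.1.1.2, p.2), p.1.1.1), p.1.2), fun _ => rfl, fun _ => rfl⟩ _ _ ?_
  rintro ⟨⟨⟨x, a⟩, b⟩, b'⟩
  simp
  ring

theorem effectOut_posSemidef [DecidableEq A] [Fintype E] [DecidableEq E] {G : Matrix A A ℂ}
    (hG : G.PosSemidef) {σ : Matrix (A × E) (A × E) ℂ} (hσ : σ.PosSemidef) :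
    (effectOut G σ).PosSemidef := by
  obtain ⟨K, hK⟩ := CStarAlgebra.nonneg_iff_eq_star_mul_self.mp hG.nonneg
  have : effectOut G σ = trFst (conjFst K σ) := by
    rw [trFst_eq_effectOut, effectOut_conjFst, Matrix.mul_one, hK, Matrix.star_eq_conjTranspose]
  rw [this]
  exact trFst_posSemidef (hσ.mul_mul_conjTranspose_same _)

theorem trace_effectOut_mono [DecidableEq A] [Fintype E] [DecidableEq E] {G H : Matrix A A ℂ}
    (h : G ≤ H)
    {σ : Matrix (A × E) (A × E) ℂ} (hσ : σ.PosSemidef) :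
    (effectOut G σ).trace.re ≤ (effectOut H σ).trace.re := by
  have h1 := (Complex.le_def.mp
    (effectOut_posSemidef (Matrix.le_iff.mp h) hσ).trace_nonneg).1
  rw [effectOut_sub, Matrix.trace_sub] at h1
  simp only [Complex.zero_re, Complex.sub_re] at h1
  linarith

theorem trace_effectOut_one [DecidableEq A] [Fintype E] (σ : Matrix (A × E) (A × E) ℂ) :
    (effectOut 1 σ).trace = σ.trace := by
  simp only [Matrix.trace, Matrix.diag, effectOut_apply, Matrix.one_apply, Fintype.sum_prod_type]
  rw [Finset.sum_comm]
  simp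

end Effects

/-! ### The Loewner order -/

section Loewner

variable {A B ι : Type*} [Fintype A] [Fintype B] [DecidableEq A] [DecidableEq B]

theorem nonneg_conj {X : Matrix A A ℂ} (h : 0 ≤ X) (K : Matrix A B ℂ) : 0 ≤ Kᴴ * X * K :=
  (Matrix.nonneg_iff_posSemidef.mp h).conjTranspose_mul_mul_same K |>.nonneg

theorem conj_mono {X Y : Matrix A A ℂ} (h : X ≤ Y) (K : Matrix A B ℂ) :
    Kᴴ * X * K ≤ Kᴴ * Y * K := by
  have := nonneg_conj (sub_nonneg.mpr h) K
  rwa [Matrix.mul_sub, Matrix.sub_mul, sub_nonneg] at this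

theorem nonneg_gram (K : Matrix A B ℂ) : 0 ≤ Kᴴ * K :=
  (Matrix.posSemidef_conjTranspose_mul_self K).nonneg

theorem smul_one_mono {c d : ℝ} (h : c ≤ d) : (c : ℂ) • (1 : Matrix A A ℂ) ≤ (d : ℂ) • 1 := by
  rw [← sub_nonneg, ← sub_smul, ← Complex.ofReal_sub]
  exact (Matrix.PosSemidef.one.smul (by exact_mod_cast sub_nonneg.mpr h)).nonneg

theorem smul_mono {c : ℝ} (hc : 0 ≤ c) {X Y : Matrix A A ℂ} (h : X ≤ Y) :
    (c : ℂ) • X ≤ (c : ℂ) • Y := by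
  rw [← sub_nonneg, ← smul_sub]
  exact ((Matrix.le_iff.mp h).smul (by exact_mod_cast hc)).nonneg

theorem smul_nonneg' {c : ℝ} (hc : 0 ≤ c) {X : Matrix A A ℂ} (h : 0 ≤ X) : 0 ≤ (c : ℂ) • X := by
  simpa using smul_mono hc h

theorem nonneg_kronecker {X : Matrix A A ℂ} {Y : Matrix B B ℂ} (hX : 0 ≤ X) (hY : 0 ≤ Y) :
    0 ≤ X ⊗ₖ Y :=
  ((Matrix.nonneg_iff_posSemidef.mp hX).kronecker (Matrix.nonneg_iff_posSemidef.mp hY)).nonneg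

theorem kronecker_mono_left {X X' : Matrix A A ℂ} {Y : Matrix B B ℂ} (h : X ≤ X') (hY : 0 ≤ Y) :
    X ⊗ₖ Y ≤ X' ⊗ₖ Y := by
  have := nonneg_kronecker (sub_nonneg.mpr h) hY
  rw [← sub_nonneg]
  convert this using 1
  ext; simp [sub_mul]

theorem kronecker_mono_right {X : Matrix A A ℂ} {Y Y' : Matrix B B ℂ} (h : Y ≤ Y') (hX : 0 ≤ X) :
    X ⊗ₖ Y ≤ X ⊗ₖ Y' := by
  have := nonneg_kronecker hX (sub_nonneg.mpr h)
  rw [← sub_nonneg]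
  convert this using 1
  ext; simp [mul_sub]

theorem sum_kronecker (s : Finset ι) (X : ι → Matrix A A ℂ) (Y : Matrix B B ℂ) :
    ∑ i ∈ s, X i ⊗ₖ Y = (∑ i ∈ s, X i) ⊗ₖ Y := by
  ext; simp [Matrix.sum_apply, Finset.sum_mul]

theorem kronecker_sum (s : Finset ι) (X : Matrix A A ℂ) (Y : ι → Matrix B B ℂ) :
    ∑ i ∈ s, X ⊗ₖ Y i = X ⊗ₖ (∑ i ∈ s, Y i) := by
  ext; simp [Matrix.sum_apply, Finset.mul_sum]

theorem sum_conj (s : Finset ι) (X : ι → Matrix A A ℂ) (K : Matrix A B ℂ) :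
    ∑ i ∈ s, Kᴴ * X i * K = Kᴴ * (∑ i ∈ s, X i) * K := by
  rw [Matrix.mul_sum, Matrix.sum_mul]

/-- `(X + Y)† (X + Y) ≤ 2 (X† X + Y† Y)`. -/
theorem gram_add_le (X Y : Matrix A B ℂ) :
    (X + Y)ᴴ * (X + Y) ≤ (2 : ℝ) • (Xᴴ * X) + (2 : ℝ) • (Yᴴ * Y) := by
  have h := nonneg_gram (X - Y)
  rw [← sub_nonneg]
  convert h using 1
  simp only [Matrix.conjTranspose_add, Matrix.conjTranspose_sub, Matrix.add_mul, Matrix.mul_add,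
    Matrix.sub_mul, Matrix.mul_sub, two_smul]
  abel

/-- The Cauchy–Schwarz inequality as a bound on a rank-one matrix. -/
theorem proj_le_smul_one (v : A → ℂ) : proj v ≤ ((∑ a, ‖v a‖ ^ 2 : ℝ) : ℂ) • 1 := by
  rw [Matrix.le_iff]
  refine Matrix.PosSemidef.of_dotProduct_mulVec_nonneg ?_ fun x => ?_
  · refine Matrix.IsHermitian.sub ?_ ?_
    · rw [Matrix.IsHermitian, Matrix.conjTranspose_smul, Matrix.conjTranspose_one]
      simp
    · exact (Matrix.posSemidef_vecMulVec_self_star v).1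
  · have e1 : star x ⬝ᵥ (proj v *ᵥ x) = ((‖∑ a, star (v a) * x a‖ ^ 2 : ℝ) : ℂ) := by
      rw [proj, Matrix.vecMulVec_mulVec, dotProduct_smul]
      have : (star v ⬝ᵥ x) = ∑ a, star (v a) * x a := rfl
      have h2 : star x ⬝ᵥ v = star (star v ⬝ᵥ x) := by
        rw [Matrix.star_dotProduct]
      rw [h2, this]
      rw [op_smul_eq_mul, Complex.star_def, Complex.conj_mul']
      push_cast; rfl
    have e2 : star x ⬝ᵥ x = ((∑ a, ‖x a‖ ^ 2 : ℝ) : ℂ) := by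
      simp only [dotProduct, Pi.star_apply, Complex.ofReal_sum]
      refine Finset.sum_congr rfl fun a _ => ?_
      rw [← Complex.normSq_eq_norm_sq, Complex.normSq_eq_conj_mul_self]; rfl
    rw [Matrix.sub_mulVec, dotProduct_sub, e1, Matrix.smul_mulVec, Matrix.one_mulVec,
      dotProduct_smul, e2, smul_eq_mul, ← Complex.ofReal_mul, ← Complex.ofReal_sub]
    refine Complex.zero_le_real.mpr (sub_nonneg.mpr ?_)
    have h1 : ‖∑ a, star (v a) * x a‖ ≤ ∑ a, ‖v a‖ * ‖x a‖ :=
      (norm_sum_le _ _).trans (le_of_eq (Finset.sum_congr rfl fun a _ => by simp))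
    calc ‖∑ a, star (v a) * x a‖ ^ 2 ≤ (∑ a, ‖v a‖ * ‖x a‖) ^ 2 := by gcongr
      _ ≤ _ := Finset.sum_mul_sq_le_sq_mul_sq _ _ _

end Loewner

/-! ### Closeness of measurements and of their outputs -/

section Close

variable {A B E ι κ : Type*} [Fintype A] [Fintype B] [Fintype E] [DecidableEq A] [DecidableEq B]
  [DecidableEq E] [Fintype ι] [Fintype κ]

/-- Two families of effects differ by positive parts whose sum is bounded by the operator `Ω`: the
error of replacing one measurement by the other on a state is at most the expectation of `Ω`. -/
def EffectsClose (F G : ι → Matrix A A ℂ) (Ω : Matrix A A ℂ) : Prop :=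
  ∃ P N : ι → Matrix A A ℂ, (∀ b, 0 ≤ P b) ∧ (∀ b, 0 ≤ N b) ∧ (∀ b, F b - G b = P b - N b) ∧
    ∑ b, (P b + N b) ≤ Ω

/-- Two families of matrices differ by positive parts of total trace at most `c`. -/
def OutputsClose (X Y : ι → Matrix E E ℂ) (c : ℝ) : Prop :=
  ∃ P N : ι → Matrix E E ℂ, (∀ b, 0 ≤ P b) ∧ (∀ b, 0 ≤ N b) ∧ (∀ b, X b - Y b = P b - N b) ∧
    ∑ b, (P b + N b).trace.re ≤ c

theorem EffectsClose.mono {F G : ι → Matrix A A ℂ} {Ω Ω' : Matrix A A ℂ}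
    (h : EffectsClose F G Ω) (hΩ : Ω ≤ Ω') : EffectsClose F G Ω' := by
  obtain ⟨P, N, hP, hN, hd, hs⟩ := h
  exact ⟨P, N, hP, hN, hd, hs.trans hΩ⟩

theorem EffectsClose.refl (F : ι → Matrix A A ℂ) : EffectsClose F F 0 :=
  ⟨fun _ => 0, fun _ => 0, fun _ => le_rfl, fun _ => le_rfl, by simp, by simp⟩

theorem EffectsClose.trans {F G H : ι → Matrix A A ℂ} {Ω Ω' : Matrix A A ℂ}
    (h : EffectsClose F G Ω) (h' : EffectsClose G H Ω') : EffectsClose F H (Ω + Ω') := by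
  obtain ⟨P, N, hP, hN, hd, hs⟩ := h
  obtain ⟨P', N', hP', hN', hd', hs'⟩ := h'
  refine ⟨fun b => P b + P' b, fun b => N b + N' b, fun b => add_nonneg (hP b) (hP' b),
    fun b => add_nonneg (hN b) (hN' b), fun b => ?_, ?_⟩
  · rw [← sub_add_sub_cancel (F b) (G b) (H b), hd, hd']; dsimp only; abel
  · calc ∑ b, (P b + P' b + (N b + N' b)) = ∑ b, (P b + N b) + ∑ b, (P' b + N' b) := by
          rw [← Finset.sum_add_distrib]; exact Finset.sum_congr rfl fun b _ => by abel
      _ ≤ _ := add_le_add hs hs'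

theorem EffectsClose.add {F G F' G' : ι → Matrix A A ℂ} {Ω Ω' : Matrix A A ℂ}
    (h : EffectsClose F G Ω) (h' : EffectsClose F' G' Ω') :
    EffectsClose (fun b => F b + F' b) (fun b => G b + G' b) (Ω + Ω') := by
  obtain ⟨P, N, hP, hN, hd, hs⟩ := h
  obtain ⟨P', N', hP', hN', hd', hs'⟩ := h'
  refine ⟨fun b => P b + P' b, fun b => N b + N' b, fun b => add_nonneg (hP b) (hP' b),
    fun b => add_nonneg (hN b) (hN' b), fun b => ?_, ?_⟩
  · rw [add_sub_add_comm, hd, hd']; dsimp only; abel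
  · calc ∑ b, (P b + P' b + (N b + N' b)) = ∑ b, (P b + N b) + ∑ b, (P' b + N' b) := by
          rw [← Finset.sum_add_distrib]; exact Finset.sum_congr rfl fun b _ => by abel
      _ ≤ _ := add_le_add hs hs'

theorem EffectsClose.conj {F G : ι → Matrix A A ℂ} {Ω : Matrix A A ℂ}
    (h : EffectsClose F G Ω) (K : Matrix A B ℂ) :
    EffectsClose (fun b => Kᴴ * F b * K) (fun b => Kᴴ * G b * K) (Kᴴ * Ω * K) := by
  obtain ⟨P, N, hP, hN, hd, hs⟩ := h
  refine ⟨fun b => Kᴴ * P b * K, fun b => Kᴴ * N b * K, fun b => nonneg_conj (hP b) K,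
    fun b => nonneg_conj (hN b) K, fun b => ?_, ?_⟩
  · rw [← Matrix.sub_mul, ← Matrix.mul_sub, hd, Matrix.mul_sub, Matrix.sub_mul]
  · simp only [← Matrix.add_mul, ← Matrix.mul_add]
    rw [sum_conj]
    exact conj_mono hs K

theorem EffectsClose.comp_equiv {F G : ι → Matrix A A ℂ} {Ω : Matrix A A ℂ}
    (h : EffectsClose F G Ω) (e : κ ≃ ι) :
    EffectsClose (fun b => F (e b)) (fun b => G (e b)) Ω := by
  obtain ⟨P, N, hP, hN, hd, hs⟩ := h
  refine ⟨fun b => P (e b), fun b => N (e b), fun b => hP _, fun b => hN _, fun b => hd _, ?_⟩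
  rwa [e.sum_comp fun b => P b + N b]

/-- Errors of a measurement of a pair, where the second measurement may depend on the first result:
the exact first measurement is performed before the second one is replaced. -/
theorem EffectsClose.kronecker {F G : ι → Matrix A A ℂ} {Ω : Matrix A A ℂ}
    {F' G' : ι → κ → Matrix B B ℂ} {Ω' : Matrix B B ℂ} (h : EffectsClose F G Ω)
    (h' : ∀ a, EffectsClose (F' a) (G' a) Ω') (hF' : ∀ a b, 0 ≤ F' a b)
    (hF'1 : ∀ a, ∑ b, F' a b = 1) (hG : ∀ a, 0 ≤ G a) (hG1 : ∑ a, G a = 1) :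
    EffectsClose (fun p : ι × κ => F p.1 ⊗ₖ F' p.1 p.2) (fun p => G p.1 ⊗ₖ G' p.1 p.2)
      (Ω ⊗ₖ 1 + 1 ⊗ₖ Ω') := by
  obtain ⟨P, N, hP, hN, hd, hs⟩ := h
  choose P' N' hP' hN' hd' hs' using h'
  refine ⟨fun p => P p.1 ⊗ₖ F' p.1 p.2 + G p.1 ⊗ₖ P' p.1 p.2,
    fun p => N p.1 ⊗ₖ F' p.1 p.2 + G p.1 ⊗ₖ N' p.1 p.2,
    fun p => add_nonneg (nonneg_kronecker (hP _) (hF' _ _)) (nonneg_kronecker (hG _) (hP' _ _)),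
    fun p => add_nonneg (nonneg_kronecker (hN _) (hF' _ _)) (nonneg_kronecker (hG _) (hN' _ _)),
    fun p => ?_, ?_⟩
  · have e1 : F p.1 = G p.1 + (P p.1 - N p.1) := by rw [← hd]; abel
    have e2 : G' p.1 p.2 = F' p.1 p.2 - (P' p.1 p.2 - N' p.1 p.2) := by rw [← hd']; abel
    dsimp only
    rw [e1, e2]
    ext ⟨i, j⟩ ⟨i', j'⟩
    simp only [Matrix.sub_apply, Matrix.add_apply, Matrix.kronecker_apply]
    ring
  · have e : ∀ p : ι × κ, P p.1 ⊗ₖ F' p.1 p.2 + G p.1 ⊗ₖ P' p.1 p.2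
        + (N p.1 ⊗ₖ F' p.1 p.2 + G p.1 ⊗ₖ N' p.1 p.2)
        = (P p.1 + N p.1) ⊗ₖ F' p.1 p.2 + G p.1 ⊗ₖ (P' p.1 p.2 + N' p.1 p.2) := by
      intro p
      rw [Matrix.add_kronecker, Matrix.kronecker_add]; abel
    rw [Finset.sum_congr rfl fun p _ => e p, Finset.sum_add_distrib, Fintype.sum_prod_type,
      Fintype.sum_prod_type]
    simp only [kronecker_sum, hF'1]
    rw [sum_kronecker]
    refine add_le_add (kronecker_mono_left hs (by exact Matrix.PosSemidef.one.nonneg)) ?_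
    calc ∑ a, G a ⊗ₖ ∑ b, (P' a b + N' a b) ≤ ∑ a, G a ⊗ₖ Ω' :=
          Finset.sum_le_sum fun a _ => kronecker_mono_right (hs' a) (hG a)
      _ = 1 ⊗ₖ Ω' := by rw [sum_kronecker, hG1]

/-- Perturbing the Kraus operator `S` in front of a measurement: the cross terms are split with the
weights `δ` and `1 / δ`, so that the error is linear in `δ`. -/
theorem EffectsClose.kraus {X : ι → Matrix A A ℂ} (hX : ∀ b, 0 ≤ X b) (hX1 : ∑ b, X b = 1)
    (R S : Matrix A B ℂ) {δ : ℝ} (hδ : 0 < δ) (hS : Sᴴ * S ≤ 1)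
    (hRS : (R - S)ᴴ * (R - S) ≤ ((δ ^ 2 : ℝ) : ℂ) • 1) :
    EffectsClose (fun b => Rᴴ * X b * R) (fun b => Sᴴ * X b * S)
      (((6 * δ + δ ^ 2 : ℝ) : ℂ) • 1) := by
  set D := R - S with hD
  have hR : R = S + D := by rw [hD]; abel
  set t : ℝ := √δ with ht
  have ht2 : t * t = δ := Real.mul_self_sqrt hδ.le
  have ht0 : t ≠ 0 := (Real.sqrt_pos.mpr hδ).ne'
  set Y := (t : ℂ) • S + ((t⁻¹ : ℝ) : ℂ) • D with hY
  have htc : (starRingEnd ℂ) (t : ℂ) * t = (δ : ℂ) := by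
    rw [Complex.conj_ofReal, ← Complex.ofReal_mul, ht2]
  have htc' : (starRingEnd ℂ) ((t⁻¹ : ℝ) : ℂ) * ((t⁻¹ : ℝ) : ℂ) = ((δ⁻¹ : ℝ) : ℂ) := by
    rw [Complex.conj_ofReal, ← Complex.ofReal_mul, ← mul_inv, ht2]
  have hcr : (t : ℂ) * ((t⁻¹ : ℝ) : ℂ) = 1 := by
    rw [← Complex.ofReal_mul, mul_inv_cancel₀ ht0, Complex.ofReal_one]
  have hYX : ∀ Z : Matrix A A ℂ, Yᴴ * Z * Y = (δ : ℂ) • (Sᴴ * Z * S)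
      + ((δ⁻¹ : ℝ) : ℂ) • (Dᴴ * Z * D) + (Sᴴ * Z * D + Dᴴ * Z * S) := by
    intro Z
    have c1 : ((t⁻¹ : ℝ) : ℂ) * (t : ℂ) = 1 := by rw [mul_comm, hcr]
    rw [Complex.conj_ofReal] at htc htc'
    simp only [smul_add, hY, Matrix.conjTranspose_add, Matrix.conjTranspose_smul, Matrix.add_mul,
      Matrix.mul_add, Matrix.smul_mul, Matrix.mul_smul, smul_smul, Complex.star_def,
      Complex.conj_ofReal, htc, htc', hcr, c1, one_smul]
    abel
  have hδi : (0 : ℝ) ≤ δ⁻¹ := (inv_pos.mpr hδ).le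
  refine ⟨fun b => Yᴴ * X b * Y + Dᴴ * X b * D,
    fun b => (δ : ℂ) • (Sᴴ * X b * S) + ((δ⁻¹ : ℝ) : ℂ) • (Dᴴ * X b * D),
    fun b => add_nonneg (nonneg_conj (hX b) _) (nonneg_conj (hX b) _),
    fun b => add_nonneg (smul_nonneg' hδ.le (nonneg_conj (hX b) _))
      (smul_nonneg' hδi (nonneg_conj (hX b) _)), fun b => ?_, ?_⟩
  · dsimp only
    rw [hYX, hR]
    simp only [Matrix.conjTranspose_add, Matrix.add_mul, Matrix.mul_add]
    abel
  · have h1 : ∑ b, (Yᴴ * X b * Y + Dᴴ * X b * D + ((δ : ℂ) • (Sᴴ * X b * S)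
        + ((δ⁻¹ : ℝ) : ℂ) • (Dᴴ * X b * D)))
        = Yᴴ * Y + Dᴴ * D + ((δ : ℂ) • (Sᴴ * S) + ((δ⁻¹ : ℝ) : ℂ) • (Dᴴ * D)) := by
      simp only [Finset.sum_add_distrib, ← Finset.smul_sum, sum_conj, hX1, Matrix.mul_one]
    have h2 : Yᴴ * Y ≤ (2 : ℝ) • ((δ : ℂ) • (Sᴴ * S)) + (2 : ℝ) • (((δ⁻¹ : ℝ) : ℂ) • (Dᴴ * D)) := by
      have := gram_add_le ((t : ℂ) • S) (((t⁻¹ : ℝ) : ℂ) • D)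
      simp only [Matrix.conjTranspose_smul, Matrix.smul_mul, Matrix.mul_smul, smul_smul,
        Complex.star_def, mul_comm _ ((starRingEnd ℂ) _), htc, htc'] at this
      exact this
    have a1 : (δ : ℂ) • (Sᴴ * S) ≤ (δ : ℂ) • (1 : Matrix B B ℂ) := smul_mono hδ.le hS
    have a2 : ((δ⁻¹ : ℝ) : ℂ) • (Dᴴ * D) ≤ (δ : ℂ) • (1 : Matrix B B ℂ) := by
      refine (smul_mono hδi hRS).trans (le_of_eq ?_)
      rw [smul_smul, ← Complex.ofReal_mul]
      congr 2; field_simp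
    rw [h1]
    simp only [two_smul] at h2
    refine (add_le_add (add_le_add (h2.trans (add_le_add (add_le_add a1 a1) (add_le_add a2 a2)))
      hRS) (add_le_add a1 a2)).trans (le_of_eq ?_)
    simp only [← add_smul]
    congr 1; push_cast; ring

theorem OutputsClose.trans {X Y Z : ι → Matrix E E ℂ} {c d : ℝ}
    (h : OutputsClose X Y c) (h' : OutputsClose Y Z d) : OutputsClose X Z (c + d) := by
  obtain ⟨P, N, hP, hN, hd, hs⟩ := h
  obtain ⟨P', N', hP', hN', hd', hs'⟩ := h'
  refine ⟨fun b => P b + P' b, fun b => N b + N' b, fun b => add_nonneg (hP b) (hP' b),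
    fun b => add_nonneg (hN b) (hN' b), fun b => ?_, ?_⟩
  · rw [← sub_add_sub_cancel (X b) (Y b) (Z b), hd, hd']; dsimp only; abel
  · refine le_trans (le_of_eq ?_) (add_le_add hs hs')
    rw [← Finset.sum_add_distrib]
    refine Finset.sum_congr rfl fun b _ => ?_
    simp only [Matrix.trace_add, Complex.add_re]; ring

theorem OutputsClose.symm {X Y : ι → Matrix E E ℂ} {c : ℝ}
    (h : OutputsClose X Y c) : OutputsClose Y X c := by
  obtain ⟨P, N, hP, hN, hd, hs⟩ := h
  refine ⟨N, P, hN, hP, fun b => ?_, ?_⟩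
  · rw [← neg_sub, hd, neg_sub]
  · simpa only [add_comm] using hs

theorem OutputsClose.sum_traceNorm_le {E : Type u} [Fintype E] [DecidableEq E]
    {X Y : ι → Matrix E E ℂ} {c : ℝ} (h : OutputsClose X Y c) :
    ∑ b, traceNorm (X b - Y b) ≤ c := by
  obtain ⟨P, N, hP, hN, hd, hs⟩ := h
  refine le_trans (Finset.sum_le_sum fun b _ => ?_) hs
  rw [hd, Matrix.trace_add]
  exact traceNorm_sub_le (Matrix.nonneg_iff_posSemidef.mp (hP b))
    (Matrix.nonneg_iff_posSemidef.mp (hN b))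

theorem EffectsClose.outputsClose {F G : ι → Matrix A A ℂ} {Ω : Matrix A A ℂ}
    (h : EffectsClose F G Ω) {σ : Matrix (A × E) (A × E) ℂ} (hσ : 0 ≤ σ) :
    OutputsClose (fun b => effectOut (F b) σ) (fun b => effectOut (G b) σ)
      (effectOut Ω σ).trace.re := by
  obtain ⟨P, N, hP, hN, hd, hs⟩ := h
  have hσ' := Matrix.nonneg_iff_posSemidef.mp hσ
  refine ⟨fun b => effectOut (P b) σ, fun b => effectOut (N b) σ,
    fun b => (effectOut_posSemidef (Matrix.nonneg_iff_posSemidef.mp (hP b)) hσ').nonneg,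
    fun b => (effectOut_posSemidef (Matrix.nonneg_iff_posSemidef.mp (hN b)) hσ').nonneg,
    fun b => by rw [← effectOut_sub, ← effectOut_sub, hd], ?_⟩
  refine le_trans (le_of_eq ?_) (trace_effectOut_mono hs hσ')
  rw [effectOut_sum, Matrix.trace_sum, Complex.re_sum]
  exact Finset.sum_congr rfl fun b _ => by rw [effectOut_add]

/-- Replacing the measured state changes the outputs by at most the trace of the positive parts of
the difference. -/
theorem OutputsClose.of_state {F : ι → Matrix A A ℂ} (hF : ∀ b, 0 ≤ F b) (hF1 : ∑ b, F b = 1)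
    {σ τ p n : Matrix (A × E) (A × E) ℂ} (hp : 0 ≤ p) (hn : 0 ≤ n) (h : σ - τ = p - n) :
    OutputsClose (fun b => effectOut (F b) σ) (fun b => effectOut (F b) τ)
      (p.trace + n.trace).re := by
  have hp' := Matrix.nonneg_iff_posSemidef.mp hp
  have hn' := Matrix.nonneg_iff_posSemidef.mp hn
  refine ⟨fun b => effectOut (F b) p, fun b => effectOut (F b) n,
    fun b => (effectOut_posSemidef (Matrix.nonneg_iff_posSemidef.mp (hF b)) hp').nonneg,
    fun b => (effectOut_posSemidef (Matrix.nonneg_iff_posSemidef.mp (hF b)) hn').nonneg,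
    fun b => by rw [← effectOut_sub_right, ← effectOut_sub_right, h], ?_⟩
  rw [← trace_effectOut_one p, ← trace_effectOut_one n, ← hF1, effectOut_sum, effectOut_sum,
    Matrix.trace_sum, Matrix.trace_sum, ← Finset.sum_add_distrib, Complex.re_sum]
  exact le_of_eq (Finset.sum_congr rfl fun b _ => by rw [Matrix.trace_add])

theorem trace_proj (v : A → ℂ) : (proj v).trace = ((∑ a, ‖v a‖ ^ 2 : ℝ) : ℂ) := by
  simp only [Matrix.trace, Matrix.diag, proj, Matrix.vecMulVec_apply, Complex.ofReal_sum]
  refine Finset.sum_congr rfl fun a _ => ?_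
  rw [← Complex.normSq_eq_norm_sq, ← Complex.mul_conj]; rfl

theorem proj_nonneg (v : A → ℂ) : (proj v).PosSemidef := Matrix.posSemidef_vecMulVec_self_star v

/-- Pure states given by close vectors differ by positive parts of small trace. -/
theorem exists_proj_sub_proj_eq (v w : A → ℂ) {δ : ℝ} (hδ : 0 < δ)
    (hw : ∑ a, ‖w a‖ ^ 2 ≤ 1) (hvw : ∑ a, ‖v a - w a‖ ^ 2 ≤ δ ^ 2) :
    ∃ p n : Matrix A A ℂ, 0 ≤ p ∧ 0 ≤ n ∧ proj v - proj w = p - n ∧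
      (p.trace + n.trace).re ≤ 6 * δ + δ ^ 2 := by
  set t : ℝ := √δ with ht
  have ht2 : t * t = δ := Real.mul_self_sqrt hδ.le
  have htp : 0 < t := Real.sqrt_pos.mpr hδ
  have htc : (t : ℂ) * t = (δ : ℂ) := by rw [← Complex.ofReal_mul, ht2]
  have htn : (t : ℂ) ≠ 0 := by exact_mod_cast htp.ne'
  set d : A → ℂ := fun a => v a - w a with hd
  set y : A → ℂ := fun a => (t : ℂ) * w a + (t : ℂ)⁻¹ * d a with hy
  set c : A → ℂ := fun a => (t : ℂ) * w a with hc
  set e : A → ℂ := fun a => (t : ℂ)⁻¹ * d a with he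
  have ny : ∑ a, ‖y a‖ ^ 2 ≤ 2 * ∑ a, ‖c a‖ ^ 2 + 2 * ∑ a, ‖e a‖ ^ 2 := by
    rw [Finset.mul_sum, Finset.mul_sum, ← Finset.sum_add_distrib]
    refine Finset.sum_le_sum fun a _ => ?_
    have : ‖y a‖ ≤ ‖c a‖ + ‖e a‖ := norm_add_le _ _
    nlinarith [norm_nonneg (y a), norm_nonneg (c a), norm_nonneg (e a),
      sq_nonneg (‖c a‖ - ‖e a‖)]
  have nc : ∑ a, ‖c a‖ ^ 2 ≤ δ := by
    simp only [hc, norm_mul, mul_pow, ← Finset.mul_sum, Complex.norm_real, Real.norm_eq_abs,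
      sq_abs]
    nlinarith [Finset.sum_nonneg fun a (_ : a ∈ Finset.univ) => sq_nonneg ‖w a‖]
  have ne : ∑ a, ‖e a‖ ^ 2 ≤ δ := by
    simp only [he, norm_mul, mul_pow, ← Finset.mul_sum, norm_inv, Complex.norm_real,
      Real.norm_eq_abs, inv_pow, sq_abs]
    rw [sq, ht2, inv_mul_le_iff₀ hδ]
    nlinarith
  refine ⟨proj y + proj d, proj c + proj e,
    add_nonneg (proj_nonneg _).nonneg (proj_nonneg _).nonneg,
    add_nonneg (proj_nonneg _).nonneg (proj_nonneg _).nonneg, ?_, ?_⟩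
  · ext a a'
    simp only [proj, Matrix.sub_apply, Matrix.add_apply, Matrix.vecMulVec_apply, Pi.star_apply, hy,
      hc, he, hd, Complex.star_def, map_add, map_mul, map_sub, map_inv₀, Complex.conj_ofReal]
    field_simp
    ring
  · rw [Matrix.trace_add, Matrix.trace_add, trace_proj, trace_proj, trace_proj, trace_proj]
    simp only [Complex.add_re, Complex.ofReal_re]
    have : ∑ a, ‖d a‖ ^ 2 ≤ δ ^ 2 := hvw
    nlinarith

end Close

/-! ### Halves of bit strings -/

/-- A string of length `2 ^ (r + 1)` as the pair of its halves. -/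
def halves (r : ℕ) : Bits (2 ^ (r + 1)) ≃ Bits (2 ^ r) × Bits (2 ^ r) where
  toFun x := (fstHalf x, sndHalf x)
  invFun p i := if h : i.val < 2 ^ r then p.1 ⟨i.val, h⟩
    else p.2 ⟨i.val - 2 ^ r, by have := i.isLt; have := pow_succ 2 r; omega⟩
  left_inv x := by
    funext i
    by_cases h : i.val < 2 ^ r
    · simp [h, fstHalf]
    · simp only [h, dite_false, sndHalf]
      congr 1; ext; simp; omega
  right_inv p := by
    refine Prod.ext ?_ ?_
    · funext i; simp [fstHalf]
    · funext i; simp [sndHalf]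

@[simp] theorem halves_apply {r : ℕ} (x : Bits (2 ^ (r + 1))) :
    halves r x = (fstHalf x, sndHalf x) := rfl

theorem prod_halves {M : Type*} [CommMonoid M] {r : ℕ} (f : Fin (2 ^ (r + 1)) → M) :
    ∏ i, f i = (∏ i : Fin (2 ^ r), f ⟨i.val, by have := i.isLt; rw [pow_succ]; omega⟩) *
      ∏ i : Fin (2 ^ r), f ⟨2 ^ r + i.val, by have := i.isLt; rw [pow_succ]; omega⟩ := by
  have h : 2 ^ r + 2 ^ r = 2 ^ (r + 1) := by rw [pow_succ]; omega
  rw [← (finCongr h).prod_comp, Fin.prod_univ_add]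
  rfl

theorem wt_eq_sum {n : ℕ} (x : Bits n) : wt x = ∑ j, (x j).val := by
  rw [wt, Finset.card_filter]
  refine Finset.sum_congr rfl fun j _ => ?_
  generalize x j = a
  fin_cases a <;> rfl

theorem wt_halves {r : ℕ} (x : Bits (2 ^ (r + 1))) : wt x = wt (fstHalf x) + wt (sndHalf x) := by
  rw [wt_eq_sum, wt_eq_sum, wt_eq_sum]
  exact Multiplicative.ofAdd.injective (prod_halves fun i => Multiplicative.ofAdd (x i).val)

theorem wt_eq_zero_iff {n : ℕ} {x : Bits n} : wt x = 0 ↔ x = 0 := by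
  rw [wt_eq_sum, Finset.sum_eq_zero_iff]
  constructor
  · intro h; funext j; exact Fin.ext (h j (Finset.mem_univ j))
  · rintro rfl j _; rfl

theorem fstHalf_zero {r : ℕ} : fstHalf (0 : Bits (2 ^ (r + 1))) = 0 := rfl

theorem sndHalf_zero {r : ℕ} : sndHalf (0 : Bits (2 ^ (r + 1))) = 0 := rfl

/-! ### The effects of the recursive measurement -/

section Tree

variable {Φ : Type*} [Fintype Φ] [DecidableEq Φ]

/-- The Kraus operators `⟨f| M_d |o⟩` of the two-outcome measurement of `|v⟩⟨v|` (outcome `0`)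
against its complement (outcome `1`), where an ancilla is prepared in the state `o` and traced out
afterwards; `v f` is the component of `v` at the ancilla state `f`. -/
def krausOf {A : Type*} [DecidableEq A] (o : Φ) (v : Φ → A → ℂ) (d : Fin 2) (f : Φ) :
    Matrix A A ℂ :=
  if d = 0 then Matrix.vecMulVec (v f) (star (v o))
  else (if f = o then 1 else 0) - Matrix.vecMulVec (v f) (star (v o))

/-- The effects of a recursive measurement in the Heisenberg picture: `K r d f` are the Kraus
operators of the elementary measurement at level `r`, and `S r` splits level `r + 1` into two
halves. -/
def treeEffect {A : ℕ → Type} [∀ r, Fintype (A r)] [∀ r, DecidableEq (A r)]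
    (K : ∀ r, Fin 2 → Φ → Matrix (A r) (A r) ℂ) (S : ∀ r, Matrix (A r × A r) (A (r + 1)) ℂ) :
    (r : ℕ) → (budget : ℕ) → Bits (2 ^ r) → Matrix (A r) (A r) ℂ
  | _, 0, b => if b = 0 then 1 else 0
  | 0, _ + 1, b => ∑ f, (K 0 (b 0) f)ᴴ * K 0 (b 0) f
  | r + 1, j + 1, b => (if b = 0 then ∑ f, (K (r + 1) 0 f)ᴴ * K (r + 1) 0 f else 0) +
      ∑ f, (K (r + 1) 1 f)ᴴ * ((S r)ᴴ * (treeEffect K S r (j + 1) (fstHalf b) ⊗ₖ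
        treeEffect K S r (j + 1 - wt (fstHalf b)) (sndHalf b)) * S r) * K (r + 1) 1 f

section General

variable {A : ℕ → Type} [∀ r, Fintype (A r)] [∀ r, DecidableEq (A r)]
  {K : ∀ r, Fin 2 → Φ → Matrix (A r) (A r) ℂ} {S : ∀ r, Matrix (A r × A r) (A (r + 1)) ℂ}

theorem treeEffect_budget_zero (r : ℕ) (b : Bits (2 ^ r)) :
    treeEffect K S r 0 b = if b = 0 then 1 else 0 := by
  cases r <;> rw [treeEffect]

theorem treeEffect_nonneg (r j : ℕ) (b : Bits (2 ^ r)) : 0 ≤ treeEffect K S r j b := by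
  induction r generalizing j with
  | zero =>
    cases j with
    | zero =>
      rw [treeEffect_budget_zero]; split_ifs
      · exact Matrix.PosSemidef.one.nonneg
      · exact le_rfl
    | succ j => rw [treeEffect]; exact Finset.sum_nonneg fun f _ => nonneg_gram _
  | succ r ih =>
    cases j with
    | zero =>
      rw [treeEffect_budget_zero]; split_ifs
      · exact Matrix.PosSemidef.one.nonneg
      · exact le_rfl
    | succ j =>
      rw [treeEffect]
      refine add_nonneg ?_ (Finset.sum_nonneg fun f _ =>
        nonneg_conj (nonneg_conj (nonneg_kronecker (ih _ _) (ih _ _)) _) _)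
      split_ifs
      · exact Finset.sum_nonneg fun f _ => nonneg_gram _
      · exact le_rfl

theorem sum_bits_one {M : Type*} [AddCommMonoid M] (g : Fin 2 → M) :
    ∑ b : Bits (2 ^ 0), g (b 0) = ∑ d, g d :=
  Fintype.sum_equiv (Equiv.funUnique (Fin 1) (Fin 2)) _ _ fun _ => rfl

theorem sum_bits_halves {M : Type*} [AddCommMonoid M] {r : ℕ}
    (g : Bits (2 ^ r) → Bits (2 ^ r) → M) :
    ∑ b : Bits (2 ^ (r + 1)), g (fstHalf b) (sndHalf b) = ∑ b, ∑ b', g b b' := by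
  rw [← Fintype.sum_prod_type' g]
  exact Fintype.sum_equiv (halves r) _ _ fun _ => rfl

theorem sum_treeEffect (hK : ∀ r, ∑ d, ∑ f, (K r d f)ᴴ * K r d f = 1)
    (hS : ∀ r, (S r)ᴴ * S r = 1) (r j : ℕ) : ∑ b, treeEffect K S r j b = 1 := by
  induction r generalizing j with
  | zero =>
    cases j with
    | zero => simp [treeEffect_budget_zero]
    | succ j =>
      rw [← hK 0, ← sum_bits_one fun d => ∑ f, (K 0 d f)ᴴ * K 0 d f]
      exact Finset.sum_congr rfl fun b _ => by rw [treeEffect]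
  | succ r ih =>
    cases j with
    | zero => simp [treeEffect_budget_zero]
    | succ j =>
      have h1 : ∑ b : Bits (2 ^ (r + 1)), treeEffect K S r (j + 1) (fstHalf b) ⊗ₖ
          treeEffect K S r (j + 1 - wt (fstHalf b)) (sndHalf b) = 1 := by
        rw [sum_bits_halves fun b b' => treeEffect K S r (j + 1) b ⊗ₖ
          treeEffect K S r (j + 1 - wt b) b']
        simp only [kronecker_sum, ih]
        rw [sum_kronecker, ih, Matrix.one_kronecker_one]
      simp only [treeEffect, Finset.sum_add_distrib]
      rw [Finset.sum_comm]
      simp only [sum_conj, h1]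
      rw [← hK (r + 1), Fin.sum_univ_two]
      simp [hS]

end General

/-- Pulling the effects back along `M r`: if `M r` intertwines the Kraus operators and, up to the
projection `(M r)† M r`, the splittings, then the effects on one side are the compressions of those
on the other. -/
theorem treeEffect_pullback {A B : ℕ → Type} [∀ r, Fintype (A r)] [∀ r, DecidableEq (A r)]
    [∀ r, Fintype (B r)] [∀ r, DecidableEq (B r)]
    {K : ∀ r, Fin 2 → Φ → Matrix (A r) (A r) ℂ} {S : ∀ r, Matrix (A r × A r) (A (r + 1)) ℂ}
    {K' : ∀ r, Fin 2 → Φ → Matrix (B r) (B r) ℂ} {S' : ∀ r, Matrix (B r × B r) (B (r + 1)) ℂ}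
    (M : ∀ r, Matrix (A r) (B r) ℂ) (P : ∀ r, Matrix (B r) (B r) ℂ)
    {s : ℕ} (hM : ∀ r ≤ s, (M r)ᴴ * M r = P r) (hPh : ∀ r, (P r)ᴴ = P r)
    (hPP : ∀ r, P r * P r = P r)
    (hKM : ∀ r ≤ s, ∀ d f, K r d f * M r = M r * K' r d f)
    (hKP : ∀ r d f, K' r d f * P r = P r * K' r d f)
    (hSM : ∀ r < s, S r * M (r + 1) = (M r ⊗ₖ M r) * S' r * P (r + 1))
    (hSP : ∀ r, (P r ⊗ₖ P r) * S' r * P (r + 1) = S' r * P (r + 1))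
    (r j : ℕ) (hr : r ≤ s) (b : Bits (2 ^ r)) :
    (M r)ᴴ * treeEffect K S r j b * M r = P r * treeEffect K' S' r j b * P r := by
  have key : ∀ r ≤ s, ∀ d f X Y, (M r)ᴴ * X * M r = P r * Y * P r →
      (M r)ᴴ * ((K r d f)ᴴ * X * K r d f) * M r
        = P r * ((K' r d f)ᴴ * Y * K' r d f) * P r := by
    intro r hr d f X Y h
    have e : P r * (K' r d f)ᴴ = (K' r d f)ᴴ * P r := by
      rw [← hPh r, ← Matrix.conjTranspose_mul, hKP, Matrix.conjTranspose_mul]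
    calc (M r)ᴴ * ((K r d f)ᴴ * X * K r d f) * M r
        = (K r d f * M r)ᴴ * X * (K r d f * M r) := by
          rw [Matrix.conjTranspose_mul]; simp only [Matrix.mul_assoc]
      _ = (K' r d f)ᴴ * ((M r)ᴴ * X * M r) * K' r d f := by
          rw [hKM r hr, Matrix.conjTranspose_mul]; simp only [Matrix.mul_assoc]
      _ = ((K' r d f)ᴴ * P r) * Y * (P r * K' r d f) := by
          rw [h]; simp only [Matrix.mul_assoc]
      _ = _ := by rw [← e, ← hKP]; simp only [Matrix.mul_assoc]
  have key1 : ∀ r ≤ s, ∀ d f, (M r)ᴴ * ((K r d f)ᴴ * K r d f) * M r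
        = P r * ((K' r d f)ᴴ * K' r d f) * P r := by
    intro r hr d f
    have := key r hr d f 1 1 (by rw [Matrix.mul_one, Matrix.mul_one, hM r hr, hPP])
    simpa using this
  induction r generalizing j with
  | zero =>
    cases j with
    | zero =>
      rw [treeEffect_budget_zero, treeEffect_budget_zero]; split_ifs
      · rw [Matrix.mul_one, Matrix.mul_one, hM _ hr, hPP]
      · simp
    | succ j =>
      rw [treeEffect, treeEffect, Matrix.mul_sum, Matrix.sum_mul, Matrix.mul_sum, Matrix.sum_mul]
      exact Finset.sum_congr rfl fun f _ => key1 0 hr _ f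
  | succ r ih =>
    cases j with
    | zero =>
      rw [treeEffect_budget_zero, treeEffect_budget_zero]; split_ifs
      · rw [Matrix.mul_one, Matrix.mul_one, hM _ hr, hPP]
      · simp
    | succ j =>
      rw [treeEffect, treeEffect, Matrix.mul_add, Matrix.add_mul, Matrix.mul_add, Matrix.add_mul]
      congr 1
      · split_ifs
        · rw [Matrix.mul_sum, Matrix.sum_mul, Matrix.mul_sum, Matrix.sum_mul]
          exact Finset.sum_congr rfl fun f _ => key1 (r + 1) hr _ f
        · simp
      · rw [Matrix.mul_sum, Matrix.sum_mul, Matrix.mul_sum, Matrix.sum_mul]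
        refine Finset.sum_congr rfl fun f _ => key (r + 1) hr _ f _ _ ?_
        set F := treeEffect K S r (j + 1) (fstHalf b)
        set G := treeEffect K S r (j + 1 - wt (fstHalf b)) (sndHalf b)
        set F' := treeEffect K' S' r (j + 1) (fstHalf b) with hF'
        set G' := treeEffect K' S' r (j + 1 - wt (fstHalf b)) (sndHalf b) with hG'
        have hF := ih (j + 1) (by omega) (fstHalf b)
        have hG := ih (j + 1 - wt (fstHalf b)) (by omega) (sndHalf b)
        have hFG : (M r ⊗ₖ M r)ᴴ * (F ⊗ₖ G) * (M r ⊗ₖ M r)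
            = (P r ⊗ₖ P r)ᴴ * (F' ⊗ₖ G') * (P r ⊗ₖ P r) := by
          rw [Matrix.conjTranspose_kronecker, Matrix.conjTranspose_kronecker, hPh,
            ← Matrix.mul_kronecker_mul, ← Matrix.mul_kronecker_mul, ← Matrix.mul_kronecker_mul,
            ← Matrix.mul_kronecker_mul, hF, hG]
        have hSM' := hSM r hr
        have hSP' := hSP r
        rw [Matrix.mul_assoc] at hSM' hSP'
        set Y := S' r * P (r + 1) with hY
        calc (M (r + 1))ᴴ * ((S r)ᴴ * (F ⊗ₖ G) * S r) * M (r + 1)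
            = (S r * M (r + 1))ᴴ * (F ⊗ₖ G) * (S r * M (r + 1)) := by
              rw [Matrix.conjTranspose_mul]; simp only [Matrix.mul_assoc]
          _ = Yᴴ * ((M r ⊗ₖ M r)ᴴ * (F ⊗ₖ G) * (M r ⊗ₖ M r)) * Y := by
              rw [hSM', Matrix.conjTranspose_mul]; simp only [Matrix.mul_assoc]
          _ = ((P r ⊗ₖ P r) * Y)ᴴ * (F' ⊗ₖ G') * ((P r ⊗ₖ P r) * Y) := by
              rw [hFG, Matrix.conjTranspose_mul _ Y]; simp only [Matrix.mul_assoc]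
          _ = _ := by
              rw [hSP', hY, Matrix.conjTranspose_mul, hPh]; simp only [Matrix.mul_assoc]

end Tree

/-! ### The elementary measurement -/

section Kraus

variable {A Φ ι : Type*} [Fintype A] [DecidableEq A] [Fintype Φ] [DecidableEq Φ] [Fintype ι]

theorem vecMulVec_conj (a b : A → ℂ) :
    (Matrix.vecMulVec a (star b))ᴴ = Matrix.vecMulVec b (star a) := by
  ext i j; simp [Matrix.vecMulVec_apply, mul_comm]

theorem vecMulVec_mul_vecMulVec' (a b c d : A → ℂ) :
    Matrix.vecMulVec a (star b) * Matrix.vecMulVec c (star d)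
      = (star b ⬝ᵥ c) • Matrix.vecMulVec a (star d) := by
  ext i j
  simp only [Matrix.mul_apply, Matrix.vecMulVec_apply, Matrix.smul_apply, smul_eq_mul, dotProduct,
    Finset.sum_mul]
  exact Finset.sum_congr rfl fun x _ => by ring

theorem star_dotProduct_self (v : A → ℂ) : star v ⬝ᵥ v = ((∑ a, ‖v a‖ ^ 2 : ℝ) : ℂ) := by
  simp only [dotProduct, Pi.star_apply, Complex.ofReal_sum]
  refine Finset.sum_congr rfl fun a _ => ?_
  rw [← Complex.normSq_eq_norm_sq, Complex.normSq_eq_conj_mul_self]; rfl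

theorem sum_krausOf {o : Φ} {v : Φ → A → ℂ} (hv : ∑ f, ∑ a, ‖v f a‖ ^ 2 = 1) :
    ∑ d, ∑ f, (krausOf o v d f)ᴴ * krausOf o v d f = 1 := by
  have hv' : ∑ f, (star (v f) ⬝ᵥ v f) = 1 := by
    simp only [star_dotProduct_self]; rw [← Complex.ofReal_sum, hv, Complex.ofReal_one]
  have h0 : ∀ f, (krausOf o v 0 f)ᴴ * krausOf o v 0 f
      = (star (v f) ⬝ᵥ v f) • proj (v o) := by
    intro f
    simp only [krausOf, if_true]
    rw [vecMulVec_conj, vecMulVec_mul_vecMulVec', proj]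
  have h1 : ∀ f, (krausOf o v 1 f)ᴴ * krausOf o v 1 f
      = (if f = o then 1 - proj (v o) - proj (v o) else 0)
        + (star (v f) ⬝ᵥ v f) • proj (v o) := by
    intro f
    have : (1 : Fin 2) ≠ 0 := by decide
    simp only [krausOf, this, if_false]
    split_ifs with h
    · subst h
      rw [Matrix.conjTranspose_sub, Matrix.conjTranspose_one, vecMulVec_conj, Matrix.sub_mul,
        Matrix.mul_sub, Matrix.mul_sub, vecMulVec_mul_vecMulVec']
      simp only [Matrix.one_mul, Matrix.mul_one, proj]
      abel
    · rw [zero_sub, Matrix.conjTranspose_neg, Matrix.neg_mul, Matrix.mul_neg, neg_neg,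
        vecMulVec_conj,
        vecMulVec_mul_vecMulVec', zero_add]
      rfl
  rw [Fin.sum_univ_two]
  simp only [h0, h1, Finset.sum_add_distrib, ← Finset.sum_smul, hv', Finset.sum_ite_eq',
    Finset.mem_univ, if_true, one_smul]
  abel

/-- The projection for outcome `d` of the exact measurement of `|e⟩⟨e|`. -/
def exactProj (e : A → ℂ) (d : Fin 2) : Matrix A A ℂ := if d = 0 then proj e else 1 - proj e

theorem exactProj_conj (e : A → ℂ) (d : Fin 2) : (exactProj e d)ᴴ = exactProj e d := by
  have : (proj e)ᴴ = proj e := vecMulVec_conj e e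
  unfold exactProj; split_ifs <;> simp [this]

theorem exactProj_mul_self {e : A → ℂ} (he : ∑ a, ‖e a‖ ^ 2 = 1) (d : Fin 2) :
    exactProj e d * exactProj e d = exactProj e d := by
  have h : proj e * proj e = proj e := by
    rw [proj, vecMulVec_mul_vecMulVec', star_dotProduct_self, he, Complex.ofReal_one, one_smul]
  unfold exactProj; split_ifs
  · exact h
  · rw [Matrix.sub_mul, Matrix.mul_sub, Matrix.mul_sub, h]; simp

theorem exactProj_le_one {e : A → ℂ} (he : ∑ a, ‖e a‖ ^ 2 = 1) (d : Fin 2) :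
    exactProj e d ≤ 1 := by
  unfold exactProj; split_ifs
  · have := proj_le_smul_one e
    rwa [he, Complex.ofReal_one, one_smul] at this
  · exact sub_le_self _ (proj_nonneg e).nonneg

/-- `|v⟩⟨v| - |e⟩⟨e|` has operator norm at most `2 ‖v - e‖`. -/
theorem gram_proj_sub_proj_le {v e : A → ℂ} {δ : ℝ} (he : ∑ a, ‖e a‖ ^ 2 = 1)
    (hv : ∑ a, ‖v a‖ ^ 2 ≤ 1) (hδ : ∑ a, ‖v a - e a‖ ^ 2 ≤ δ ^ 2) :
    (proj v - proj e)ᴴ * (proj v - proj e) ≤ (((2 * δ) ^ 2 : ℝ) : ℂ) • 1 := by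
  set w : A → ℂ := fun a => v a - e a with hw
  have hsplit : proj v - proj e = Matrix.vecMulVec v (star w) + Matrix.vecMulVec w (star e) := by
    ext i j
    simp only [proj, Matrix.sub_apply, Matrix.add_apply, Matrix.vecMulVec_apply, Pi.star_apply, hw,
      star_sub]
    ring
  have hw0 : 0 ≤ ∑ a, ‖w a‖ ^ 2 := Finset.sum_nonneg fun _ _ => by positivity
  have hv0 : 0 ≤ ∑ a, ‖v a‖ ^ 2 := Finset.sum_nonneg fun _ _ => by positivity
  have g1 : (Matrix.vecMulVec v (star w))ᴴ * Matrix.vecMulVec v (star w)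
      ≤ ((δ ^ 2 : ℝ) : ℂ) • 1 := by
    rw [vecMulVec_conj, vecMulVec_mul_vecMulVec', star_dotProduct_self]
    refine (smul_mono hv0 (proj_le_smul_one w)).trans ?_
    rw [smul_smul, ← Complex.ofReal_mul]
    exact smul_one_mono ((mul_le_of_le_one_left hw0 hv).trans hδ)
  have g2 : (Matrix.vecMulVec w (star e))ᴴ * Matrix.vecMulVec w (star e)
      ≤ ((δ ^ 2 : ℝ) : ℂ) • 1 := by
    rw [vecMulVec_conj, vecMulVec_mul_vecMulVec', star_dotProduct_self]
    refine (smul_mono hw0 (proj_le_smul_one e)).trans ?_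
    rw [smul_smul, ← Complex.ofReal_mul, he, mul_one]
    exact smul_one_mono hδ
  rw [hsplit]
  refine (gram_add_le _ _).trans ?_
  rw [two_smul, two_smul]
  refine (add_le_add (add_le_add g1 g1) (add_le_add g2 g2)).trans (le_of_eq ?_)
  simp only [← add_smul]
  congr 1; push_cast; ring

theorem EffectsClose.of_nonneg {F : ι → Matrix A A ℂ} (hF : ∀ b, 0 ≤ F b) {Ω : Matrix A A ℂ}
    (h : ∑ b, F b ≤ Ω) : EffectsClose F 0 Ω :=
  ⟨F, 0, hF, fun _ => le_rfl, fun _ => by simp, by simpa using h⟩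

/-- One elementary measurement in front of a measurement `X`: the ancilla component at `o` perturbs
the exact Kraus operator, and the others only contribute the weight `η` of the ancilla outside `o`.
-/
theorem effectsClose_krausOf {o : Φ} {v : Φ → A → ℂ} {e : A → ℂ} {δ η : ℝ} (hδ : 0 < δ)
    (he : ∑ a, ‖e a‖ ^ 2 = 1) (hv : ∑ a, ‖v o a‖ ^ 2 ≤ 1)
    (hve : ∑ a, ‖v o a - e a‖ ^ 2 ≤ δ ^ 2)
    (hη : ∑ f ∈ Finset.univ.erase o, ∑ a, ‖v f a‖ ^ 2 ≤ η)
    {X : ι → Matrix A A ℂ} (hX : ∀ b, 0 ≤ X b) (hX1 : ∑ b, X b = 1) (d : Fin 2) :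
    EffectsClose (fun b => ∑ f, (krausOf o v d f)ᴴ * X b * krausOf o v d f)
      (fun b => (exactProj e d)ᴴ * X b * exactProj e d)
      (((12 * δ + 4 * δ ^ 2 + η : ℝ) : ℂ) • 1) := by
  have h1 : EffectsClose (fun b => (krausOf o v d o)ᴴ * X b * krausOf o v d o)
      (fun b => (exactProj e d)ᴴ * X b * exactProj e d)
        (((6 * (2 * δ) + (2 * δ) ^ 2 : ℝ) : ℂ) • 1) := by
    refine EffectsClose.kraus hX hX1 _ _ (by linarith) ?_ ?_
    · rw [exactProj_conj, exactProj_mul_self he]; exact exactProj_le_one he d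
    · have hg := gram_proj_sub_proj_le he hv hve
      have : krausOf o v d o - exactProj e d = proj (v o) - proj e ∨
          krausOf o v d o - exactProj e d = -(proj (v o) - proj e) := by
        unfold krausOf exactProj
        simp only [if_true]
        split_ifs
        · left; rfl
        · right; simp only [proj]; abel
      rcases this with h | h <;> rw [h]
      · exact hg
      · rwa [Matrix.conjTranspose_neg, Matrix.neg_mul, Matrix.mul_neg, neg_neg]
  have h2 : EffectsClose
      (fun b => ∑ f ∈ Finset.univ.erase o, (krausOf o v d f)ᴴ * X b * krausOf o v d f) 0
      ((η : ℂ) • 1) := by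
    refine EffectsClose.of_nonneg
      (fun b => Finset.sum_nonneg fun f _ => nonneg_conj (hX b) _) ?_
    rw [Finset.sum_comm]
    simp only [sum_conj, hX1, Matrix.mul_one]
    have hf : ∀ f ∈ Finset.univ.erase o, (krausOf o v d f)ᴴ * krausOf o v d f
        ≤ ((∑ a, ‖v f a‖ ^ 2 : ℝ) : ℂ) • (1 : Matrix A A ℂ) := by
      intro f hf
      have hfo : f ≠ o := (Finset.mem_erase.mp hf).1
      have : (krausOf o v d f)ᴴ * krausOf o v d f
          = ((∑ a, ‖v f a‖ ^ 2 : ℝ) : ℂ) • proj (v o) := by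
        unfold krausOf
        split_ifs
        · rw [vecMulVec_conj, vecMulVec_mul_vecMulVec', star_dotProduct_self]; rfl
        · rw [zero_sub, Matrix.conjTranspose_neg, Matrix.neg_mul, Matrix.mul_neg, neg_neg,
            vecMulVec_conj,
            vecMulVec_mul_vecMulVec', star_dotProduct_self]; rfl
      rw [this]
      refine smul_mono (Finset.sum_nonneg fun _ _ => by positivity) ?_
      refine (proj_le_smul_one _).trans ((smul_one_mono hv).trans ?_)
      simp
    refine (Finset.sum_le_sum hf).trans ?_
    rw [← Finset.sum_smul, ← Complex.ofReal_sum]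
    exact smul_one_mono hη
  have h3 := h1.add h2
  have e1 : ∀ b, ∑ f, (krausOf o v d f)ᴴ * X b * krausOf o v d f
      = (krausOf o v d o)ᴴ * X b * krausOf o v d o
        + ∑ f ∈ Finset.univ.erase o, (krausOf o v d f)ᴴ * X b * krausOf o v d f := fun b =>
    (Finset.add_sum_erase _ _ (Finset.mem_univ o)).symm
  simp only [e1]
  simp only [Pi.zero_apply, add_zero] at h3
  convert h3 using 1
  rw [← add_smul, ← Complex.ofReal_add]; ring_nf

end Kraus

/-! ### Measuring in the computational basis -/

/-- The result that the recursive measurement reports when the qubits are in the computational basis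
state `x`: only the first `budget` ones are located. -/
def locate : (r : ℕ) → (budget : ℕ) → Bits (2 ^ r) → Bits (2 ^ r)
  | _, 0, _ => 0
  | 0, _ + 1, x => x
  | r + 1, j + 1, x => if x = 0 then 0 else
      (halves r).symm (locate r (j + 1) (fstHalf x),
        locate r (j + 1 - wt (locate r (j + 1) (fstHalf x))) (sndHalf x))

theorem locate_budget_zero (r : ℕ) (x : Bits (2 ^ r)) : locate r 0 x = 0 := by
  cases r <;> rw [locate]

theorem locate_of_wt_le {r j : ℕ} {x : Bits (2 ^ r)} (h : wt x ≤ j) : locate r j x = x := by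
  induction r generalizing j with
  | zero =>
    cases j with
    | zero => rw [locate_budget_zero, wt_eq_zero_iff.mp (Nat.le_zero.mp h)]
    | succ j => rw [locate]
  | succ r ih =>
    cases j with
    | zero => rw [locate_budget_zero, wt_eq_zero_iff.mp (Nat.le_zero.mp h)]
    | succ j =>
      rw [locate]
      split_ifs with hx
      · exact hx.symm
      · rw [wt_halves] at h
        rw [ih (by omega), ih (by omega)]
        exact (halves r).symm_apply_apply x

/-- The splitting of uncompressed qubits into two halves. -/
def bitSplit (r : ℕ) : Matrix (Bits (2 ^ r) × Bits (2 ^ r)) (Bits (2 ^ (r + 1))) ℂ :=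
  (1 : Matrix (Bits (2 ^ r) × Bits (2 ^ r)) (Bits (2 ^ r) × Bits (2 ^ r)) ℂ).submatrix id (halves r)

theorem bitSplit_conj_mul (r : ℕ)
    (X : Matrix (Bits (2 ^ r) × Bits (2 ^ r)) (Bits (2 ^ r) × Bits (2 ^ r)) ℂ) :
    (bitSplit r)ᴴ * X * bitSplit r = X.submatrix (halves r) (halves r) := by
  ext x y
  simp only [bitSplit, Matrix.mul_apply, Matrix.conjTranspose_apply, Matrix.submatrix_apply,
    Matrix.one_apply, apply_ite (star : ℂ → ℂ), star_one, star_zero, ite_mul, one_mul, zero_mul,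
    mul_ite, mul_one, mul_zero, id, Finset.sum_ite_eq', Finset.mem_univ, if_true]

theorem bitSplit_isometry (r : ℕ) : (bitSplit r)ᴴ * bitSplit r = 1 := by
  have := bitSplit_conj_mul r 1
  rw [Matrix.mul_one] at this
  rw [this, Matrix.submatrix_one_equiv]

/-- The computational basis state `|0⟩`. -/
def zeroState (n : ℕ) : Bits n → ℂ := fun x => if x = 0 then 1 else 0

theorem zeroState_norm (n : ℕ) : ∑ x, ‖zeroState n x‖ ^ 2 = 1 := by
  simp [zeroState, apply_ite]

theorem proj_zeroState (n : ℕ) :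
    proj (zeroState n) = Matrix.diagonal fun x => if x = 0 then (1 : ℂ) else 0 := by
  ext x y
  by_cases hx : x = 0 <;> by_cases hy : y = 0 <;>
    simp [proj, Matrix.vecMulVec_apply, zeroState, Matrix.diagonal_apply, hx, hy]
  intro h; exact absurd h.symm hy

theorem one_sub_proj_zeroState (n : ℕ) :
    1 - proj (zeroState n) = Matrix.diagonal fun x => if x = 0 then (0 : ℂ) else 1 := by
  rw [proj_zeroState, ← Matrix.diagonal_one, Matrix.diagonal_sub]
  congr 1; ext x; split_ifs <;> simp

/-- The effect of the result `b` of the recursive measurement for exact elementary measurements. -/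
def locateEffect (r j : ℕ) (b : Bits (2 ^ r)) : Matrix (Bits (2 ^ r)) (Bits (2 ^ r)) ℂ :=
  Matrix.diagonal fun x => if locate r j x = b then 1 else 0

theorem locateEffect_nonneg (r j : ℕ) (b : Bits (2 ^ r)) : 0 ≤ locateEffect r j b := by
  refine (Matrix.PosSemidef.diagonal fun x => ?_).nonneg
  dsimp only
  split_ifs <;> simp

theorem sum_locateEffect (r j : ℕ) : ∑ b, locateEffect r j b = 1 := by
  ext x y
  simp only [locateEffect, Matrix.sum_apply, Matrix.diagonal_apply, Matrix.one_apply]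
  split_ifs <;> simp

theorem locateEffect_succ (r j : ℕ) (b : Bits (2 ^ (r + 1))) :
    locateEffect (r + 1) (j + 1) b = (if b = 0 then proj (zeroState _) else 0) +
      (exactProj (zeroState _) 1)ᴴ * ((bitSplit r)ᴴ * (locateEffect r (j + 1) (fstHalf b) ⊗ₖ
        locateEffect r (j + 1 - wt (fstHalf b)) (sndHalf b)) * bitSplit r)
        * exactProj (zeroState _) 1 := by
  have h10 : (1 : Fin 2) ≠ 0 := by decide
  rw [exactProj_conj, bitSplit_conj_mul, exactProj, if_neg h10, one_sub_proj_zeroState,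
    proj_zeroState]
  simp only [locateEffect]
  rw [Matrix.diagonal_kronecker_diagonal, Matrix.submatrix_diagonal_equiv,
    Matrix.diagonal_mul_diagonal, Matrix.diagonal_mul_diagonal]
  have e : (if b = 0 then (Matrix.diagonal fun x : Bits (2 ^ (r + 1)) =>
      if x = 0 then (1 : ℂ) else 0) else 0)
      = Matrix.diagonal fun x => if b = 0 ∧ x = 0 then (1 : ℂ) else 0 := by
    by_cases hb : b = 0
    · simp [hb]
    · simp [hb]
  rw [e, Matrix.diagonal_add]
  congr 1; ext x
  rw [locate]
  by_cases hx : x = 0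
  · simp [hx, eq_comm]
  · simp only [hx, if_false, and_false, Equiv.symm_apply_eq, halves_apply, Prod.mk.injEq, zero_add,
      one_mul, mul_one, Function.comp]
    by_cases h1 : locate r (j + 1) (fstHalf x) = fstHalf b
    · simp only [h1, true_and, if_true]
      rw [one_mul]
      congr
    · simp [h1]

/-- The error operator: an error `κ` for every elementary measurement that is made, in the worst
case for a computational basis state of given weight. -/
def errOp (κ : ℝ) (r : ℕ) : Matrix (Bits (2 ^ r)) (Bits (2 ^ r)) ℂ :=
  Matrix.diagonal fun x => ((κ * (1 + 2 * r * wt x) : ℝ) : ℂ)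

theorem errOp_nonneg {κ : ℝ} (hκ : 0 ≤ κ) (r : ℕ) : 0 ≤ errOp κ r := by
  refine (Matrix.PosSemidef.diagonal fun x => ?_).nonneg
  exact Complex.zero_le_real.mpr (by positivity)

theorem errOp_succ {κ : ℝ} (hκ : 0 ≤ κ) (r : ℕ) :
    (κ : ℂ) • 1 + (exactProj (zeroState _) 1)ᴴ * ((bitSplit r)ᴴ * (errOp κ r ⊗ₖ 1 + 1 ⊗ₖ errOp κ r)
      * bitSplit r) * exactProj (zeroState _) 1 ≤ errOp κ (r + 1) := by
  have h10 : (1 : Fin 2) ≠ 0 := by decide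
  rw [exactProj_conj, bitSplit_conj_mul, exactProj, if_neg h10, one_sub_proj_zeroState]
  simp only [errOp]
  rw [← Matrix.diagonal_one, ← Matrix.diagonal_one (n := Bits (2 ^ r)),
    Matrix.diagonal_kronecker_diagonal, Matrix.diagonal_kronecker_diagonal, Matrix.diagonal_add,
    Matrix.submatrix_diagonal_equiv, Matrix.diagonal_mul_diagonal, Matrix.diagonal_mul_diagonal,
    ← Matrix.diagonal_smul, Matrix.diagonal_add, Matrix.le_iff, Matrix.diagonal_sub]
  refine Matrix.PosSemidef.diagonal fun x => ?_
  simp only [Function.comp, halves_apply, Pi.smul_apply, smul_eq_mul, mul_one, one_mul,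
    Pi.zero_apply]
  rw [wt_halves x]
  by_cases hx : x = 0
  · simp only [hx, if_true]
    simp only [fstHalf_zero, sndHalf_zero, wt_eq_zero_iff.mpr rfl]
    simp
  · have hw : 1 ≤ wt (fstHalf x) + wt (sndHalf x) := by
      rw [← wt_halves]; exact Nat.one_le_iff_ne_zero.mpr fun h => hx (wt_eq_zero_iff.mp h)
    have hw' : (1 : ℝ) ≤ wt (fstHalf x) + wt (sndHalf x) := by exact_mod_cast hw
    simp only [hx, if_false, one_mul, mul_one]
    rw [← Complex.ofReal_add, ← Complex.ofReal_add, ← Complex.ofReal_sub]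
    refine Complex.zero_le_real.mpr ?_
    push_cast
    nlinarith

/-- Near-exact elementary measurements give a near-exact recursive measurement. -/
theorem effectsClose_treeEffect {Φ : Type*} [Fintype Φ] [DecidableEq Φ] {o : Φ}
    {v : ∀ r, Φ → Bits (2 ^ r) → ℂ} {δ η : ℝ} (hδ : 0 < δ) (hη : 0 ≤ η)
    (hv : ∀ r, ∑ f, ∑ a, ‖v r f a‖ ^ 2 = 1) {s : ℕ}
    (hve : ∀ r ≤ s, ∑ a, ‖v r o a - zeroState _ a‖ ^ 2 ≤ δ ^ 2)
    (hvη : ∀ r ≤ s, ∑ f ∈ Finset.univ.erase o, ∑ a, ‖v r f a‖ ^ 2 ≤ η) (r j : ℕ) (hr : r ≤ s) :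
    EffectsClose (treeEffect (fun r => krausOf o (v r)) bitSplit r j) (locateEffect r j)
      (errOp (24 * δ + 8 * δ ^ 2 + 2 * η) r) := by
  set κ := 24 * δ + 8 * δ ^ 2 + 2 * η with hκ
  have hκ0 : 0 ≤ κ := by positivity
  have hvo : ∀ r, ∑ a, ‖v r o a‖ ^ 2 ≤ 1 := fun r => by
    rw [← hv r]
    exact Finset.single_le_sum (f := fun f => ∑ a, ‖v r f a‖ ^ 2)
      (fun f _ => Finset.sum_nonneg fun _ _ => by positivity) (Finset.mem_univ o)
  have hK : ∀ r, ∑ d, ∑ f, (krausOf o (v r) d f)ᴴ * krausOf o (v r) d f = 1 :=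
    fun r => sum_krausOf (hv r)
  have hzero : ∀ r, EffectsClose (treeEffect (fun r => krausOf o (v r)) bitSplit r 0)
      (locateEffect r 0) (errOp κ r) := by
    intro r
    have : treeEffect (fun r => krausOf o (v r)) bitSplit r 0 = locateEffect r 0 := by
      funext b
      rw [treeEffect_budget_zero]
      simp only [locateEffect, locate_budget_zero]
      by_cases hb : b = 0
      · simp [hb]
      · simp [hb, Ne.symm hb]
    rw [this]
    exact (EffectsClose.refl _).mono (errOp_nonneg hκ0 r)
  have hadd : ((12 * δ + 4 * δ ^ 2 + η : ℝ) : ℂ) + ((12 * δ + 4 * δ ^ 2 + η : ℝ) : ℂ) =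
      (κ : ℂ) := by
    rw [← Complex.ofReal_add, hκ]; congr 1; ring
  induction r generalizing j with
  | zero =>
    cases j with
    | zero => exact hzero 0
    | succ j =>
      have hX : ∀ d : Fin 2, ∀ b : Bits (2 ^ 0), (0 : Matrix (Bits (2 ^ 0)) (Bits (2 ^ 0)) ℂ) ≤
          if b 0 = d then 1 else 0 := by
        intro d b; split_ifs
        · exact Matrix.PosSemidef.one.nonneg
        · exact le_rfl
      have hX1 : ∀ d : Fin 2, ∑ b : Bits (2 ^ 0),
          (if b 0 = d then (1 : Matrix (Bits (2 ^ 0)) (Bits (2 ^ 0)) ℂ) else 0) = 1 := by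
        intro d
        rw [sum_bits_one fun d' => if d' = d then
          (1 : Matrix (Bits (2 ^ 0)) (Bits (2 ^ 0)) ℂ) else 0]
        simp
      have h := (effectsClose_krausOf hδ (zeroState_norm _) (hvo 0) (hve 0 hr) (hvη 0 hr)
        (hX 0) (hX1 0) 0).add
        (effectsClose_krausOf hδ (zeroState_norm _) (hvo 0) (hve 0 hr) (hvη 0 hr)
        (hX 1) (hX1 1) 1)
      have e1 : (fun b : Bits (2 ^ 0) =>
          ∑ f, (krausOf o (v 0) 0 f)ᴴ * (if b 0 = 0 then 1 else 0) * krausOf o (v 0) 0 f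
          + ∑ f, (krausOf o (v 0) 1 f)ᴴ * (if b 0 = 1 then 1 else 0) * krausOf o (v 0) 1 f)
          = treeEffect (fun r => krausOf o (v r)) bitSplit 0 (j + 1) := by
        funext b
        rw [treeEffect]
        generalize b 0 = d
        fin_cases d <;> simp
      have e2 : (fun b : Bits (2 ^ 0) => (exactProj (zeroState (2 ^ 0)) 0)ᴴ *
            (if b 0 = 0 then 1 else 0) * exactProj (zeroState (2 ^ 0)) 0
          + (exactProj (zeroState (2 ^ 0)) 1)ᴴ *
            (if b 0 = 1 then 1 else 0) * exactProj (zeroState (2 ^ 0)) 1)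
          = locateEffect 0 (j + 1) := by
        funext b
        have hb : ∀ x y : Bits (2 ^ 0), x = y ↔ x 0 = y 0 := fun x y =>
          (Equiv.funUnique (Fin 1) (Fin 2)).injective.eq_iff.symm
        have hc : ∀ d : Fin 2, (exactProj (zeroState (2 ^ 0)) d)
            = Matrix.diagonal fun x => if x 0 = d then (1 : ℂ) else 0 := by
          intro d
          rw [exactProj]
          split_ifs with hd
          · rw [proj_zeroState, hd]; simp only [hb]; rfl
          · rw [one_sub_proj_zeroState]
            congr 1; ext x
            have : d = 1 := by omega
            subst this
            have h2 : x = 0 ↔ ¬ x 0 = 1 := by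
              rw [hb]
              change x 0 = 0 ↔ _
              omega
            by_cases h3 : x 0 = 1 <;> simp [h2, h3]
        simp only [exactProj_conj]
        simp only [hc, locateEffect, locate, hb]
        generalize b 0 = d
        fin_cases d <;> simp
      rw [e1, e2] at h
      refine h.mono ?_
      rw [← add_smul, hadd, errOp]
      simp [Matrix.smul_one_eq_diagonal]
  | succ r ih =>
    cases j with
    | zero => exact hzero (r + 1)
    | succ j =>
      set T := treeEffect (fun r => krausOf o (v r)) bitSplit with hT
      have hT0 : ∀ r j b, 0 ≤ T r j b := fun r j b => treeEffect_nonneg r j b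
      have hT1 : ∀ r j, ∑ b, T r j b = 1 := sum_treeEffect hK bitSplit_isometry
      set X : Bits (2 ^ (r + 1)) → Matrix (Bits (2 ^ (r + 1))) (Bits (2 ^ (r + 1))) ℂ := fun b =>
        (bitSplit r)ᴴ * (T r (j + 1) (fstHalf b) ⊗ₖ T r (j + 1 - wt (fstHalf b)) (sndHalf b))
          * bitSplit r with hX
      have hX0 : ∀ b, 0 ≤ X b := fun b =>
        nonneg_conj (nonneg_kronecker (hT0 _ _ _) (hT0 _ _ _)) _
      have hX1 : ∑ b, X b = 1 := by
        simp only [hX, sum_conj]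
        rw [sum_bits_halves fun b b' => T r (j + 1) b ⊗ₖ T r (j + 1 - wt b) b']
        simp only [kronecker_sum, hT1]
        rw [sum_kronecker, hT1, Matrix.one_kronecker_one, Matrix.mul_one, bitSplit_isometry]
      have hZ0 : ∀ b : Bits (2 ^ (r + 1)),
          (0 : Matrix (Bits (2 ^ (r + 1))) (Bits (2 ^ (r + 1))) ℂ) ≤ if b = 0 then 1 else 0 := by
        intro b; split_ifs
        · exact Matrix.PosSemidef.one.nonneg
        · exact le_rfl
      have h0 := effectsClose_krausOf hδ (zeroState_norm _) (hvo _) (hve _ hr) (hvη _ hr)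
        hZ0 (by simp) 0
      have h1 := effectsClose_krausOf hδ (zeroState_norm _) (hvo _) (hve _ hr) (hvη _ hr)
        hX0 hX1 1
      have hk : EffectsClose X (fun b => (bitSplit r)ᴴ * (locateEffect r (j + 1) (fstHalf b) ⊗ₖ
          locateEffect r (j + 1 - wt (fstHalf b)) (sndHalf b)) * bitSplit r)
          ((bitSplit r)ᴴ * (errOp κ r ⊗ₖ 1 + 1 ⊗ₖ errOp κ r) * bitSplit r) :=
        ((EffectsClose.kronecker (F := T r (j + 1)) (F' := fun b => T r (j + 1 - wt b))
          (G' := fun b => locateEffect r (j + 1 - wt b)) (ih (j + 1) (by omega))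
          (fun a => ih _ (by omega)) (fun a b => hT0 _ _ _) (fun a => hT1 _ _)
          (locateEffect_nonneg _ _) (sum_locateEffect _ _)).comp_equiv (halves r)).conj _
      have h2 := (h0.add h1).trans ((EffectsClose.refl _).add (hk.conj (exactProj (zeroState _) 1)))
      rw [zero_add, ← add_smul, hadd] at h2
      have h3 := h2.mono (errOp_succ hκ0 r)
      convert h3 using 2 with b b
      · rw [hT, treeEffect]
        congr 1
        split_ifs <;> simp
      · rw [locateEffect_succ]
        congr 1
        split_ifs
        · rw [Matrix.mul_one, exactProj_conj, exactProj_mul_self (zeroState_norm _)]; rfl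
        · simp

/-! ### The compressed measurement in the Heisenberg picture -/

/-- The Kraus operators of the elementary measurement on the registers. -/
def regKraus (β : ℝ) (k m ρ r : ℕ) : Fin 2 → Flag ρ → Matrix (Reg k m) (Reg k m) ℂ :=
  krausOf 0 fun f c => prepVec β k m ρ (2 ^ r) (c, f)

theorem measStep_eq (β : ℝ) (k m ρ r : ℕ) {E : Type u} [Fintype E] [DecidableEq E] (d : Fin 2)
    (σ : Matrix (Reg k m × E) (Reg k m × E) ℂ) :
    measStep β k m ρ (2 ^ r) d σ = ∑ f, conjFst (regKraus β k m ρ r d f) σ := by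
  rw [measStep]
  refine Finset.sum_congr rfl fun f _ => ?_
  congr 1
  ext c c'
  simp only [Matrix.of_apply, measOp, regKraus, krausOf]
  by_cases hd : d = 0
  · simp only [hd, if_true]; rfl
  · simp only [hd, if_false, Matrix.sub_apply]
    congr 1
    by_cases hf : f = 0
    · simp [hf, Matrix.one_apply]
    · simp [hf]

theorem effectOut_measStep (β : ℝ) (k m ρ r : ℕ) {E : Type u} [Fintype E] [DecidableEq E]
    (d : Fin 2) (G : Matrix (Reg k m) (Reg k m) ℂ) (σ : Matrix (Reg k m × E) (Reg k m × E) ℂ) :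
    effectOut G (measStep β k m ρ (2 ^ r) d σ)
      = effectOut (∑ f, (regKraus β k m ρ r d f)ᴴ * G * regKraus β k m ρ r d f) σ := by
  rw [measStep_eq, effectOut_sum_right, effectOut_sum]
  exact Finset.sum_congr rfl fun f _ => effectOut_conjFst _ _ _

theorem trFst_measStep (β : ℝ) (k m ρ r : ℕ) {E : Type u} [Fintype E] [DecidableEq E]
    (d : Fin 2) (σ : Matrix (Reg k m × E) (Reg k m × E) ℂ) :
    trFst (measStep β k m ρ (2 ^ r) d σ)
      = effectOut (∑ f, (regKraus β k m ρ r d f)ᴴ * regKraus β k m ρ r d f) σ := by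
  rw [trFst_eq_effectOut, effectOut_measStep]
  simp

theorem measure_eq_effectOut (β : ℝ) (k m ρ r j : ℕ) {E : Type u} [Fintype E] [DecidableEq E]
    (σ : Matrix (Reg k m × E) (Reg k m × E) ℂ) (b : Bits (2 ^ r)) :
    measure β k m ρ r j σ b
      = effectOut (treeEffect (A := fun _ => Reg k m) (regKraus β k m ρ)
          (splitOp k m) r j b) σ := by
  have hzero : ∀ (r : ℕ) {E : Type u} [Fintype E] [DecidableEq E]
      (σ : Matrix (Reg k m × E) (Reg k m × E) ℂ) (b : Bits (2 ^ r)),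
      measure β k m ρ r 0 σ b
        = effectOut (treeEffect (A := fun _ => Reg k m) (regKraus β k m ρ)
            (splitOp k m) r 0 b) σ := by
    intro r E _ _ σ b
    rw [treeEffect_budget_zero]
    have : measure β k m ρ r 0 σ b = if b = 0 then trFst σ else 0 := by cases r <;> rw [measure]
    rw [this]
    split_ifs
    · exact trFst_eq_effectOut σ
    · rw [effectOut_zero]
  induction r generalizing j E with
  | zero =>
    cases j with
    | zero => exact hzero 0 σ b
    | succ j =>
      rw [measure, treeEffect]
      exact trFst_measStep β k m ρ 0 (b 0) σ
  | succ r ih =>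
    cases j with
    | zero => exact hzero (r + 1) σ b
    | succ j =>
      rw [measure, treeEffect, ih, ih, effectOut_add, split, effectOut_effectOut,
        effectOut_conjFst, effectOut_measStep]
      congr 1
      split_ifs
      · exact trFst_measStep β k m ρ (r + 1) 0 σ
      · rw [effectOut_zero]

/-! ### Gaps of bit strings -/

section Gaps

variable {n : ℕ}

theorem wt_cons (a : Fin 2) (y : Bits n) :
    wt (Fin.cons a y : Bits (n + 1)) = a.val + wt y := by
  rw [wt_eq_sum, wt_eq_sum, Fin.sum_univ_succ]; simp

theorem onesBefore_zero (x : Bits n) : onesBefore x 0 = 0 := by simp [onesBefore]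

theorem onesBefore_cons_succ (a : Fin 2) (y : Bits n) (j : ℕ) :
    onesBefore (Fin.cons a y : Bits (n + 1)) (j + 1) = a.val + onesBefore y j := by
  simp only [onesBefore, Finset.card_filter]
  rw [Fin.sum_univ_succ]
  simp only [Fin.cons_zero, Fin.cons_succ, Fin.val_zero, Fin.val_succ, Nat.succ_pos, true_and,
    add_lt_add_iff_right]
  congr 1
  fin_cases a <;> rfl

theorem gap_cons (a : Fin 2) (y : Bits n) (i : ℕ) :
    gap (Fin.cons a y : Bits (n + 1)) i
      = (if a = 0 ∧ i = 0 then 1 else 0) + if a.val ≤ i then gap y (i - a.val) else 0 := by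
  simp only [gap, Finset.card_filter]
  rw [Fin.sum_univ_succ]
  simp only [Fin.cons_zero, Fin.cons_succ, Fin.val_zero, Fin.val_succ, onesBefore_zero,
    onesBefore_cons_succ]
  congr 1
  · simp [eq_comm]
  · split_ifs with h
    · refine Finset.sum_congr rfl fun j _ => ?_
      have : a.val + onesBefore y j.val = i ↔ onesBefore y j.val = i - a.val := by omega
      simp only [this]
    · refine Finset.sum_eq_zero fun j _ => if_neg fun h' => h ?_
      omega

theorem gap_cons_zero_zero (y : Bits n) : gap (Fin.cons 0 y : Bits (n + 1)) 0 = gap y 0 + 1 := by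
  rw [gap_cons]; simp [add_comm]

theorem gap_cons_zero_succ (y : Bits n) (i : ℕ) :
    gap (Fin.cons 0 y : Bits (n + 1)) (i + 1) = gap y (i + 1) := by
  rw [gap_cons]; simp

theorem gap_cons_one_zero (y : Bits n) : gap (Fin.cons 1 y : Bits (n + 1)) 0 = 0 := by
  rw [gap_cons]; simp

theorem gap_cons_one_succ (y : Bits n) (i : ℕ) :
    gap (Fin.cons 1 y : Bits (n + 1)) (i + 1) = gap y i := by
  rw [gap_cons]; simp

theorem gap_add_wt_le (x : Bits n) (i : ℕ) : gap x i + wt x ≤ n := by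
  rw [gap, wt, ← Finset.card_union_of_disjoint]
  · exact (Finset.card_le_univ _).trans (by simp)
  · rw [Finset.disjoint_filter]
    intro j _ h h'
    rw [h.1] at h'
    exact absurd h' (by decide)

theorem eq_of_gap_eq {x y : Bits n} (hw : wt x = wt y) (h : ∀ i < wt x, gap x i = gap y i) :
    x = y := by
  induction n with
  | zero => exact Subsingleton.elim _ _
  | succ n ih =>
    rw [← Fin.cons_self_tail x, ← Fin.cons_self_tail y] at *
    revert hw h
    generalize x 0 = a
    generalize y 0 = b
    generalize (Fin.tail x : Bits n) = x'
    generalize (Fin.tail y : Bits n) = y'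
    intro hw h
    rw [wt_cons, wt_cons] at hw
    rw [wt_cons] at h
    have h01 : ∀ a : Fin 2, a = 0 ∨ a = 1 := by decide
    rcases h01 a with rfl | rfl <;> rcases h01 b with rfl | rfl
    · congr 1
      simp only [Fin.val_zero, zero_add] at hw h
      refine ih hw fun i hi => ?_
      have := h i hi
      rcases i with _ | i
      · rw [gap_cons_zero_zero, gap_cons_zero_zero] at this; omega
      · rwa [gap_cons_zero_succ, gap_cons_zero_succ] at this
    · simp only [Fin.val_zero, Fin.val_one, zero_add] at hw h
      have := h 0 (by omega)
      rw [gap_cons_zero_zero, gap_cons_one_zero] at this; omega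
    · simp only [Fin.val_zero, Fin.val_one, zero_add] at hw h
      have := h 0 (by omega)
      rw [gap_cons_zero_zero, gap_cons_one_zero] at this; omega
    · congr 1
      simp only [Fin.val_one] at hw h
      refine ih (by omega) fun i hi => ?_
      have := h (i + 1) (by omega)
      rwa [gap_cons_one_succ, gap_cons_one_succ] at this

end Gaps

/-! ### Codewords -/

theorem enc_val {k m n : ℕ} (hn : n ≤ m) (x : Bits n) (i : Fin (k + 1)) :
    (enc k m x i).val = if i.val < wt x then gap x i.val else n := by
  have h := gap_add_wt_le x i.val
  unfold enc
  split_ifs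
  · simp only [Fin.ofNat]; exact Nat.mod_eq_of_lt (by omega)
  · simp only [Fin.ofNat]; exact Nat.mod_eq_of_lt (by omega)

theorem enc_inj {k m n : ℕ} (hn : n ≤ m) {x y : Bits n} (hx : wt x ≤ k + 1) (hy : wt y ≤ k + 1)
    (h : enc k m x = enc k m y) : x = y := by
  have hv : ∀ i : ℕ, i < k + 1 → (if i < wt x then gap x i else n)
      = if i < wt y then gap y i else n := by
    intro i hi
    have := congrArg Fin.val (congrFun h ⟨i, hi⟩)
    rwa [enc_val hn, enc_val hn] at this
  have hw : wt x = wt y := by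
    rcases lt_trichotomy (wt x) (wt y) with hlt | heq | hlt
    · have h1 := hv (wt x) (by omega)
      have h2 := gap_add_wt_le y (wt x)
      rw [if_neg (lt_irrefl _), if_pos hlt] at h1
      omega
    · exact heq
    · have h1 := hv (wt y) (by omega)
      have h2 := gap_add_wt_le x (wt y)
      rw [if_neg (lt_irrefl _), if_pos hlt] at h1
      omega
  refine eq_of_gap_eq hw fun i hi => ?_
  have := hv i (by omega)
  rwa [if_pos hi, if_pos (hw ▸ hi)] at this

/-- The encoding `C_n^k` as an operator; it vanishes on strings with more than `k + 1` ones. -/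
def encMat (k m n : ℕ) : Matrix (Reg k m) (Bits n) ℂ :=
  Matrix.of fun c x => if wt x ≤ k + 1 ∧ enc k m x = c then 1 else 0

/-- The projection onto the strings with at most `k + 1` ones. -/
def capProj (k n : ℕ) : Matrix (Bits n) (Bits n) ℂ :=
  Matrix.diagonal fun x => if wt x ≤ k + 1 then 1 else 0

theorem capProj_conj (k n : ℕ) : (capProj k n)ᴴ = capProj k n := by
  rw [capProj, Matrix.diagonal_conjTranspose]
  congr 1; ext x; simp [apply_ite]

theorem capProj_mul_self (k n : ℕ) : capProj k n * capProj k n = capProj k n := by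
  rw [capProj, Matrix.diagonal_mul_diagonal]
  congr 1; ext x; simp

theorem encMat_isometry {k m n : ℕ} (hn : n ≤ m) :
    (encMat k m n)ᴴ * encMat k m n = capProj k n := by
  ext x y
  simp only [Matrix.mul_apply, Matrix.conjTranspose_apply, encMat, Matrix.of_apply, capProj,
    Matrix.diagonal_apply, apply_ite (star : ℂ → ℂ), star_one, star_zero]
  by_cases hx : wt x ≤ k + 1
  · simp only [hx, true_and, ite_mul, one_mul, zero_mul, Finset.sum_ite_eq, Finset.mem_univ,
      if_true]
    by_cases hxy : x = y
    · subst hxy; simp [hx]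
    · rw [if_neg hxy, if_neg]
      rintro ⟨hy, he⟩
      exact hxy (enc_inj hn hx hy he.symm)
  · simp [hx]

theorem splitOp_eq (k m r : ℕ) :
    splitOp k m r = (encMat k m (2 ^ r) ⊗ₖ encMat k m (2 ^ r)) * bitSplit r
      * (encMat k m (2 ^ (r + 1)))ᴴ := by
  ext p c
  have e : ∀ y, ((encMat k m (2 ^ r) ⊗ₖ encMat k m (2 ^ r)) * bitSplit r) p y
      = encMat k m (2 ^ r) p.1 (fstHalf y) * encMat k m (2 ^ r) p.2 (sndHalf y) := by
    intro y
    simp only [Matrix.mul_apply, bitSplit, Matrix.submatrix_apply, Matrix.one_apply, id, mul_ite,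
      mul_one, mul_zero, Finset.sum_ite_eq', Finset.mem_univ, if_true]
    rfl
  rw [Matrix.mul_apply, splitOp, Matrix.of_apply]
  refine Finset.sum_congr rfl fun x _ => ?_
  rw [e]
  simp only [encMat, Matrix.of_apply, Matrix.conjTranspose_apply]
  have hw := wt_halves x
  by_cases hx : wt x ≤ k + 1
  · have h1 : wt (fstHalf x) ≤ k + 1 := by omega
    have h2 : wt (sndHalf x) ≤ k + 1 := by omega
    by_cases a1 : enc k m x = c <;> by_cases a2 : enc k m (fstHalf x) = p.1 <;>
      by_cases a3 : enc k m (sndHalf x) = p.2 <;> simp [hx, h1, h2, a1, a2, a3]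
  · simp [hx]

theorem capProj_bitSplit (k r : ℕ) :
    (capProj k (2 ^ r) ⊗ₖ capProj k (2 ^ r)) * bitSplit r * capProj k (2 ^ (r + 1))
      = bitSplit r * capProj k (2 ^ (r + 1)) := by
  ext p x
  simp only [capProj, Matrix.diagonal_kronecker_diagonal, Matrix.mul_diagonal, Matrix.diagonal_mul,
    bitSplit, Matrix.submatrix_apply, Matrix.one_apply, id]
  have hw := wt_halves x
  by_cases hp : p = halves r x
  · subst hp
    by_cases hx : wt x ≤ k + 1
    · have h1 : wt (fstHalf x) ≤ k + 1 := by omega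
      have h2 : wt (sndHalf x) ≤ k + 1 := by omega
      simp [hx, h1, h2]
    · simp [hx]
  · rw [halves_apply] at hp
    simp [hp]

/-! ### Tensor powers of one-qubit operators -/

theorem tpow_mul (A B : Matrix (Fin 2) (Fin 2) ℂ) (n : ℕ) :
    tpow A n * tpow B n = tpow (A * B) n := by
  ext x y
  simp only [Matrix.mul_apply, tpow, Matrix.of_apply, ← Finset.prod_mul_distrib]
  rw [Finset.prod_univ_sum]
  simp [Fintype.piFinset_univ]

theorem tpow_one (n : ℕ) : tpow 1 n = 1 := by
  ext x y
  simp only [tpow, Matrix.of_apply, Matrix.one_apply]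
  by_cases h : x = y
  · simp [h]
  · rw [if_neg h]
    obtain ⟨j, hj⟩ := Function.ne_iff.mp h
    exact Finset.prod_eq_zero (Finset.mem_univ j) (if_neg hj)

theorem tpow_conjTranspose (A : Matrix (Fin 2) (Fin 2) ℂ) (n : ℕ) : (tpow A n)ᴴ = tpow Aᴴ n := by
  ext x y
  simp [tpow]

theorem bitSplit_tpow (A : Matrix (Fin 2) (Fin 2) ℂ) (r : ℕ) :
    bitSplit r * tpow A (2 ^ (r + 1)) = (tpow A (2 ^ r) ⊗ₖ tpow A (2 ^ r)) * bitSplit r := by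
  ext p x
  obtain ⟨y, rfl⟩ := (halves r).surjective p
  have h1 : (bitSplit r * tpow A (2 ^ (r + 1))) (halves r y) x = tpow A (2 ^ (r + 1)) y x := by
    simp only [Matrix.mul_apply, bitSplit, Matrix.submatrix_apply, Matrix.one_apply, id,
      EmbeddingLike.apply_eq_iff_eq, ite_mul, one_mul, zero_mul, Finset.sum_ite_eq,
      Finset.mem_univ, if_true]
  have h2 : ((tpow A (2 ^ r) ⊗ₖ tpow A (2 ^ r)) * bitSplit r) (halves r y) x
      = tpow A (2 ^ r) (fstHalf y) (fstHalf x) * tpow A (2 ^ r) (sndHalf y) (sndHalf x) := by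
    simp only [Matrix.mul_apply, bitSplit, Matrix.submatrix_apply, Matrix.one_apply, id, mul_ite,
      mul_one, mul_zero, Finset.sum_ite_eq', Finset.mem_univ, if_true]
    rfl
  rw [h1, h2]
  exact prod_halves fun j => A (y j) (x j)

theorem alpha_sq {β : ℝ} (h0 : 0 < β) (h1 : β < 1) : alpha β ^ 2 = 1 - β ^ 2 :=
  Real.sq_sqrt (by nlinarith)

theorem gateR_mul_self {β : ℝ} (h0 : 0 < β) (h1 : β < 1) : gateR β * gateR β = 1 := by
  have h : ((alpha β : ℝ) : ℂ) * alpha β + (β : ℂ) * β = 1 := by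
    have := alpha_sq h0 h1
    exact_mod_cast (by nlinarith : alpha β * alpha β + β * β = 1)
  ext i j
  fin_cases i <;> fin_cases j <;> simp [gateR, Matrix.mul_apply, Fin.sum_univ_two]
  · exact h
  · ring
  · ring
  · rw [add_comm]; exact h

theorem gateR_conj (β : ℝ) : (gateR β)ᴴ = gateR β := by
  ext i j
  fin_cases i <;> fin_cases j <;> simp [gateR]

theorem tpow_gateR_conj (β : ℝ) (n : ℕ) : (tpow (gateR β) n)ᴴ = tpow (gateR β) n := by
  rw [tpow_conjTranspose, gateR_conj]

theorem tpow_gateR_mul_self {β : ℝ} (h0 : 0 < β) (h1 : β < 1) (n : ℕ) :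
    tpow (gateR β) n * tpow (gateR β) n = 1 := by
  rw [tpow_mul, gateR_mul_self h0 h1, tpow_one]

/-! ### From the registers to uncompressed qubits -/

/-- The amplitudes, on uncompressed control qubits, of the succinct state with the error flag in the
state `f`. -/
def prepCoeff (β : ℝ) (k ρ n : ℕ) (f : Flag ρ) : Bits n → ℂ := fun x =>
  if wt x ≤ k + 1 then (prepAmp β k x : ℂ) * prepFlag β k ρ x f else 0

theorem prepVec_eq (β : ℝ) (k m ρ n : ℕ) (f : Flag ρ) :
    (fun c => prepVec β k m ρ n (c, f)) = encMat k m n *ᵥ prepCoeff β k ρ n f := by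
  ext c
  simp only [prepVec, Matrix.mulVec, dotProduct, encMat, Matrix.of_apply, prepCoeff]
  refine Finset.sum_congr rfl fun x _ => ?_
  by_cases hx : wt x ≤ k + 1 <;> by_cases he : enc k m x = c <;> simp [hx, he]

theorem capProj_prepCoeff (β : ℝ) (k ρ n : ℕ) (f : Flag ρ) :
    capProj k n *ᵥ prepCoeff β k ρ n f = prepCoeff β k ρ n f := by
  ext x
  rw [capProj, Matrix.mulVec_diagonal, prepCoeff]
  split_ifs <;> simp

/-- The components of the succinct state in the basis of the final measurement. -/
def rotCoeff (β : ℝ) (k ρ n : ℕ) (f : Flag ρ) : Bits n → ℂ :=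
  tpow (gateR β) n *ᵥ prepCoeff β k ρ n f

theorem krausOf_intertwine {A B Φ : Type*} [Fintype A] [Fintype B] [DecidableEq A] [DecidableEq B]
    [Fintype Φ] [DecidableEq Φ] (M : Matrix A B ℂ) {o : Φ} {v : Φ → B → ℂ}
    (hv : (Mᴴ * M) *ᵥ v o = v o) (d : Fin 2) (f : Φ) :
    krausOf o (fun f => M *ᵥ v f) d f * M = M * krausOf o v d f := by
  have h : Matrix.vecMulVec (M *ᵥ v f) (star (M *ᵥ v o)) * M
      = M * Matrix.vecMulVec (v f) (star (v o)) := by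
    rw [Matrix.vecMulVec_mul, Matrix.mul_vecMulVec]
    congr 1
    rw [Matrix.star_mulVec, Matrix.vecMul_vecMul, ← Matrix.conjTranspose_conjTranspose (Mᴴ * M),
      ← Matrix.star_mulVec, Matrix.conjTranspose_mul, Matrix.conjTranspose_conjTranspose, hv]
  unfold krausOf
  split_ifs
  · exact h
  · rw [Matrix.sub_mul, h, Matrix.mul_sub, Matrix.one_mul, Matrix.mul_one]
  · rw [Matrix.sub_mul, h, Matrix.mul_sub, Matrix.zero_mul, Matrix.mul_zero]

theorem krausOf_comm {B Φ : Type*} [Fintype B] [DecidableEq B]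
    [Fintype Φ] [DecidableEq Φ] {P : Matrix B B ℂ} (hP : Pᴴ = P) {o : Φ} {v : Φ → B → ℂ}
    (hv : ∀ f, P *ᵥ v f = v f) (d : Fin 2) (f : Φ) :
    krausOf o v d f * P = P * krausOf o v d f := by
  have h : Matrix.vecMulVec (v f) (star (v o)) * P = P * Matrix.vecMulVec (v f) (star (v o)) := by
    rw [Matrix.vecMulVec_mul, Matrix.mul_vecMulVec, hv]
    congr 1
    nth_rw 1 [← hP]
    rw [← Matrix.star_mulVec, hv]
  unfold krausOf
  split_ifs
  · exact h
  · rw [Matrix.sub_mul, h, Matrix.mul_sub, Matrix.one_mul, Matrix.mul_one]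
  · rw [Matrix.sub_mul, h, Matrix.mul_sub, Matrix.zero_mul, Matrix.mul_zero]

/-- The effects of the recursive measurement of the registers, seen on uncompressed qubits in the
rotated basis: they are those of a recursive measurement of these qubits, compressed to the strings
with at most `k + 1` ones. -/
theorem regEffect_pullback {β : ℝ} (h0 : 0 < β) (h1 : β < 1) (k ρ s j : ℕ) (b : Bits (2 ^ s)) :
    (encMat k (2 ^ s) (2 ^ s) * tpow (gateR β) (2 ^ s))ᴴ *
      treeEffect (A := fun _ => Reg k (2 ^ s)) (regKraus β k (2 ^ s) ρ) (splitOp k (2 ^ s)) s j b *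
      (encMat k (2 ^ s) (2 ^ s) * tpow (gateR β) (2 ^ s))
    = (tpow (gateR β) (2 ^ s) * capProj k (2 ^ s) * tpow (gateR β) (2 ^ s)) *
      treeEffect (A := fun r => Bits (2 ^ r)) (fun r => krausOf 0 (rotCoeff β k ρ (2 ^ r)))
          bitSplit s j b *
      (tpow (gateR β) (2 ^ s) * capProj k (2 ^ s) * tpow (gateR β) (2 ^ s)) := by
  have hR : ∀ n, tpow (gateR β) n * tpow (gateR β) n = 1 := tpow_gateR_mul_self h0 h1
  have hRc : ∀ n, (tpow (gateR β) n)ᴴ = tpow (gateR β) n := tpow_gateR_conj β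
  have hRl : ∀ n {B : Type} (X : Matrix (Bits n) B ℂ),
      tpow (gateR β) n * (tpow (gateR β) n * X) = X := fun n B X => by
    rw [← Matrix.mul_assoc, hR, Matrix.one_mul]
  have hpow : ∀ r ≤ s, 2 ^ r ≤ 2 ^ s := fun r hr => Nat.pow_le_pow_right (by norm_num) hr
  have hPv : ∀ r f, (tpow (gateR β) (2 ^ r) * capProj k (2 ^ r) * tpow (gateR β) (2 ^ r)) *ᵥ
      rotCoeff β k ρ (2 ^ r) f = rotCoeff β k ρ (2 ^ r) f := by
    intro r f
    rw [rotCoeff, Matrix.mulVec_mulVec, Matrix.mul_assoc, hR, Matrix.mul_one,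
      ← Matrix.mulVec_mulVec, capProj_prepCoeff]
  have hMM : ∀ r ≤ s, (encMat k (2 ^ s) (2 ^ r) * tpow (gateR β) (2 ^ r))ᴴ *
      (encMat k (2 ^ s) (2 ^ r) * tpow (gateR β) (2 ^ r))
      = tpow (gateR β) (2 ^ r) * capProj k (2 ^ r) * tpow (gateR β) (2 ^ r) := by
    intro r hr
    rw [Matrix.conjTranspose_mul, hRc, ← encMat_isometry (hpow r hr)]
    simp only [Matrix.mul_assoc]
  have hPh : ∀ r, (tpow (gateR β) (2 ^ r) * capProj k (2 ^ r) * tpow (gateR β) (2 ^ r))ᴴ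
      = tpow (gateR β) (2 ^ r) * capProj k (2 ^ r) * tpow (gateR β) (2 ^ r) := by
    intro r
    rw [Matrix.conjTranspose_mul, Matrix.conjTranspose_mul, hRc, capProj_conj, Matrix.mul_assoc]
  refine treeEffect_pullback (fun r => encMat k (2 ^ s) (2 ^ r) * tpow (gateR β) (2 ^ r))
    (fun r => tpow (gateR β) (2 ^ r) * capProj k (2 ^ r) * tpow (gateR β) (2 ^ r)) (s := s)
    hMM hPh ?_ ?_ ?_ ?_ ?_ s j le_rfl b
  · intro r
    simp only [Matrix.mul_assoc]
    rw [hRl, ← Matrix.mul_assoc (capProj k (2 ^ r)), capProj_mul_self]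
  · intro r hr d f
    have := krausOf_intertwine (encMat k (2 ^ s) (2 ^ r) * tpow (gateR β) (2 ^ r))
      (o := (0 : Flag ρ)) (v := rotCoeff β k ρ (2 ^ r)) (by rw [hMM r hr, hPv]) d f
    rw [← this, regKraus]
    congr 2
    ext f' : 1
    rw [prepVec_eq, rotCoeff, Matrix.mulVec_mulVec, Matrix.mul_assoc, hR, Matrix.mul_one]
  · intro r d f
    exact krausOf_comm (hPh r) (hPv r) d f
  · intro r hr
    rw [splitOp_eq, Matrix.mul_kronecker_mul]
    have e1 : (encMat k (2 ^ s) (2 ^ (r + 1)))ᴴ * (encMat k (2 ^ s) (2 ^ (r + 1)) *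
        tpow (gateR β) (2 ^ (r + 1))) = capProj k (2 ^ (r + 1)) * tpow (gateR β) (2 ^ (r + 1)) := by
      rw [← Matrix.mul_assoc, encMat_isometry (hpow _ hr)]
    simp only [Matrix.mul_assoc]
    rw [e1, ← Matrix.mul_assoc (tpow (gateR β) (2 ^ r) ⊗ₖ tpow (gateR β) (2 ^ r)), ← bitSplit_tpow,
      Matrix.mul_assoc (bitSplit r), hRl]
  · intro r
    rw [Matrix.mul_kronecker_mul, Matrix.mul_kronecker_mul]
    simp only [Matrix.mul_assoc]
    rw [← Matrix.mul_assoc (tpow (gateR β) (2 ^ r) ⊗ₖ tpow (gateR β) (2 ^ r)) (bitSplit r),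
      ← bitSplit_tpow, Matrix.mul_assoc (bitSplit r), hRl]
    have e2 := capProj_bitSplit k r
    rw [Matrix.mul_assoc] at e2
    have e3 : bitSplit r * (capProj k (2 ^ (r + 1)) * tpow (gateR β) (2 ^ (r + 1)))
        = bitSplit r * capProj k (2 ^ (r + 1)) * tpow (gateR β) (2 ^ (r + 1)) := by
      rw [Matrix.mul_assoc]
    rw [e3, ← Matrix.mul_assoc (capProj k (2 ^ r) ⊗ₖ capProj k (2 ^ r)), e2, ← e3,
      ← Matrix.mul_assoc, ← bitSplit_tpow]
    simp only [Matrix.mul_assoc]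

/-! ### Weights of product distributions -/

theorem sum_bits_cons {M : Type*} [AddCommMonoid M] {n : ℕ} (f : Bits (n + 1) → M) :
    ∑ x, f x = ∑ a, ∑ y : Bits n, f (Fin.cons a y) := by
  rw [← Fintype.sum_prod_type' fun a (y : Bits n) => f (Fin.cons a y)]
  exact (Fintype.sum_equiv (Fin.consEquiv fun _ => Fin 2) _ _ fun _ => rfl).symm

theorem sum_prod_bits {n : ℕ} (g : Fin n → Fin 2 → ℝ) :
    ∑ x : Bits n, ∏ j, g j (x j) = ∏ j, ∑ a, g j a := by
  rw [Finset.prod_univ_sum]; simp [Fintype.piFinset_univ]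

/-- A bound on one-qubit operators by diagonal quadratic forms passes to tensor products. -/
theorem sum_tensor_le {n : ℕ} (A : Fin n → Matrix (Fin 2) (Fin 2) ℂ) (τ μ : Fin n → Fin 2 → ℝ)
    (hτ : ∀ j a, 0 ≤ τ j a) (hμ : ∀ j a, 0 ≤ μ j a)
    (hA : ∀ j (z : Fin 2 → ℂ), ∑ b, τ j b * ‖∑ x, A j b x * z x‖ ^ 2 ≤ ∑ x, μ j x * ‖z x‖ ^ 2)
    (h : Bits n → ℂ) :
    ∑ b : Bits n, (∏ j, τ j (b j)) * ‖∑ x : Bits n, (∏ j, A j (b j) (x j)) * h x‖ ^ 2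
      ≤ ∑ x : Bits n, (∏ j, μ j (x j)) * ‖h x‖ ^ 2 := by
  induction n with
  | zero => simp
  | succ n ih =>
    rw [sum_bits_cons, sum_bits_cons]
    have e : ∀ a (b : Bits n), ∑ x : Bits (n + 1),
        (∏ j, A j ((Fin.cons a b : Bits (n + 1)) j) (x j)) * h x
        = ∑ y : Bits n, (∏ j : Fin n, A j.succ (b j) (y j)) *
          ∑ c, A 0 a c * h (Fin.cons c y) := by
      intro a b
      rw [sum_bits_cons, Finset.sum_comm]
      refine Finset.sum_congr rfl fun y _ => ?_
      rw [Finset.mul_sum]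
      refine Finset.sum_congr rfl fun c _ => ?_
      rw [Fin.prod_univ_succ]
      simp only [Fin.cons_zero, Fin.cons_succ]
      ring
    simp only [e]
    simp only [Fin.prod_univ_succ, Fin.cons_zero, Fin.cons_succ]
    calc _ ≤ ∑ a, τ 0 a * ∑ y : Bits n, (∏ j : Fin n, μ j.succ (y j)) *
          ‖∑ c, A 0 a c * h (Fin.cons c y)‖ ^ 2 := by
          refine Finset.sum_le_sum fun a _ => ?_
          simp only [mul_assoc]
          rw [← Finset.mul_sum]
          exact mul_le_mul_of_nonneg_left (ih (fun j => A j.succ) (fun j => τ j.succ)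
            (fun j => μ j.succ) (fun j => hτ _) (fun j => hμ _) (fun j => hA _) _) (hτ 0 a)
      _ = ∑ y : Bits n, (∏ j : Fin n, μ j.succ (y j)) *
          ∑ a, τ 0 a * ‖∑ c, A 0 a c * h (Fin.cons c y)‖ ^ 2 := by
          simp only [Finset.mul_sum]
          rw [Finset.sum_comm]
          exact Finset.sum_congr rfl fun y _ => Finset.sum_congr rfl fun a _ => by ring
      _ ≤ ∑ y : Bits n, (∏ j : Fin n, μ j.succ (y j)) *
          ∑ c, μ 0 c * ‖h (Fin.cons c y)‖ ^ 2 :=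
          Finset.sum_le_sum fun y _ => mul_le_mul_of_nonneg_left (hA 0 _)
            (Finset.prod_nonneg fun j _ => hμ _ _)
      _ = _ := by
          simp only [Finset.mul_sum]
          rw [Finset.sum_comm]
          exact Finset.sum_congr rfl fun y _ => Finset.sum_congr rfl fun a _ => by ring

theorem card_filter_one {n : ℕ} (x : Bits n) :
    (Finset.univ.filter fun j => x j = 1).card = wt x := rfl

/-- The union bound: if prescribed ones cost a factor `lam` each, then the weight of at least `K`
ones is at most `(n lam) ^ K / K!`. -/
theorem tail_le {n : ℕ} {p : Bits n → ℝ} (hp : ∀ x, 0 ≤ p x) {lam : ℝ} (hl : 0 ≤ lam)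
    (h : ∀ S : Finset (Fin n), (∑ x, if ∀ j ∈ S, x j = 1 then p x else 0) ≤ lam ^ S.card) (K : ℕ) :
    (∑ x, if K ≤ wt x then p x else 0) ≤ (n * lam) ^ K / K.factorial := by
  calc (∑ x, if K ≤ wt x then p x else 0)
      ≤ ∑ x, ∑ S ∈ Finset.univ.powersetCard K, if ∀ j ∈ S, x j = 1 then p x else 0 := by
        refine Finset.sum_le_sum fun x _ => ?_
        have hnn : ∀ S ∈ (Finset.univ : Finset (Fin n)).powersetCard K,
            0 ≤ if ∀ j ∈ S, x j = 1 then p x else 0 := by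
          intro S _; split_ifs; exacts [hp x, le_rfl]
        split_ifs with hK
        · obtain ⟨S, hS, hc⟩ := Finset.exists_subset_card_eq hK
          refine le_trans ?_ (Finset.single_le_sum hnn
            (Finset.mem_powersetCard.mpr ⟨Finset.subset_univ S, hc⟩))
          rw [if_pos]
          intro j hj
          exact (Finset.mem_filter.mp (hS hj)).2
        · exact Finset.sum_nonneg hnn
    _ = ∑ S ∈ (Finset.univ : Finset (Fin n)).powersetCard K,
          ∑ x, if ∀ j ∈ S, x j = 1 then p x else 0 := Finset.sum_comm
    _ ≤ ∑ S ∈ (Finset.univ : Finset (Fin n)).powersetCard K, lam ^ K := by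
        refine Finset.sum_le_sum fun S hS => ?_
        rw [← (Finset.mem_powersetCard.mp hS).2]
        exact h S
    _ = (n.choose K : ℝ) * lam ^ K := by
        rw [Finset.sum_const, Finset.card_powersetCard, Finset.card_univ, Fintype.card_fin,
          nsmul_eq_mul]
    _ ≤ (n : ℝ) ^ K / K.factorial * lam ^ K :=
        mul_le_mul_of_nonneg_right (Nat.choose_le_pow_div K n) (pow_nonneg hl K)
    _ = _ := by rw [mul_pow]; ring

theorem mean_wt_le {n : ℕ} {p : Bits n → ℝ} {lam : ℝ}
    (h : ∀ S : Finset (Fin n), (∑ x, if ∀ j ∈ S, x j = 1 then p x else 0) ≤ lam ^ S.card) :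
    ∑ x, wt x * p x ≤ n * lam := by
  have e : ∀ x : Bits n, (wt x : ℝ) * p x = ∑ j, if x j = 1 then p x else 0 := by
    intro x
    rw [← Finset.sum_filter, Finset.sum_const, nsmul_eq_mul]; rfl
  simp only [e]
  rw [Finset.sum_comm]
  calc ∑ j, ∑ x : Bits n, (if x j = 1 then p x else 0) ≤ ∑ j : Fin n, lam := by
        refine Finset.sum_le_sum fun j _ => ?_
        simpa using h {j}
    _ = n * lam := by simp

/-! ### The product state and the succinct amplitudes -/

/-- The amplitudes of `(R |0⟩)^{⊗n}`. -/
def bitAmp (β : ℝ) {n : ℕ} (x : Bits n) : ℝ := ∏ j, if x j = 1 then β else alpha β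

theorem bitAmp_eq (β : ℝ) {n : ℕ} (x : Bits n) :
    bitAmp β x = alpha β ^ (n - wt x) * β ^ wt x := by
  rw [bitAmp, Finset.prod_ite, Finset.prod_const, Finset.prod_const, mul_comm, card_filter_one]
  congr 2
  have := Finset.card_filter_add_card_filter_not (s := (Finset.univ : Finset (Fin n)))
    (fun j => x j = 1)
  rw [card_filter_one, Finset.card_univ, Fintype.card_fin] at this
  omega

theorem alpha_nonneg (β : ℝ) : 0 ≤ alpha β := Real.sqrt_nonneg _

theorem bitAmp_sq_marginal {β : ℝ} (h0 : 0 < β) (h1 : β < 1) {n : ℕ} (S : Finset (Fin n)) :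
    (∑ x : Bits n, if ∀ j ∈ S, x j = 1 then bitAmp β x ^ 2 else 0) = (β ^ 2) ^ S.card := by
  have e : ∀ x : Bits n, (if ∀ j ∈ S, x j = 1 then bitAmp β x ^ 2 else 0)
      = ∏ j, if j ∈ S then (if x j = 1 then β ^ 2 else 0)
          else (if x j = 1 then β ^ 2 else alpha β ^ 2) := by
    intro x
    split_ifs with h
    · rw [bitAmp, ← Finset.prod_pow]
      refine Finset.prod_congr rfl fun j _ => ?_
      by_cases hj : j ∈ S
      · simp [hj, h j hj]
      · by_cases hx : x j = 1 <;> simp [hj, hx]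
    · push Not at h
      obtain ⟨j, hj, hx⟩ := h
      exact (Finset.prod_eq_zero (Finset.mem_univ j) (by simp [hj, hx])).symm
  simp only [e]
  rw [sum_prod_bits fun j a => if j ∈ S then (if a = 1 then β ^ 2 else 0)
          else (if a = 1 then β ^ 2 else alpha β ^ 2)]
  have e2 : ∀ j, (∑ a : Fin 2, if j ∈ S then (if a = 1 then β ^ 2 else 0)
          else (if a = 1 then β ^ 2 else alpha β ^ 2)) = if j ∈ S then β ^ 2 else 1 := by
    intro j
    rw [Fin.sum_univ_two, alpha_sq h0 h1]
    by_cases hj : j ∈ S <;> simp [hj]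
  simp only [e2]
  rw [Finset.prod_ite_mem, Finset.univ_inter, Finset.prod_const]

theorem sum_bitAmp_sq {β : ℝ} (h0 : 0 < β) (h1 : β < 1) (n : ℕ) :
    ∑ x : Bits n, bitAmp β x ^ 2 = 1 := by
  simpa using bitAmp_sq_marginal h0 h1 (∅ : Finset (Fin n))

/-- The amplitudes of the succinct state with `K` registers, `K = 0` being allowed. -/
def succAmp (β : ℝ) (K : ℕ) {n : ℕ} (x : Bits n) : ℝ :=
  if wt x < K then alpha β ^ (n - wt x) * β ^ wt x
  else alpha β ^ (∑ i ∈ Finset.range K, gap x i) * β ^ K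

theorem wt_le {n : ℕ} (x : Bits n) : wt x ≤ n := (Finset.card_le_univ _).trans (by simp)

theorem succAmp_cons_zero (β : ℝ) (K : ℕ) {n : ℕ} (y : Bits n) :
    succAmp β (K + 1) (Fin.cons 0 y : Bits (n + 1)) = alpha β * succAmp β (K + 1) y := by
  have := wt_le y
  simp only [succAmp, wt_cons, Fin.val_zero, zero_add]
  split_ifs
  · rw [Nat.succ_sub this, pow_succ]; ring
  · rw [Finset.sum_range_succ', Finset.sum_range_succ' (gap y), gap_cons_zero_zero]
    simp only [gap_cons_zero_succ]
    ring

theorem succAmp_cons_one (β : ℝ) (K : ℕ) {n : ℕ} (y : Bits n) :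
    succAmp β (K + 1) (Fin.cons 1 y : Bits (n + 1)) = β * succAmp β K y := by
  simp only [succAmp, wt_cons, Fin.val_one]
  by_cases h : wt y < K
  · rw [if_pos (by omega), if_pos h, show n + 1 - (1 + wt y) = n - wt y by omega, pow_add]; ring
  · rw [if_neg (by omega), if_neg h, Finset.sum_range_succ', gap_cons_one_zero]
    simp only [gap_cons_one_succ]
    ring

/-- The succinct state is normalised: its weights are the probabilities of the first `K` ones. -/
theorem sum_succAmp_sq {β : ℝ} (h0 : 0 < β) (h1 : β < 1) (n K : ℕ) :
    (∑ x : Bits n, if wt x ≤ K then succAmp β K x ^ 2 else 0) = 1 := by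
  induction n generalizing K with
  | zero =>
    have hw : ∀ x : Bits 0, wt x = 0 := fun x => by simp [wt]
    have hg : ∀ (x : Bits 0) i, gap x i = 0 := fun x i => by simp [gap]
    rw [Fintype.sum_eq_single (0 : Bits 0) fun x hx => absurd (Subsingleton.elim x 0) hx]
    rcases K with _ | K <;> simp [hw, hg, succAmp]
  | succ n ih =>
    rcases K with _ | K
    · rw [Fintype.sum_eq_single 0]
      · simp [succAmp, wt_eq_zero_iff.mpr]
      · intro x hx
        rw [if_neg]
        rwa [Nat.le_zero, wt_eq_zero_iff]
    · rw [sum_bits_cons, Fin.sum_univ_two]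
      have e0 : (∑ y : Bits n, if wt (Fin.cons 0 y : Bits (n + 1)) ≤ K + 1 then
          succAmp β (K + 1) (Fin.cons 0 y : Bits (n + 1)) ^ 2 else 0) = alpha β ^ 2 := by
        rw [← mul_one (alpha β ^ 2), ← ih (K + 1), Finset.mul_sum]
        refine Finset.sum_congr rfl fun y _ => ?_
        rw [succAmp_cons_zero, wt_cons, mul_ite, mul_zero, mul_pow]; simp
      have e1 : (∑ y : Bits n, if wt (Fin.cons 1 y : Bits (n + 1)) ≤ K + 1 then
          succAmp β (K + 1) (Fin.cons 1 y : Bits (n + 1)) ^ 2 else 0) = β ^ 2 := by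
        rw [← mul_one (β ^ 2), ← ih K, Finset.mul_sum]
        refine Finset.sum_congr rfl fun y _ => ?_
        rw [succAmp_cons_one, wt_cons, mul_ite, mul_zero, mul_pow, Fin.val_one, add_comm 1]; simp
      rw [e0, e1, alpha_sq h0 h1]; ring

theorem prepAmp_eq_succAmp (β : ℝ) (k : ℕ) {n : ℕ} (x : Bits n) :
    prepAmp β k x = succAmp β (k + 1) x := by
  simp only [prepAmp, succAmp, Nat.lt_succ_iff]

theorem prepAmp_of_le (β : ℝ) {k n : ℕ} {x : Bits n} (h : wt x ≤ k) :
    prepAmp β k x = bitAmp β x := by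
  rw [prepAmp, if_pos h, bitAmp_eq]

/-- The codewords with all registers filled carry the weight of at least `k + 1` ones. -/
theorem sum_prepAmp_full {β : ℝ} (h0 : 0 < β) (h1 : β < 1) (n k : ℕ) :
    (∑ x : Bits n, if wt x = k + 1 then prepAmp β k x ^ 2 else 0)
      = ∑ x : Bits n, if k + 1 ≤ wt x then bitAmp β x ^ 2 else 0 := by
  have e1 := sum_succAmp_sq h0 h1 n (k + 1)
  have e2 := sum_bitAmp_sq h0 h1 n
  rw [← e2] at e1
  have s1 : ∀ x : Bits n, (if wt x ≤ k + 1 then succAmp β (k + 1) x ^ 2 else 0)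
      = (if wt x ≤ k then bitAmp β x ^ 2 else 0)
        + if wt x = k + 1 then prepAmp β k x ^ 2 else 0 := by
    intro x
    rw [← prepAmp_eq_succAmp]
    rcases lt_trichotomy (wt x) (k + 1) with h | h | h
    · have h' : wt x ≤ k := by omega
      rw [if_pos h.le, if_pos h', if_neg h.ne, prepAmp_of_le β h', add_zero]
    · rw [if_pos h.le, if_neg (by omega), if_pos h, zero_add]
    · rw [if_neg (by omega), if_neg (by omega), if_neg (by omega), add_zero]
  have s2 : ∀ x : Bits n, bitAmp β x ^ 2 = (if wt x ≤ k then bitAmp β x ^ 2 else 0)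
        + if k + 1 ≤ wt x then bitAmp β x ^ 2 else 0 := by
    intro x
    by_cases h : wt x ≤ k
    · rw [if_pos h, if_neg (by omega), add_zero]
    · rw [if_neg h, if_pos (by omega), zero_add]
  rw [Finset.sum_congr rfl fun x _ => s1 x, Finset.sum_congr rfl fun x _ => s2 x,
    Finset.sum_add_distrib, Finset.sum_add_distrib] at e1
  linarith

/-! ### Exponential superpositions and the error flag -/

theorem sum_flagVal (ρ : ℕ) (g : ℕ → ℝ) :
    ∑ f : Flag ρ, g (flagVal f) = ∑ s ∈ Finset.range (2 ^ ρ + 2 ^ ρ), g s := by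
  have key : ∀ c, ∑ b : Fin ρ → Fin 2, g (c + ∑ j, (b j).val * 2 ^ j.val)
      = ∑ s ∈ Finset.range (2 ^ ρ), g (c + s) := by
    intro c
    rw [← Fin.sum_univ_eq_sum_range fun s => g (c + s)]
    exact Fintype.sum_equiv finFunctionFinEquiv _ _ fun b => by
      rw [finFunctionFinEquiv_apply]
  rw [Fintype.sum_prod_type, Fin.sum_univ_two, Finset.sum_range_add]
  congr 1
  · simpa [flagVal] using key 0
  · simpa [flagVal] using key (2 ^ ρ)

theorem alpha_pow_nonneg (β : ℝ) (s : ℕ) : 0 ≤ alpha β ^ s := pow_nonneg (alpha_nonneg β) s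

theorem alpha_le_one {β : ℝ} : alpha β ≤ 1 :=
  Real.sqrt_le_one.mpr (by nlinarith [sq_nonneg β])

/-- The real amplitude of `|s⟩` in `|φ_p⟩`. -/
def expAmp (β : ℝ) (p s : ℕ) : ℝ :=
  if s < p then β * alpha β ^ s else if s = p then alpha β ^ p else 0

theorem expState_eq (β : ℝ) (ρ p : ℕ) (f : Flag ρ) :
    expState β ρ p f = (expAmp β p (flagVal f) : ℂ) := by
  unfold expState expAmp
  split_ifs <;> simp

theorem expAmp_nonneg {β : ℝ} (h0 : 0 < β) (p s : ℕ) : 0 ≤ expAmp β p s := by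
  unfold expAmp
  split_ifs
  · exact mul_nonneg h0.le (alpha_pow_nonneg _ _)
  · exact alpha_pow_nonneg _ _
  · exact le_rfl

theorem geom_alpha {β : ℝ} (h0 : 0 < β) (h1 : β < 1) (p : ℕ) :
    ∑ s ∈ Finset.range p, (β * alpha β ^ s) ^ 2 = 1 - alpha β ^ (2 * p) := by
  induction p with
  | zero => simp
  | succ p ih =>
    rw [Finset.sum_range_succ, ih, mul_pow]
    have : β ^ 2 = 1 - alpha β ^ 2 := by rw [alpha_sq h0 h1]; ring
    rw [this]; ring

theorem sum_expAmp_sq {β : ℝ} (h0 : 0 < β) (h1 : β < 1) {p N : ℕ} (hp : p < N) :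
    ∑ s ∈ Finset.range N, expAmp β p s ^ 2 = 1 := by
  rw [← Finset.sum_subset (Finset.range_mono (Nat.succ_le_of_lt hp))]
  · rw [Finset.sum_range_succ, Finset.sum_congr rfl (g := fun s => (β * alpha β ^ s) ^ 2),
      geom_alpha h0 h1, expAmp, if_neg (lt_irrefl p), if_pos rfl]
    · ring
    · intro s hs; rw [expAmp, if_pos (Finset.mem_range.mp hs)]
  · intro s _ hs
    rw [Finset.mem_range] at hs
    rw [expAmp, if_neg (by omega), if_neg (by omega)]; simp

theorem expAmp_overlap {β : ℝ} (h0 : 0 < β) (h1 : β < 1) {p q N : ℕ} (hpq : p ≤ q) (hq : q < N) :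
    1 - alpha β ^ (2 * p) ≤ ∑ s ∈ Finset.range N, expAmp β q s * expAmp β p s ∧
      ∑ s ∈ Finset.range N, expAmp β q s * expAmp β p s ≤ 1 := by
  constructor
  · rw [← geom_alpha h0 h1]
    calc _ = ∑ s ∈ Finset.range p, expAmp β q s * expAmp β p s := by
          refine Finset.sum_congr rfl fun s hs => ?_
          rw [Finset.mem_range] at hs
          rw [expAmp, expAmp, if_pos (by omega), if_pos hs, sq]
      _ ≤ _ := Finset.sum_le_sum_of_subset_of_nonneg (Finset.range_mono (by omega))
          fun s _ _ => mul_nonneg (expAmp_nonneg h0 _ _) (expAmp_nonneg h0 _ _)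
  · have e1 := sum_expAmp_sq h0 h1 hq
    have e2 := sum_expAmp_sq h0 h1 (lt_of_le_of_lt hpq hq)
    calc _ ≤ ∑ s ∈ Finset.range N, (expAmp β q s ^ 2 / 2 + expAmp β p s ^ 2 / 2) :=
          Finset.sum_le_sum fun s _ => by nlinarith [sq_nonneg (expAmp β q s - expAmp β p s)]
      _ = 1 := by rw [Finset.sum_add_distrib, ← Finset.sum_div, ← Finset.sum_div, e1, e2]; norm_num

theorem gateM_mul (γ : ℝ) : gateM γ * (gateM γ)ᴴ = 1 := by
  have hpos : (0 : ℝ) < 1 + γ ^ 2 := by positivity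
  have hs : ((1 / √(1 + γ ^ 2) : ℝ) : ℂ) * ((1 / √(1 + γ ^ 2) : ℝ) : ℂ) *
      (1 + (γ : ℂ) * γ) = 1 := by
    have : (1 / √(1 + γ ^ 2)) * (1 / √(1 + γ ^ 2)) * (1 + γ * γ) = 1 := by
      rw [div_mul_div_comm, Real.mul_self_sqrt hpos.le]; field_simp
    exact_mod_cast this
  rw [gateM, Matrix.conjTranspose_smul, Matrix.smul_mul, Matrix.mul_smul, smul_smul,
    Complex.star_def, Complex.conj_ofReal]
  have hT : (!![1, -(γ : ℂ); (γ : ℂ), 1])ᴴ = !![1, (γ : ℂ); -(γ : ℂ), 1] := by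
    ext i j; fin_cases i <;> fin_cases j <;> simp
  have hm : !![1, -(γ : ℂ); (γ : ℂ), 1] * !![1, (γ : ℂ); -(γ : ℂ), 1]
      = (1 + (γ : ℂ) * γ) • (1 : Matrix (Fin 2) (Fin 2) ℂ) := by
    rw [Matrix.mul_fin_two]
    ext i j; fin_cases i <;> fin_cases j <;> simp [add_comm]
  rw [hT, hm, smul_smul, hs, one_smul]

theorem gateW_mul (β : ℝ) (ρ : ℕ) : gateW β ρ * (gateW β ρ)ᴴ = 1 := by
  have hle : alpha β ^ (2 * 2 ^ ρ) ≤ 1 := pow_le_one₀ (alpha_nonneg β) alpha_le_one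
  have hs : ((√(1 - alpha β ^ (2 * 2 ^ ρ)) : ℝ) : ℂ) * (√(1 - alpha β ^ (2 * 2 ^ ρ)) : ℝ)
      + ((alpha β ^ 2 ^ ρ : ℝ) : ℂ) * ((alpha β ^ 2 ^ ρ : ℝ) : ℂ) = 1 := by
    have : √(1 - alpha β ^ (2 * 2 ^ ρ)) * √(1 - alpha β ^ (2 * 2 ^ ρ))
        + alpha β ^ 2 ^ ρ * alpha β ^ 2 ^ ρ = 1 := by
      rw [Real.mul_self_sqrt (by linarith), ← pow_add, two_mul]; ring
    exact_mod_cast this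
  ext i j
  fin_cases i <;> fin_cases j <;>
    simp [gateW, Matrix.mul_apply, Fin.sum_univ_two, -Complex.ofReal_pow]
  · exact hs
  · ring
  · ring
  · rw [add_comm]; exact hs

theorem expPrep_mul (β : ℝ) (ρ : ℕ) : expPrep β ρ * (expPrep β ρ)ᴴ = 1 := by
  set Bm : Fin 2 → Matrix (Fin ρ → Fin 2) (Fin ρ → Fin 2) ℂ := fun c =>
    Matrix.of fun x y => if c = 0 then ∏ j : Fin ρ, gateM (alpha β ^ (2 ^ j.val)) (x j) (y j)
      else if x = y then 1 else 0 with hBm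
  have hB : ∀ c, Bm c * (Bm c)ᴴ = 1 := by
    intro c
    by_cases hc : c = 0
    · ext x y
      simp only [hBm, hc, if_true, Matrix.mul_apply, Matrix.conjTranspose_apply, Matrix.of_apply,
        star_prod, ← Finset.prod_mul_distrib]
      have : ∏ j : Fin ρ, ∑ a, gateM (alpha β ^ (2 ^ j.val)) (x j) a *
          star (gateM (alpha β ^ (2 ^ j.val)) (y j) a) = (1 : Matrix (Fin ρ → Fin 2) _ ℂ) x y := by
        have h1 : ∀ j : Fin ρ, ∑ a, gateM (alpha β ^ (2 ^ j.val)) (x j) a *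
            star (gateM (alpha β ^ (2 ^ j.val)) (y j) a)
            = (1 : Matrix (Fin 2) (Fin 2) ℂ) (x j) (y j) := by
          intro j
          rw [← gateM_mul (alpha β ^ (2 ^ j.val)), Matrix.mul_apply]; rfl
        simp only [h1]
        rw [← tpow_one]; rfl
      rw [← this, Finset.prod_univ_sum]
      simp [Fintype.piFinset_univ]
    · have : Bm c = 1 := by ext x y; simp [hBm, hc, Matrix.one_apply]
      rw [this]; simp
  ext f f'
  have e : ∀ f g, expPrep β ρ f g = gateW β ρ f.1 g.1 * Bm f.1 f.2 g.2 := fun f g => rfl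
  simp only [Matrix.mul_apply, Matrix.conjTranspose_apply, e, Fintype.sum_prod_type, star_mul']
  have h2 : ∀ a b, gateW β ρ f.1 a * Bm f.1 f.2 b *
      (star (gateW β ρ f'.1 a) * star (Bm f'.1 f'.2 b))
      = (gateW β ρ f.1 a * star (gateW β ρ f'.1 a)) * (Bm f.1 f.2 b * star (Bm f'.1 f'.2 b)) := by
    intro a b; ring
  simp only [h2]
  rw [← Finset.sum_mul_sum]
  have hW : ∑ a, gateW β ρ f.1 a * star (gateW β ρ f'.1 a)
      = (1 : Matrix (Fin 2) (Fin 2) ℂ) f.1 f'.1 := by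
    rw [← gateW_mul β ρ, Matrix.mul_apply]; rfl
  rw [hW, Matrix.one_apply, Matrix.one_apply]
  by_cases h : f.1 = f'.1
  · have hBB : ∑ b, Bm f.1 f.2 b * star (Bm f'.1 f'.2 b)
        = (1 : Matrix (Fin ρ → Fin 2) _ ℂ) f.2 f'.2 := by
      rw [← hB f.1, Matrix.mul_apply, ← h]; rfl
    rw [hBB, Matrix.one_apply]
    simp [h, Prod.ext_iff]
  · simp [h, Prod.ext_iff]

theorem prod_one_add_pow (x : ℝ) (ρ : ℕ) :
    (1 - x) * ∏ j : Fin ρ, (1 + x ^ 2 ^ j.val) = 1 - x ^ 2 ^ ρ := by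
  induction ρ with
  | zero => simp
  | succ ρ ih =>
    rw [Fin.prod_univ_castSucc, ← mul_assoc]
    simp only [Fin.val_castSucc, Fin.val_last]
    rw [ih, pow_succ 2 ρ, pow_mul]; ring

/-- The circuit prepares `|φ_q⟩` from `|0⟩`. -/
theorem expPrep_zero {β : ℝ} (h0 : 0 < β) (h1 : β < 1) (ρ : ℕ) (f : Flag ρ) :
    expPrep β ρ f 0 = (expAmp β (2 ^ ρ) (flagVal f) : ℂ) := by
  obtain ⟨c, b⟩ := f
  have hM : ∀ (γ : ℝ) (a : Fin 2), gateM γ a 0 = ((γ ^ a.val / √(1 + γ ^ 2) : ℝ) : ℂ) := by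
    intro γ a
    fin_cases a <;> simp [gateM, div_eq_mul_inv, mul_comm]
  have hlt : ∑ j, (b j).val * 2 ^ j.val < 2 ^ ρ := by
    have := (finFunctionFinEquiv b).isLt
    rwa [finFunctionFinEquiv_apply] at this
  have hc : c = 0 ∨ c = 1 := by omega
  rcases hc with rfl | rfl
  · have hv : flagVal ((0, b) : Flag ρ) = ∑ j, (b j).val * 2 ^ j.val := by simp [flagVal]
    rw [hv, expAmp, if_pos hlt]
    simp only [expPrep, Matrix.of_apply, Prod.fst_zero, Prod.snd_zero, Pi.zero_apply, if_true, hM]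
    have hW : gateW β ρ 0 0 = ((√(1 - alpha β ^ (2 * 2 ^ ρ)) : ℝ) : ℂ) := by simp [gateW]
    rw [hW, ← Complex.ofReal_prod, ← Complex.ofReal_mul]
    congr 1
    rw [Finset.prod_div_distrib]
    have e1 : ∏ j : Fin ρ, (alpha β ^ 2 ^ j.val) ^ (b j).val
        = alpha β ^ ∑ j, (b j).val * 2 ^ j.val := by
      rw [← Finset.prod_pow_eq_pow_sum]
      exact Finset.prod_congr rfl fun j _ => by rw [← pow_mul, mul_comm]
    have hDpos : ∀ j ∈ (Finset.univ : Finset (Fin ρ)), 0 < √(1 + (alpha β ^ 2 ^ j.val) ^ 2) :=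
      fun j _ => Real.sqrt_pos.mpr (by positivity)
    have hD := Finset.prod_pos hDpos
    have e2 : √(1 - alpha β ^ (2 * 2 ^ ρ)) = β * ∏ j : Fin ρ, √(1 + (alpha β ^ 2 ^ j.val) ^ 2) := by
      rw [Real.sqrt_eq_iff_mul_self_eq_of_pos (mul_pos h0 hD)]
      have : ∏ j : Fin ρ, (1 + (alpha β ^ 2) ^ 2 ^ j.val)
          = (∏ j : Fin ρ, √(1 + (alpha β ^ 2 ^ j.val) ^ 2))
            * ∏ j : Fin ρ, √(1 + (alpha β ^ 2 ^ j.val) ^ 2) := by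
        rw [← Finset.prod_mul_distrib]
        refine Finset.prod_congr rfl fun j _ => ?_
        rw [Real.mul_self_sqrt (by positivity), ← pow_mul, ← pow_mul, mul_comm]
      have hb : β ^ 2 = 1 - alpha β ^ 2 := by rw [alpha_sq h0 h1]; ring
      rw [mul_mul_mul_comm, ← this, ← sq, hb, prod_one_add_pow, pow_mul]
    rw [e1, e2]
    field_simp
  · have hv : flagVal ((1, b) : Flag ρ) = 2 ^ ρ + ∑ j, (b j).val * 2 ^ j.val := by simp [flagVal]
    have hW : gateW β ρ 1 0 = ((alpha β ^ 2 ^ ρ : ℝ) : ℂ) := by simp [gateW]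
    have hz : b = 0 ↔ ∑ j, (b j).val * 2 ^ j.val = 0 := by
      rw [Finset.sum_eq_zero_iff]
      constructor
      · rintro rfl j _; simp
      · intro h; funext j
        have := h j (Finset.mem_univ j)
        have h2 : 2 ^ j.val ≠ 0 := by positivity
        exact Fin.ext (by simpa [h2] using this)
    have h10 : (1 : Fin 2) ≠ 0 := by decide
    rw [hv, expAmp, if_neg (by omega)]
    simp only [expPrep, Matrix.of_apply, Prod.fst_zero, Prod.snd_zero, h10, if_false, hW]
    by_cases hb : b = 0
    · rw [if_pos hb, hz.mp hb]; simp
    · rw [if_neg hb, if_neg]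
      · simp
      · intro h; exact hb (hz.mpr (by omega))

theorem prepFlag_norm {β : ℝ} (h0 : 0 < β) (h1 : β < 1) (k ρ : ℕ) {n : ℕ} (x : Bits n) :
    ∑ f, ‖prepFlag β k ρ x f‖ ^ 2 = 1 := by
  rw [prepFlag]
  split_ifs
  · set φ := expState β ρ (2 ^ ρ - gap x (wt x)) with hφ
    have hc : ((∑ f, ‖((expPrep β ρ)ᴴ *ᵥ φ) f‖ ^ 2 : ℝ) : ℂ) = ((∑ f, ‖φ f‖ ^ 2 : ℝ) : ℂ) := by
      rw [← star_dotProduct_self, ← star_dotProduct_self, Matrix.star_mulVec,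
        Matrix.conjTranspose_conjTranspose, ← Matrix.dotProduct_mulVec, Matrix.mulVec_mulVec,
        expPrep_mul, Matrix.one_mulVec]
    rw [Complex.ofReal_inj] at hc
    rw [hc, hφ]
    simp only [expState_eq, Complex.norm_real, Real.norm_eq_abs, sq_abs]
    have hpos : 0 < 2 ^ ρ := by positivity
    rw [sum_flagVal ρ fun s => expAmp β (2 ^ ρ - gap x (wt x)) s ^ 2,
      sum_expAmp_sq h0 h1 (by omega)]
  · simp [apply_ite]

/-- The amplitude of the flag state `|0⟩` falls short of `1` only by the square `α^{2(q-n)}` of the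
deviation of the exponential superposition. -/
theorem prepFlag_zero {β : ℝ} (h0 : 0 < β) (h1 : β < 1) (k ρ : ℕ) {n : ℕ} (x : Bits n) :
    ∃ c : ℝ, prepFlag β k ρ x 0 = c ∧ 1 - alpha β ^ (2 * (2 ^ ρ - n)) ≤ c ∧ c ≤ 1 := by
  rw [prepFlag]
  split_ifs
  · set p := 2 ^ ρ - gap x (wt x) with hp
    have hpos : 0 < 2 ^ ρ := by positivity
    have hov := expAmp_overlap h0 h1 (p := p) (q := 2 ^ ρ) (N := 2 ^ ρ + 2 ^ ρ) (by omega)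
        (by omega)
    refine ⟨∑ s ∈ Finset.range (2 ^ ρ + 2 ^ ρ), expAmp β (2 ^ ρ) s * expAmp β p s, ?_, ?_, hov.2⟩
    · rw [← sum_flagVal ρ fun s => expAmp β (2 ^ ρ) s * expAmp β p s, Complex.ofReal_sum]
      simp only [Matrix.mulVec, dotProduct, Matrix.conjTranspose_apply, expPrep_zero h0 h1,
        expState_eq, Complex.star_def, Complex.conj_ofReal, Complex.ofReal_mul]
    · have hg := gap_add_wt_le x (wt x)
      have : alpha β ^ (2 * p) ≤ alpha β ^ (2 * (2 ^ ρ - n)) :=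
        pow_le_pow_of_le_one (alpha_nonneg β) alpha_le_one (by omega)
      linarith [hov.1]
  · exact ⟨1, by simp, by linarith [alpha_pow_nonneg β (2 * (2 ^ ρ - n))], le_rfl⟩

/-! ### The succinct state is close to the product state -/

theorem sum_prepCoeff_sq {β : ℝ} (h0 : 0 < β) (h1 : β < 1) (k ρ n : ℕ) :
    ∑ f, ∑ x, ‖prepCoeff β k ρ n f x‖ ^ 2 = 1 := by
  rw [Finset.sum_comm, ← sum_succAmp_sq h0 h1 n (k + 1)]
  refine Finset.sum_congr rfl fun x _ => ?_
  simp only [prepCoeff]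
  split_ifs
  · simp only [norm_mul, mul_pow, Complex.norm_real, Real.norm_eq_abs, sq_abs]
    rw [← Finset.mul_sum, prepFlag_norm h0 h1, mul_one, prepAmp_eq_succAmp]
  · simp

theorem sum_erase_prepCoeff_sq_le {β : ℝ} (h0 : 0 < β) (h1 : β < 1) (k ρ n : ℕ) :
    ∑ f ∈ Finset.univ.erase 0, ∑ x, ‖prepCoeff β k ρ n f x‖ ^ 2
      ≤ 2 * alpha β ^ (2 * (2 ^ ρ - n)) := by
  set θ := alpha β ^ (2 * (2 ^ ρ - n)) with hθ
  have hθ1 : θ ≤ 1 := pow_le_one₀ (alpha_nonneg β) alpha_le_one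
  have h := sum_prepCoeff_sq h0 h1 k ρ n
  rw [← Finset.add_sum_erase _ _ (Finset.mem_univ 0)] at h
  have hlow : 1 - 2 * θ ≤ ∑ x, ‖prepCoeff β k ρ n 0 x‖ ^ 2 := by
    have hs := sum_succAmp_sq h0 h1 n (k + 1)
    calc 1 - 2 * θ = (1 - 2 * θ) *
          ∑ x : Bits n, if wt x ≤ k + 1 then succAmp β (k + 1) x ^ 2 else 0 := by rw [hs, mul_one]
      _ ≤ _ := by
        rw [Finset.mul_sum]
        refine Finset.sum_le_sum fun x _ => ?_
        obtain ⟨c, hc, hc1, hc2⟩ := prepFlag_zero h0 h1 k ρ x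
        rw [← hθ] at hc1
        simp only [prepCoeff, hc]
        split_ifs
        · rw [← Complex.ofReal_mul, Complex.norm_real, Real.norm_eq_abs, sq_abs, mul_pow,
            ← prepAmp_eq_succAmp, mul_comm]
          exact mul_le_mul_of_nonneg_left (by nlinarith) (sq_nonneg _)
        · simp
  linarith

theorem sum_prepCoeff_sub_bitAmp_le {β : ℝ} (h0 : 0 < β) (h1 : β < 1) (k ρ n : ℕ) :
    ∑ x : Bits n, ‖prepCoeff β k ρ n 0 x - (bitAmp β x : ℂ)‖ ^ 2
      ≤ (alpha β ^ (2 * (2 ^ ρ - n))) ^ 2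
        + 4 * ∑ x : Bits n, if k + 1 ≤ wt x then bitAmp β x ^ 2 else 0 := by
  set θ := alpha β ^ (2 * (2 ^ ρ - n)) with hθ
  set τ := ∑ x : Bits n, if k + 1 ≤ wt x then bitAmp β x ^ 2 else 0 with hτ
  have hfull := sum_prepAmp_full h0 h1 n k
  have hpt : ∀ x : Bits n, ‖prepCoeff β k ρ n 0 x - (bitAmp β x : ℂ)‖ ^ 2
      ≤ θ ^ 2 * bitAmp β x ^ 2 + 2 * (if wt x = k + 1 then prepAmp β k x ^ 2 else 0)
        + 2 * (if k + 1 ≤ wt x then bitAmp β x ^ 2 else 0) := by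
    intro x
    have hsq : 0 ≤ θ ^ 2 * bitAmp β x ^ 2 := by positivity
    rcases lt_trichotomy (wt x) (k + 1) with h | h | h
    · obtain ⟨c, hc, hc1, hc2⟩ := prepFlag_zero h0 h1 k ρ x
      rw [← hθ] at hc1
      rw [prepCoeff, if_pos h.le, hc, if_neg h.ne, if_neg (by omega), prepAmp_of_le β (by omega),
        ← Complex.ofReal_mul, ← Complex.ofReal_sub, Complex.norm_real, Real.norm_eq_abs, sq_abs]
      have : (bitAmp β x * c - bitAmp β x) ^ 2 = (1 - c) ^ 2 * bitAmp β x ^ 2 := by ring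
      rw [this]
      have h3 : (1 - c) ^ 2 ≤ θ ^ 2 := pow_le_pow_left₀ (by linarith) (by linarith) 2
      have := mul_le_mul_of_nonneg_right h3 (sq_nonneg (bitAmp β x))
      linarith
    · have hf : prepFlag β k ρ x 0 = 1 := by
        rw [prepFlag, if_neg (by omega)]; simp
      rw [prepCoeff, if_pos h.le, hf, if_pos h, if_pos h.ge, mul_one, ← Complex.ofReal_sub,
        Complex.norm_real, Real.norm_eq_abs, sq_abs]
      nlinarith [sq_nonneg (prepAmp β k x + bitAmp β x)]
    · rw [prepCoeff, if_neg (by omega), if_neg (by omega), if_pos h.le, zero_sub, norm_neg,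
        Complex.norm_real, Real.norm_eq_abs, sq_abs]
      nlinarith [sq_nonneg (bitAmp β x)]
  refine (Finset.sum_le_sum fun x _ => hpt x).trans (le_of_eq ?_)
  rw [Finset.sum_add_distrib, Finset.sum_add_distrib, ← Finset.mul_sum, ← Finset.mul_sum,
    ← Finset.mul_sum, hfull, sum_bitAmp_sq h0 h1, ← hτ]
  ring

/-! ### The target operation -/

section Target

variable {T : Type u} [Fintype T] [DecidableEq T] {V : ℕ → Matrix T T ℂ} {Q : Matrix T T ℂ} {n : ℕ}

theorem segment_mem_unitary (hV : ∀ j, V j ∈ Matrix.unitaryGroup T ℂ)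
    (hQ : Q ∈ Matrix.unitaryGroup T ℂ) (cap : ℕ) (x : Bits n) (j : ℕ) :
    segment V Q cap x j ∈ Matrix.unitaryGroup T ℂ := by
  induction j with
  | zero => exact hV 0
  | succ j ih =>
    rw [segment]
    refine mul_mem (mul_mem (hV _) ?_) ih
    split_ifs
    exacts [hQ, one_mem _]

theorem onesBefore_lt_wt (x : Bits n) {j : ℕ} (h : j < n) (hx : x ⟨j, h⟩ = 1) :
    onesBefore x j < wt x := by
  refine Finset.card_lt_card (Finset.ssubset_iff_of_subset ?_ |>.mpr ⟨⟨j, h⟩, ?_, ?_⟩)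
  · intro i hi
    simp only [Finset.mem_filter, Finset.mem_univ, true_and] at hi ⊢
    exact hi.2
  · simpa using hx
  · simp

theorem segment_eq_of_wt_le {cap cap' : ℕ} {x : Bits n} (h : wt x ≤ cap) (h' : wt x ≤ cap')
    (j : ℕ) :
    segment V Q cap x j = segment V Q cap' x j := by
  induction j with
  | zero => rfl
  | succ j ih =>
    have e : ((∃ h : j < n, x ⟨j, h⟩ = 1) ∧ onesBefore x j < cap)
        ↔ ((∃ h : j < n, x ⟨j, h⟩ = 1) ∧ onesBefore x j < cap') := by
      refine and_congr_right ?_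
      rintro ⟨hj, hx⟩
      have := onesBefore_lt_wt x hj hx
      omega
    rw [segment, segment, ih]
    simp only [e]

theorem targetOp_norm (hV : ∀ j, V j ∈ Matrix.unitaryGroup T ℂ)
    (hQ : Q ∈ Matrix.unitaryGroup T ℂ) {ζ : T → ℂ} (hζ : star ζ ⬝ᵥ ζ = 1) (cap : ℕ) (x : Bits n) :
    ∑ t, ‖(targetOp V Q cap x *ᵥ ζ) t‖ ^ 2 = 1 := by
  have hU := Matrix.mem_unitaryGroup_iff'.mp (segment_mem_unitary hV hQ cap x n)
  have : ((∑ t, ‖(targetOp V Q cap x *ᵥ ζ) t‖ ^ 2 : ℝ) : ℂ) = 1 := by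
    rw [← star_dotProduct_self, Matrix.star_mulVec, ← Matrix.dotProduct_mulVec,
      Matrix.mulVec_mulVec, targetOp, ← Matrix.star_eq_conjTranspose, hU, Matrix.one_mulVec, hζ]
  exact_mod_cast this

/-- The joint state after the controlled operations (phase gates included) when the control qubits
had the amplitudes `w`. -/
def ctrlVec (V : ℕ → Matrix T T ℂ) (Q : Matrix T T ℂ) (cap : ℕ) (ζ : T → ℂ) (w : Bits n → ℂ) :
    Bits n × T → ℂ :=
  fun p => Complex.I ^ wt p.1 * w p.1 * (targetOp V Q cap p.1 *ᵥ ζ) p.2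

theorem sum_ctrlVec_sq (hV : ∀ j, V j ∈ Matrix.unitaryGroup T ℂ)
    (hQ : Q ∈ Matrix.unitaryGroup T ℂ) {ζ : T → ℂ} (hζ : star ζ ⬝ᵥ ζ = 1) (cap : ℕ)
    (w : Bits n → ℂ) : ∑ p, ‖ctrlVec V Q cap ζ w p‖ ^ 2 = ∑ x, ‖w x‖ ^ 2 := by
  rw [Fintype.sum_prod_type]
  refine Finset.sum_congr rfl fun x _ => ?_
  simp only [ctrlVec, norm_mul, mul_pow, norm_pow, Complex.norm_I, one_pow, one_mul]
  rw [← Finset.mul_sum, targetOp_norm hV hQ hζ, mul_one]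

/-- Rotation of the control qubits into the basis of the final measurement. -/
def rotVec (β : ℝ) (ψ : Bits n × T → ℂ) : Bits n × T → ℂ :=
  (tpow (gateR β) n ⊗ₖ (1 : Matrix T T ℂ)) *ᵥ ψ

theorem kronecker_one_mulVec {A B : Type*} [Fintype A] [Fintype B] (K : Matrix A B ℂ)
    (ψ : B × T → ℂ) (a : A) (t : T) :
    ((K ⊗ₖ (1 : Matrix T T ℂ)) *ᵥ ψ) (a, t) = ∑ b, K a b * ψ (b, t) := by
  simp only [Matrix.mulVec, dotProduct, Fintype.sum_prod_type, Matrix.kronecker_apply,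
    Matrix.one_apply, mul_ite, mul_one, mul_zero, ite_mul, zero_mul, Finset.sum_ite_eq,
    Finset.mem_univ, if_true]

theorem rotVec_apply (β : ℝ) (ψ : Bits n × T → ℂ) (b : Bits n) (t : T) :
    rotVec β ψ (b, t) = ∑ x, tpow (gateR β) n b x * ψ (x, t) := kronecker_one_mulVec _ _ _ _

theorem rotVec_sub (β : ℝ) (ψ φ : Bits n × T → ℂ) :
    rotVec β (ψ - φ) = rotVec β ψ - rotVec β φ := Matrix.mulVec_sub _ _ _

theorem gateR_norm {β : ℝ} (h0 : 0 < β) (h1 : β < 1) (z : Fin 2 → ℂ) :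
    ∑ b, ‖∑ x, gateR β b x * z x‖ ^ 2 = ∑ x, ‖z x‖ ^ 2 := by
  have : ((∑ b, ‖(gateR β *ᵥ z) b‖ ^ 2 : ℝ) : ℂ) = ((∑ x, ‖z x‖ ^ 2 : ℝ) : ℂ) := by
    rw [← star_dotProduct_self, ← star_dotProduct_self, Matrix.star_mulVec,
      ← Matrix.dotProduct_mulVec, Matrix.mulVec_mulVec, gateR_conj, gateR_mul_self h0 h1,
      Matrix.one_mulVec]
  exact_mod_cast this

theorem sum_rotVec_sq_le {β : ℝ} (h0 : 0 < β) (h1 : β < 1) (ψ : Bits n × T → ℂ) :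
    ∑ p, ‖rotVec β ψ p‖ ^ 2 ≤ ∑ p, ‖ψ p‖ ^ 2 := by
  rw [Fintype.sum_prod_type_right, Fintype.sum_prod_type_right]
  refine Finset.sum_le_sum fun t _ => ?_
  simp only [rotVec_apply]
  have := sum_tensor_le (n := n) (fun _ => gateR β) (fun _ _ => 1) (fun _ _ => 1)
    (fun _ _ => zero_le_one) (fun _ _ => zero_le_one)
    (fun _ z => by simpa using (gateR_norm h0 h1 z).le) (fun x => ψ (x, t))
  simpa [tpow] using this

theorem I_pow_mul_bitAmp (β : ℝ) (x : Bits n) :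
    Complex.I ^ wt x * (bitAmp β x : ℂ)
      = ∏ j, if x j = 1 then Complex.I * β else (alpha β : ℂ) := by
  rw [bitAmp, Complex.ofReal_prod, ← card_filter_one, ← Finset.prod_const, Finset.prod_filter,
    ← Finset.prod_mul_distrib]
  refine Finset.prod_congr rfl fun j _ => ?_
  split_ifs <;> simp

/-- In the rotated basis, each prescribed one costs a factor `4 β²`: the amplitude `⟨1|R` of a qubit
in the state `α |0⟩ + i β |1⟩` is a sum of two terms of modulus `α β`. -/
theorem rotVec_marginal_le {β : ℝ} (h0 : 0 < β) (h1 : β < 1)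
    (hV : ∀ j, V j ∈ Matrix.unitaryGroup T ℂ)
    (hQ : Q ∈ Matrix.unitaryGroup T ℂ) {ζ : T → ℂ} (hζ : star ζ ⬝ᵥ ζ = 1) (cap : ℕ)
    (S : Finset (Fin n)) :
    (∑ b : Bits n, if ∀ j ∈ S, b j = 1 then
      ∑ t, ‖rotVec β (ctrlVec V Q cap ζ fun x => (bitAmp β x : ℂ)) (b, t)‖ ^ 2 else 0)
      ≤ (4 * β ^ 2) ^ S.card := by
  set A : Matrix (Fin 2) (Fin 2) ℂ := Matrix.of fun b x =>
    gateR β b x * if x = 1 then Complex.I * β else (alpha β : ℂ) with hA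
  set τ : Fin n → Fin 2 → ℝ := fun j b => if j ∈ S then (if b = 1 then 1 else 0) else 1 with hτ
  set μ : Fin n → Fin 2 → ℝ := fun j x => if j ∈ S then 2 * (alpha β ^ 2 * β ^ 2)
    else if x = 1 then β ^ 2 else alpha β ^ 2 with hμ
  have hτ0 : ∀ j a, 0 ≤ τ j a := fun j a => by simp only [hτ]; split_ifs <;> norm_num
  have hμ0 : ∀ j a, 0 ≤ μ j a := fun j a => by simp only [hμ]; split_ifs <;> positivity
  have hA1 : ∀ j (z : Fin 2 → ℂ),
      ∑ b, τ j b * ‖∑ x, A b x * z x‖ ^ 2 ≤ ∑ x, μ j x * ‖z x‖ ^ 2 := by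
    intro j z
    by_cases hj : j ∈ S
    · have hl : ∑ b, τ j b * ‖∑ x, A b x * z x‖ ^ 2 = ‖∑ x, A 1 x * z x‖ ^ 2 := by
        rw [Fin.sum_univ_two]; simp [hτ, hj]
      have hr : ∑ x, μ j x * ‖z x‖ ^ 2
          = (alpha β * β) ^ 2 * (2 * (‖z 0‖ ^ 2 + ‖z 1‖ ^ 2)) := by
        rw [Fin.sum_univ_two]; simp only [hμ, hj, if_true]; ring
      have e : ∑ x, A 1 x * z x = ((alpha β * β : ℝ) : ℂ) * (z 0 - Complex.I * z 1) := by
        rw [Fin.sum_univ_two]; simp [hA, gateR]; ring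
      rw [hl, hr]
      rw [e, norm_mul, mul_pow, Complex.norm_real, Real.norm_eq_abs, sq_abs]
      have h3 : ‖z 0 - Complex.I * z 1‖ ≤ ‖z 0‖ + ‖z 1‖ := by
        refine (norm_sub_le _ _).trans ?_
        rw [norm_mul, Complex.norm_I, one_mul]
      have h4 : ‖z 0 - Complex.I * z 1‖ ^ 2 ≤ 2 * (‖z 0‖ ^ 2 + ‖z 1‖ ^ 2) := by
        nlinarith [norm_nonneg (z 0 - Complex.I * z 1), sq_nonneg (‖z 0‖ - ‖z 1‖),
          norm_nonneg (z 0), norm_nonneg (z 1)]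
      exact mul_le_mul_of_nonneg_left h4 (sq_nonneg (alpha β * β))
    · have h2 := (gateR_norm h0 h1 fun x =>
        (if x = 1 then Complex.I * β else (alpha β : ℂ)) * z x).le
      simp only [hτ, hμ, hj, if_false, one_mul, hA, Matrix.of_apply, mul_assoc]
      refine h2.trans (le_of_eq ?_)
      refine Finset.sum_congr rfl fun x _ => ?_
      split_ifs <;> simp [mul_pow]
  have hpt : ∀ t, ∑ b : Bits n, (∏ j, τ j (b j)) *
      ‖rotVec β (ctrlVec V Q cap ζ fun x => (bitAmp β x : ℂ)) (b, t)‖ ^ 2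
      ≤ ∑ x : Bits n, (∏ j, μ j (x j)) * ‖(targetOp V Q cap x *ᵥ ζ) t‖ ^ 2 := by
    intro t
    refine le_trans (le_of_eq ?_)
      (sum_tensor_le (fun _ => A) τ μ hτ0 hμ0 hA1 fun x => (targetOp V Q cap x *ᵥ ζ) t)
    refine Finset.sum_congr rfl fun b _ => ?_
    rw [rotVec_apply]
    congr 3
    refine Finset.sum_congr rfl fun x _ => ?_
    simp only [ctrlVec, I_pow_mul_bitAmp, tpow, Matrix.of_apply, hA, Finset.prod_mul_distrib]
    ring
  have hlhs : (∑ b : Bits n, if ∀ j ∈ S, b j = 1 then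
      ∑ t, ‖rotVec β (ctrlVec V Q cap ζ fun x => (bitAmp β x : ℂ)) (b, t)‖ ^ 2 else 0)
      = ∑ t, ∑ b : Bits n, (∏ j, τ j (b j)) *
      ‖rotVec β (ctrlVec V Q cap ζ fun x => (bitAmp β x : ℂ)) (b, t)‖ ^ 2 := by
    rw [Finset.sum_comm]
    refine Finset.sum_congr rfl fun b _ => ?_
    rw [← Finset.mul_sum]
    split_ifs with h
    · rw [Finset.prod_eq_one, one_mul]
      intro j _
      by_cases hj : j ∈ S
      · simp [hτ, hj, h j hj]
      · simp [hτ, hj]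
    · push Not at h
      obtain ⟨j, hj, hb⟩ := h
      rw [Finset.prod_eq_zero (Finset.mem_univ j) (by simp [hτ, hj, hb]), zero_mul]
  rw [hlhs]
  refine (Finset.sum_le_sum fun t _ => hpt t).trans ?_
  rw [Finset.sum_comm]
  simp only [← Finset.mul_sum, targetOp_norm hV hQ hζ, mul_one]
  rw [sum_prod_bits]
  have hα := alpha_sq h0 h1
  have hm : ∀ j, ∑ a, μ j a = if j ∈ S then 4 * (alpha β ^ 2 * β ^ 2) else 1 := by
    intro j
    rw [Fin.sum_univ_two]
    by_cases hj : j ∈ S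
    · simp only [hμ, hj, if_true]; ring
    · simp [hμ, hj, hα]
  simp only [hm]
  rw [Finset.prod_ite_mem, Finset.univ_inter, Finset.prod_const]
  refine pow_le_pow_left₀ (by positivity) ?_ _
  rw [hα]
  nlinarith [sq_nonneg (β ^ 2), sq_nonneg β]

theorem uncState_eq (β : ℝ) (cap : ℕ) (ζ : T → ℂ) :
    uncState β n V Q cap ζ = rotVec β (ctrlVec V Q cap ζ fun x => (bitAmp β x : ℂ)) := by
  rw [uncState, rotVec]
  congr 1
  ext ⟨x, t⟩
  have h0 : ∀ y t', ((tpow (gateP * gateR β) n ⊗ₖ (1 : Matrix T T ℂ)) *ᵥ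
      fun p : Bits n × T => if p.1 = 0 then ζ p.2 else 0) (y, t')
      = Complex.I ^ wt y * (bitAmp β y : ℂ) * ζ t' := by
    intro y t'
    rw [kronecker_one_mulVec]
    simp only [mul_ite, mul_zero, Finset.sum_ite_eq', Finset.mem_univ, if_true]
    congr 1
    rw [I_pow_mul_bitAmp, tpow, Matrix.of_apply]
    refine Finset.prod_congr rfl fun j _ => ?_
    generalize y j = a
    fin_cases a <;> simp [gateP, gateR, Matrix.mul_apply, Fin.sum_univ_two]
  generalize ((tpow (gateP * gateR β) n ⊗ₖ (1 : Matrix T T ℂ)) *ᵥ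
      fun p : Bits n × T => if p.1 = 0 then ζ p.2 else 0) = φ at h0
  simp only [Matrix.mulVec, dotProduct, uncCtrl, Matrix.of_apply, Fintype.sum_prod_type, ctrlVec,
      h0]
  rw [Finset.sum_eq_single x]
  · simp only [if_true, Finset.mul_sum]
    exact Finset.sum_congr rfl fun t' _ => by ring
  · intro y _ hy
    simp [Ne.symm hy]
  · simp

theorem conjFst_proj {A B : Type*} [Fintype A] [Fintype B] (K : Matrix A B ℂ) (ψ : B × T → ℂ) :
    conjFst K (proj ψ) = proj ((K ⊗ₖ (1 : Matrix T T ℂ)) *ᵥ ψ) := by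
  rw [conjFst, proj, proj, Matrix.mul_vecMulVec, Matrix.vecMulVec_mul, Matrix.star_mulVec]

theorem compState_eq (β : ℝ) {k m ρ : ℕ} (hn : n ≤ m) (cap : ℕ) (ζ : T → ℂ) :
    compState β k m ρ n V Q cap ζ
      = ∑ f, conjFst (encMat k m n) (proj (ctrlVec V Q cap ζ (prepCoeff β k ρ n f))) := by
  rw [compState]
  refine Finset.sum_congr rfl fun f _ => ?_
  rw [conjFst_proj]
  congr 1
  ext ⟨c, t⟩
  rw [kronecker_one_mulVec]
  have hv : ∀ c', prepVec β k m ρ n (c', f) = (encMat k m n *ᵥ prepCoeff β k ρ n f) c' := fun c' =>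
    congrFun (prepVec_eq β k m ρ n f) c'
  have hx : ∀ x : Bits n, wt x ≤ k + 1 →
      (encMat k m n *ᵥ prepCoeff β k ρ n f) (enc k m x) = prepCoeff β k ρ n f x := by
    intro x hw
    simp only [Matrix.mulVec, dotProduct, encMat, Matrix.of_apply]
    rw [Finset.sum_eq_single x]
    · simp [hw]
    · intro y _ hy
      rw [if_neg, zero_mul]
      rintro ⟨hy', he⟩
      exact hy (enc_inj hn hy' hw he)
    · simp
  generalize encMat k m n *ᵥ prepCoeff β k ρ n f = φ at hv hx
  simp only [Matrix.mulVec, dotProduct, compCtrl, Matrix.of_apply, Fintype.sum_prod_type, hv]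
  have e : ∀ c' : Reg k m, (∑ t', (∑ x : Bits n,
      if wt x ≤ k + 1 ∧ enc k m x = c ∧ enc k m x = c' then
        Complex.I ^ wt x * targetOp V Q cap x t t' else 0) * (φ c' * ζ t'))
      = ∑ x : Bits n, if enc k m x = c' then encMat k m n c x * (Complex.I ^ wt x * φ c' *
        ∑ t', targetOp V Q cap x t t' * ζ t') else 0 := by
    intro c'
    simp only [Finset.sum_mul]
    rw [Finset.sum_comm]
    refine Finset.sum_congr rfl fun x _ => ?_
    simp only [encMat, Matrix.of_apply]
    by_cases h3 : enc k m x = c'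
    · simp only [h3, and_true, if_true, ite_mul, one_mul, zero_mul, Finset.mul_sum,
        Finset.sum_ite_irrel, Finset.sum_const_zero]
      refine if_congr Iff.rfl (Finset.sum_congr rfl fun t' _ => ?_) rfl
      ring
    · simp [h3]
  rw [Finset.sum_congr rfl fun c' _ => e c', Finset.sum_comm]
  refine Finset.sum_congr rfl fun x _ => ?_
  rw [Finset.sum_ite_eq, if_pos (Finset.mem_univ _)]
  by_cases hw : wt x ≤ k + 1
  · rw [hx x hw]; rfl
  · simp [encMat, hw]

end Target

/-! ### Comparison of the two schemes -/

section Compare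

variable {T : Type u} [Fintype T] [DecidableEq T] {V : ℕ → Matrix T T ℂ} {Q : Matrix T T ℂ}

/-- The effects of the recursive measurement of uncompressed qubits, in the rotated basis, whose
elementary measurements use the succinct states. -/
def rotEffect (β : ℝ) (k ρ r j : ℕ) (b : Bits (2 ^ r)) : Matrix (Bits (2 ^ r)) (Bits (2 ^ r)) ℂ :=
  treeEffect (A := fun r => Bits (2 ^ r)) (fun r => krausOf 0 (rotCoeff β k ρ (2 ^ r)))
    bitSplit r j b

theorem compOut_eq {β : ℝ} (h0 : 0 < β) (h1 : β < 1) (k k' ρ r : ℕ) (ζ : T → ℂ)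
    (b : Bits (2 ^ r)) :
    compOut β k k' ρ r V Q ζ b = effectOut (rotEffect β k ρ r k' b)
      (∑ f, proj (rotVec β (ctrlVec V Q k' ζ (prepCoeff β k ρ (2 ^ r) f)))) := by
  have hR := tpow_gateR_mul_self h0 h1 (2 ^ r)
  have hRc := tpow_gateR_conj β (2 ^ r)
  rw [compOut, measure_eq_effectOut, compState_eq β le_rfl, effectOut_sum_right,
      effectOut_sum_right]
  refine Finset.sum_congr rfl fun f _ => ?_
  set ψ := ctrlVec V Q k' ζ (prepCoeff β k ρ (2 ^ r) f) with hψ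
  have hcap : (capProj k (2 ^ r) ⊗ₖ (1 : Matrix T T ℂ)) *ᵥ ψ = ψ := by
    ext ⟨x, t⟩
    rw [kronecker_one_mulVec]
    simp only [capProj, Matrix.diagonal_apply, ite_mul, zero_mul, Finset.sum_ite_eq,
      Finset.mem_univ, if_true, one_mul]
    split_ifs with hx
    · rfl
    · simp [hψ, ctrlVec, prepCoeff, hx]
  have e1 : conjFst (encMat k (2 ^ r) (2 ^ r)) (proj ψ)
      = conjFst (encMat k (2 ^ r) (2 ^ r) * tpow (gateR β) (2 ^ r)) (proj (rotVec β ψ)) := by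
    rw [conjFst_proj, conjFst_proj, rotVec, Matrix.mulVec_mulVec, ← Matrix.mul_kronecker_mul,
      Matrix.mul_assoc, hR, Matrix.mul_one, Matrix.mul_one]
  have e2 : conjFst (tpow (gateR β) (2 ^ r) * capProj k (2 ^ r) * tpow (gateR β) (2 ^ r))
      (proj (rotVec β ψ)) = proj (rotVec β ψ) := by
    rw [conjFst_proj, rotVec, Matrix.mulVec_mulVec, ← Matrix.mul_kronecker_mul, Matrix.mul_assoc,
      hR, Matrix.mul_one, Matrix.mul_kronecker_mul, ← Matrix.mulVec_mulVec, hcap]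
  have e3 : (tpow (gateR β) (2 ^ r) * capProj k (2 ^ r) * tpow (gateR β) (2 ^ r))ᴴ
      = tpow (gateR β) (2 ^ r) * capProj k (2 ^ r) * tpow (gateR β) (2 ^ r) := by
    rw [Matrix.conjTranspose_mul, Matrix.conjTranspose_mul, hRc, capProj_conj, Matrix.mul_assoc]
  rw [e1, effectOut_conjFst, regEffect_pullback h0 h1]
  conv_rhs => rw [← e2, effectOut_conjFst, e3]
  rfl

theorem sum_tpow_gateR_sq {β : ℝ} (h0 : 0 < β) (h1 : β < 1) {n : ℕ} (z : Bits n → ℂ) :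
    ∑ x, ‖(tpow (gateR β) n *ᵥ z) x‖ ^ 2 = ∑ x, ‖z x‖ ^ 2 := by
  have : ((∑ x, ‖(tpow (gateR β) n *ᵥ z) x‖ ^ 2 : ℝ) : ℂ) = ((∑ x, ‖z x‖ ^ 2 : ℝ) : ℂ) := by
    rw [← star_dotProduct_self, ← star_dotProduct_self, Matrix.star_mulVec,
      ← Matrix.dotProduct_mulVec, Matrix.mulVec_mulVec, tpow_gateR_conj,
      tpow_gateR_mul_self h0 h1, Matrix.one_mulVec]
  exact_mod_cast this

theorem tpow_gateR_bitAmp {β : ℝ} (h0 : 0 < β) (h1 : β < 1) (n : ℕ) :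
    tpow (gateR β) n *ᵥ (fun x => (bitAmp β x : ℂ)) = zeroState n := by
  have hb : (fun x : Bits n => (bitAmp β x : ℂ)) = fun x => tpow (gateR β) n x 0 := by
    ext x
    rw [bitAmp, Complex.ofReal_prod, tpow, Matrix.of_apply]
    refine Finset.prod_congr rfl fun j _ => ?_
    generalize x j = a
    fin_cases a <;> simp [gateR]
  ext x
  rw [hb]
  change (tpow (gateR β) n * tpow (gateR β) n) x 0 = _
  rw [tpow_gateR_mul_self h0 h1, Matrix.one_apply, zeroState]

theorem trace_effectOut_diagonal {A : Type*} [Fintype A] [DecidableEq A] (ω : A → ℝ)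
    (φ : A × T → ℂ) :
    (effectOut (Matrix.diagonal fun a => (ω a : ℂ)) (proj φ)).trace.re
      = ∑ a, ω a * ∑ t, ‖φ (a, t)‖ ^ 2 := by
  have : (effectOut (Matrix.diagonal fun a => (ω a : ℂ)) (proj φ)).trace
      = ((∑ a, ω a * ∑ t, ‖φ (a, t)‖ ^ 2 : ℝ) : ℂ) := by
    simp only [Matrix.trace, Matrix.diag, effectOut_apply, Matrix.diagonal_apply, ite_mul, zero_mul,
      Finset.sum_ite_eq, Finset.mem_univ, if_true, proj, Matrix.vecMulVec_apply, Pi.star_apply,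
      Complex.star_def, Complex.mul_conj']
    rw [Finset.sum_comm]
    push_cast
    simp only [Finset.mul_sum]
  rw [this, Complex.ofReal_re]

theorem effectsClose_locate (r j : ℕ) :
    EffectsClose (fun b : Bits (2 ^ r) => Matrix.diagonal fun x => if x = b then (1 : ℂ) else 0)
      (locateEffect r j)
      (Matrix.diagonal fun x => ((if j + 1 ≤ wt x then 2 else 0 : ℝ) : ℂ)) := by
  refine ⟨fun b => Matrix.diagonal fun x => if j + 1 ≤ wt x ∧ x = b then (1 : ℂ) else 0,
    fun b => Matrix.diagonal fun x => if j + 1 ≤ wt x ∧ locate r j x = b then (1 : ℂ) else 0,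
    fun b => (Matrix.PosSemidef.diagonal fun x => ?_).nonneg,
    fun b => (Matrix.PosSemidef.diagonal fun x => ?_).nonneg, fun b => ?_, le_of_eq ?_⟩
  · dsimp only; split_ifs <;> simp
  · dsimp only; split_ifs <;> simp
  · rw [locateEffect, Matrix.diagonal_sub, Matrix.diagonal_sub]
    congr 1; ext x
    by_cases h : j + 1 ≤ wt x
    · simp only [h, true_and]
    · simp only [h, false_and, if_false,
        locate_of_wt_le (Nat.lt_succ_iff.mp (not_le.mp h)), sub_self]
  · ext x y
    simp only [Matrix.diagonal_add, Matrix.sum_apply, Matrix.diagonal_apply]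
    by_cases hxy : x = y
    · subst hxy
      by_cases h : j + 1 ≤ wt x
      · simp only [h, true_and, if_true, Finset.sum_add_distrib, Finset.sum_ite_eq,
          Finset.mem_univ]
        norm_num
      · simp [h]
    · simp [hxy]

/-- The error bound in terms of the weights that the cutoffs neglect: `δ' ^ 2` and `π'` bound the
weights of more than `k'` ones before and after the final rotation, `θ` is the error of the
clean-up, and `δ` bounds the distance of the succinct states from the product states. -/
theorem Dav_le {β : ℝ} (h0 : 0 < β) (h1 : β < 1) (k k' cap ρ r : ℕ) {ζ : T → ℂ}
    (hV : ∀ j, V j ∈ Matrix.unitaryGroup T ℂ) (hQ : Q ∈ Matrix.unitaryGroup T ℂ)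
    (hζ : star ζ ⬝ᵥ ζ = 1) (hcap : k' ≤ cap) {δ δ' θ π' : ℝ} (hδ : 0 < δ) (hδ' : 0 < δ')
    (hθ : alpha β ^ (2 * (2 ^ ρ - 2 ^ r)) ≤ θ)
    (hu : ∀ s ≤ r, ∑ x : Bits (2 ^ s),
      ‖prepCoeff β k ρ (2 ^ s) 0 x - (bitAmp β x : ℂ)‖ ^ 2 ≤ δ ^ 2)
    (hτ : 4 * (∑ x : Bits (2 ^ r), if k' + 1 ≤ wt x then bitAmp β x ^ 2 else 0) ≤ δ' ^ 2)
    (hπ : (((2 ^ r : ℕ) : ℝ) * (4 * β ^ 2)) ^ (k' + 1) / (k' + 1).factorial ≤ π') :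
    Dav β k k' cap ρ r V Q ζ ≤ (6 * δ' + δ' ^ 2) + 2 * π'
      + (24 * δ + 8 * δ ^ 2 + 2 * (2 * θ)) * (1 + 2 * r * (((2 ^ r : ℕ) : ℝ) * (4 * β ^ 2)))
      + (6 * δ + δ ^ 2 + 2 * θ) := by
  set amp : Bits (2 ^ r) → ℂ := fun x => (bitAmp β x : ℂ) with hamp
  set Φ := rotVec β (ctrlVec V Q k' ζ amp) with hΦ
  set Φc := rotVec β (ctrlVec V Q cap ζ amp) with hΦc
  set Φf : Flag ρ → Bits (2 ^ r) × T → ℂ := fun f =>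
    rotVec β (ctrlVec V Q k' ζ (prepCoeff β k ρ (2 ^ r) f)) with hΦf
  set E : Bits (2 ^ r) → Matrix (Bits (2 ^ r)) (Bits (2 ^ r)) ℂ := fun b =>
    Matrix.diagonal fun x => if x = b then (1 : ℂ) else 0 with hE
  have hE0 : ∀ b, 0 ≤ E b := fun b => by
    refine (Matrix.PosSemidef.diagonal fun x => ?_).nonneg
    dsimp only; split_ifs <;> simp
  have hE1 : ∑ b, E b = 1 := by
    ext x y
    simp only [hE, Matrix.sum_apply, Matrix.diagonal_apply, Matrix.one_apply]
    split_ifs <;> simp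
  have hampn : ∑ x, ‖amp x‖ ^ 2 = 1 := by
    simp only [hamp, Complex.norm_real, Real.norm_eq_abs, sq_abs]; exact sum_bitAmp_sq h0 h1 _
  have hΦn : ∑ p, ‖Φ p‖ ^ 2 ≤ 1 :=
    (sum_rotVec_sq_le h0 h1 _).trans (by rw [sum_ctrlVec_sq hV hQ hζ, hampn])
  set p : Bits (2 ^ r) → ℝ := fun b => ∑ t, ‖Φ (b, t)‖ ^ 2 with hp
  have hp0 : ∀ b, 0 ≤ p b := fun b => Finset.sum_nonneg fun t _ => by positivity
  have hmarg : ∀ S : Finset (Fin (2 ^ r)),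
      (∑ x, if ∀ j ∈ S, x j = 1 then p x else 0) ≤ (4 * β ^ 2) ^ S.card :=
    fun S => rotVec_marginal_le h0 h1 hV hQ hζ k' S
  have hp1 : ∑ b, p b ≤ 1 :=
    (Fintype.sum_prod_type (fun q => ‖Φ q‖ ^ 2)).symm.le.trans hΦn
  have htail := (tail_le hp0 (by positivity) hmarg (k' + 1)).trans hπ
  have hmean := mean_wt_le hmarg
  have hθ0 : 0 ≤ θ := (alpha_pow_nonneg _ _).trans hθ
  -- the cap on the number of queries
  have c1 : OutputsClose (fun b => effectOut (E b) (proj Φc)) (fun b => effectOut (E b) (proj Φ))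
      (6 * δ' + δ' ^ 2) := by
    have hd : ∑ q, ‖Φc q - Φ q‖ ^ 2 ≤ δ' ^ 2 := by
      have e : ∀ q, Φc q - Φ q
          = rotVec β (ctrlVec V Q cap ζ amp - ctrlVec V Q k' ζ amp) q := by
        intro q; rw [rotVec_sub]; rfl
      simp only [e]
      refine ((sum_rotVec_sq_le h0 h1 _).trans ?_).trans hτ
      rw [Fintype.sum_prod_type, Finset.mul_sum]
      refine Finset.sum_le_sum fun x _ => ?_
      by_cases hx : k' + 1 ≤ wt x
      · rw [if_pos hx]
        have hn1 := targetOp_norm hV hQ hζ cap x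
        have hn2 := targetOp_norm hV hQ hζ k' x
        calc _ ≤ ∑ t, (2 * bitAmp β x ^ 2 * ‖(targetOp V Q cap x *ᵥ ζ) t‖ ^ 2
              + 2 * bitAmp β x ^ 2 * ‖(targetOp V Q k' x *ᵥ ζ) t‖ ^ 2) := by
              refine Finset.sum_le_sum fun t _ => ?_
              set a := (targetOp V Q cap x *ᵥ ζ) t
              set c := (targetOp V Q k' x *ᵥ ζ) t
              have e2 : (ctrlVec V Q cap ζ amp - ctrlVec V Q k' ζ amp) (x, t)
                  = Complex.I ^ wt x * (bitAmp β x : ℂ) * (a - c) := by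
                simp only [Pi.sub_apply, ctrlVec, hamp]; ring
              rw [e2]
              simp only [norm_mul, norm_pow, Complex.norm_I, one_pow, one_mul, mul_pow,
                Complex.norm_real, Real.norm_eq_abs, sq_abs]
              have h3 : ‖a - c‖ ≤ ‖a‖ + ‖c‖ := norm_sub_le _ _
              have h4 : ‖a - c‖ ^ 2 ≤ 2 * ‖a‖ ^ 2 + 2 * ‖c‖ ^ 2 := by
                nlinarith [norm_nonneg (a - c), sq_nonneg (‖a‖ - ‖c‖), norm_nonneg a,
                  norm_nonneg c]
              have := mul_le_mul_of_nonneg_left h4 (sq_nonneg (bitAmp β x))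
              linarith
          _ = 4 * bitAmp β x ^ 2 := by
              rw [Finset.sum_add_distrib, ← Finset.mul_sum, ← Finset.mul_sum, hn1, hn2]; ring
      · rw [if_neg hx, mul_zero]
        refine le_of_eq (Finset.sum_eq_zero fun t _ => ?_)
        have : targetOp V Q cap x = targetOp V Q k' x :=
          segment_eq_of_wt_le (by omega) (by omega) _
        simp [ctrlVec, this]
    obtain ⟨P, N, hP, hN, he, ht⟩ := exists_proj_sub_proj_eq Φc Φ hδ' hΦn hd
    obtain ⟨P', N', a1, a2, a3, a4⟩ := OutputsClose.of_state hE0 hE1 hP hN he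
    exact ⟨P', N', a1, a2, a3, a4.trans ht⟩
  -- the stop after `k'` located ones
  have c2 : OutputsClose (fun b => effectOut (E b) (proj Φ))
      (fun b => effectOut (locateEffect r k' b) (proj Φ)) (2 * π') := by
    obtain ⟨P', N', a1, a2, a3, a4⟩ :=
      (effectsClose_locate r k').outputsClose (proj_nonneg Φ).nonneg
    refine ⟨P', N', a1, a2, a3, a4.trans ?_⟩
    rw [trace_effectOut_diagonal]
    refine le_trans (le_of_eq ?_) (mul_le_mul_of_nonneg_left htail (by norm_num : (0 : ℝ) ≤ 2))
    rw [Finset.mul_sum]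
    refine Finset.sum_congr rfl fun b _ => ?_
    split_ifs <;> simp [hp]
  -- the imperfect elementary measurements
  have hηr : ∀ s ≤ r, ∑ f ∈ Finset.univ.erase 0, ∑ x, ‖prepCoeff β k ρ (2 ^ s) f x‖ ^ 2
      ≤ 2 * θ := by
    intro s hs
    refine (sum_erase_prepCoeff_sq_le h0 h1 k ρ (2 ^ s)).trans ?_
    have : 2 ^ s ≤ 2 ^ r := Nat.pow_le_pow_right (by norm_num) hs
    have := pow_le_pow_of_le_one (alpha_nonneg β) (alpha_le_one (β := β))
      (show 2 * (2 ^ ρ - 2 ^ r) ≤ 2 * (2 ^ ρ - 2 ^ s) by omega)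
    linarith
  have hrot1 : ∀ s, ∑ f, ∑ x, ‖rotCoeff β k ρ (2 ^ s) f x‖ ^ 2 = 1 := by
    intro s
    simp only [rotCoeff, sum_tpow_gateR_sq h0 h1]
    exact sum_prepCoeff_sq h0 h1 k ρ _
  have hT := effectsClose_treeEffect (o := (0 : Flag ρ)) (v := fun s => rotCoeff β k ρ (2 ^ s))
    hδ (η := 2 * θ) (by linarith) hrot1 (s := r)
    (fun s hs => by
      rw [← tpow_gateR_bitAmp h0 h1]
      simp only [rotCoeff, ← Pi.sub_apply, ← Matrix.mulVec_sub]
      rw [sum_tpow_gateR_sq h0 h1]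
      exact hu s hs)
    (fun s hs => by
      simp only [rotCoeff, sum_tpow_gateR_sq h0 h1]
      exact hηr s hs) r k' le_rfl
  have hκ : 0 ≤ 24 * δ + 8 * δ ^ 2 + 2 * (2 * θ) := by positivity
  have c3 : OutputsClose (fun b => effectOut (rotEffect β k ρ r k' b) (proj Φ))
      (fun b => effectOut (locateEffect r k' b) (proj Φ))
      ((24 * δ + 8 * δ ^ 2 + 2 * (2 * θ)) * (1 + 2 * r * (((2 ^ r : ℕ) : ℝ) * (4 * β ^ 2)))) := by
    obtain ⟨P', N', a1, a2, a3, a4⟩ := hT.outputsClose (proj_nonneg Φ).nonneg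
    refine ⟨P', N', a1, a2, a3, a4.trans ?_⟩
    rw [errOp, trace_effectOut_diagonal]
    calc _ = (24 * δ + 8 * δ ^ 2 + 2 * (2 * θ)) * (∑ b, p b + 2 * r * ∑ b, wt b * p b) := by
          rw [Finset.mul_sum (f := fun b => (wt b : ℝ) * p b), ← Finset.sum_add_distrib,
            Finset.mul_sum]
          refine Finset.sum_congr rfl fun b _ => ?_
          simp only [hp]; ring
      _ ≤ _ := by
          refine mul_le_mul_of_nonneg_left (add_le_add hp1 ?_) hκ
          exact mul_le_mul_of_nonneg_left hmean (by positivity)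
  -- the imperfect preparation
  have hF0 : ∀ b, 0 ≤ rotEffect β k ρ r k' b := fun b => treeEffect_nonneg _ _ _
  have hF1 : ∑ b, rotEffect β k ρ r k' b = 1 :=
    sum_treeEffect (fun s => sum_krausOf (hrot1 s)) bitSplit_isometry r k'
  have c4 : OutputsClose (fun b => effectOut (rotEffect β k ρ r k' b) (∑ f, proj (Φf f)))
      (fun b => effectOut (rotEffect β k ρ r k' b) (proj Φ)) (6 * δ + δ ^ 2 + 2 * θ) := by
    have hd : ∑ q, ‖Φf 0 q - Φ q‖ ^ 2 ≤ δ ^ 2 := by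
      have e : ∀ q, Φf 0 q - Φ q
          = rotVec β (ctrlVec V Q k' ζ (prepCoeff β k ρ (2 ^ r) 0 - amp)) q := by
        intro q
        have : ctrlVec V Q k' ζ (prepCoeff β k ρ (2 ^ r) 0 - amp)
            = ctrlVec V Q k' ζ (prepCoeff β k ρ (2 ^ r) 0) - ctrlVec V Q k' ζ amp := by
          ext q; simp only [ctrlVec, Pi.sub_apply]; ring
        rw [this, rotVec_sub]; rfl
      simp only [e]
      refine (sum_rotVec_sq_le h0 h1 _).trans ?_
      rw [sum_ctrlVec_sq hV hQ hζ]
      exact hu r le_rfl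
    obtain ⟨P, N, hP, hN, he, ht⟩ := exists_proj_sub_proj_eq (Φf 0) Φ hδ hΦn hd
    set R := ∑ f ∈ Finset.univ.erase 0, proj (Φf f) with hR
    have hR0 : 0 ≤ R := Finset.sum_nonneg fun f _ => (proj_nonneg _).nonneg
    have hRt : R.trace.re ≤ 2 * θ := by
      refine le_trans ?_ (hηr r le_rfl)
      rw [hR, Matrix.trace_sum, Complex.re_sum]
      refine Finset.sum_le_sum fun f _ => ?_
      rw [trace_proj, Complex.ofReal_re, ← sum_ctrlVec_sq hV hQ hζ k']
      exact sum_rotVec_sq_le h0 h1 _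
    have he' : ∑ f, proj (Φf f) - proj Φ = (P + R) - N := by
      rw [← Finset.add_sum_erase _ _ (Finset.mem_univ (0 : Flag ρ)), add_sub_right_comm, he, hR]
      abel
    obtain ⟨P', N', a1, a2, a3, a4⟩ := OutputsClose.of_state hF0 hF1 (add_nonneg hP hR0) hN he'
    refine ⟨P', N', a1, a2, a3, a4.trans ?_⟩
    rw [Matrix.trace_add]
    simp only [Complex.add_re] at ht ⊢
    linarith
  have hall := ((c1.trans c2).trans c3.symm).trans c4.symm
  refine le_trans (le_of_eq ?_) hall.sum_traceNorm_le
  rw [Dav]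
  refine Finset.sum_congr rfl fun b _ => ?_
  congr 2
  · rw [uncOut, uncState_eq]
    ext t t'
    simp [effectOut_apply, hE, Matrix.diagonal_apply, proj, Matrix.vecMulVec_apply, hΦc, hamp]
  · exact compOut_eq h0 h1 k k' ρ r ζ b

end Compare

/-! ### The cutoffs -/

/-- With the constant `8` in the cutoff, the Poisson-like tails are `O(ε²)`. -/
theorem pow_div_factorial_le_of_cutoff (A : ℝ) {ε : ℝ} (hε : 0 < ε) (hε1 : ε < 1 / 2) {k : ℕ}
    (hk : 8 * cutoff ε ≤ k) :
    A ^ (k + 1) / (k + 1).factorial ≤ Real.exp (Real.exp 1 * A ^ 2 / 2) * ε ^ 2 := by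
  set N := k + 1 with hN
  have hl2 : 0 < Real.log 2 := Real.log_pos (by norm_num)
  set L := Real.logb 2 (1 / ε) with hL
  have hL1 : 1 < L := by
    rw [hL, Real.lt_logb_iff_rpow_lt (by norm_num) (by positivity), Real.rpow_one,
      lt_div_iff₀ hε]
    linarith
  set l := Real.logb 2 L with hl
  have hl0 : 0 < l := Real.logb_pos (by norm_num) hL1
  have hlL : l * Real.log 2 = Real.log L := by rw [hl, Real.logb]; field_simp
  have hLε : L * Real.log 2 = -Real.log ε := by
    rw [hL, Real.logb, one_div, Real.log_inv]; field_simp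
  have hNc : 8 * (L / l) ≤ (N : ℝ) := by
    have : 8 * (L / l) ≤ (k : ℝ) := hk
    rw [hN]; push_cast; linarith
  have hy : 0 < 8 * (L / l) := by positivity
  have hNpos : (0 : ℝ) < N := hy.trans_le hNc
  have hlog8 : Real.log 8 = 3 * Real.log 2 := by
    rw [show (8 : ℝ) = 2 ^ 3 by norm_num, Real.log_pow]; norm_num
  -- `log l` is dominated by `l`, so `log N` is at least half of `log L`
  have hlogl : Real.log l ≤ l / 4 - 1 + 2 * Real.log 2 := by
    have h4 : Real.log 4 = 2 * Real.log 2 := by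
      rw [show (4 : ℝ) = 2 ^ 2 by norm_num, Real.log_pow]; norm_num
    have := Real.log_le_sub_one_of_pos (show 0 < l / 4 by positivity)
    rw [Real.log_div hl0.ne' (by norm_num), h4] at this
    linarith
  have hlogN : l * Real.log 2 / 2 ≤ Real.log N := by
    have h5 : Real.log (8 * (L / l)) ≤ Real.log N := Real.log_le_log hy hNc
    rw [Real.log_mul (by norm_num) (by positivity), Real.log_div (by positivity) hl0.ne', hlog8,
      ← hlL] at h5
    have := Real.log_two_gt_d9
    nlinarith
  have hNN : -4 * Real.log ε ≤ N * Real.log N := by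
    have h6 : 8 * (L / l) * (l * Real.log 2 / 2) ≤ N * Real.log N :=
      mul_le_mul hNc hlogN (by positivity) hNpos.le
    have h7 : 8 * (L / l) * (l * Real.log 2 / 2) = 4 * (L * Real.log 2) := by field_simp; ring
    rw [h7, hLε] at h6
    linarith
  have hpow : 1 ≤ ε ^ 4 * (N : ℝ) ^ N := by
    rw [← Real.log_nonneg_iff (by positivity), Real.log_mul (by positivity) (by positivity),
      Real.log_pow, Real.log_pow]
    push_cast
    linarith
  have hf : (0 : ℝ) < N.factorial := by exact_mod_cast N.factorial_pos
  have hNf : (N : ℝ) ^ N / N.factorial ≤ Real.exp 1 ^ N := by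
    rw [← Real.exp_nat_mul, mul_one]
    exact Real.pow_div_factorial_le_exp N (by positivity) N
  have hAf : (Real.exp 1 * A ^ 2) ^ N / N.factorial ≤ Real.exp (Real.exp 1 * A ^ 2) :=
    Real.pow_div_factorial_le_exp _ (by positivity) N
  refine le_of_sq_le_sq ?_ (by positivity)
  have hsq : (A ^ N / N.factorial) ^ 2 * (N : ℝ) ^ N
      = (A ^ 2) ^ N / N.factorial * ((N : ℝ) ^ N / N.factorial) := by
    rw [div_pow, ← pow_mul, ← pow_mul, mul_comm 2 N]; field_simp
  have hexp : Real.exp (Real.exp 1 * A ^ 2) = Real.exp (Real.exp 1 * A ^ 2 / 2) ^ 2 := by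
    rw [← Real.exp_nat_mul]; congr 1; push_cast; ring
  calc (A ^ N / N.factorial) ^ 2 ≤ (A ^ N / N.factorial) ^ 2 * (ε ^ 4 * (N : ℝ) ^ N) :=
        le_mul_of_one_le_right (sq_nonneg _) hpow
    _ = ε ^ 4 * ((A ^ 2) ^ N / N.factorial * ((N : ℝ) ^ N / N.factorial)) := by rw [← hsq]; ring
    _ ≤ ε ^ 4 * ((A ^ 2) ^ N / N.factorial * Real.exp 1 ^ N) := by gcongr
    _ = ε ^ 4 * ((Real.exp 1 * A ^ 2) ^ N / N.factorial) := by rw [mul_pow]; ring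
    _ ≤ ε ^ 4 * Real.exp (Real.exp 1 * A ^ 2) := by gcongr
    _ = _ := by rw [hexp]; ring

/-- The choice of `q` makes the deviation of the exponential superposition at most `ε`. -/
theorem alpha_pow_le {β ε : ℝ} (h0 : 0 < β) (h1 : β < 1) (hε : 0 < ε) (hε1 : ε < 1 / 2) {r ρ : ℕ}
    (hq : (2 : ℝ) ^ r + 1 / β ^ 2 * Real.logb 2 (1 / ε) ≤ (2 : ℝ) ^ ρ) :
    alpha β ^ (2 * (2 ^ ρ - 2 ^ r)) ≤ ε := by
  have hlog : 0 < -Real.log ε := by linarith [Real.log_neg hε (by linarith)]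
  have hl2 : 0 < Real.log 2 := Real.log_pos (by norm_num)
  have hl2' : Real.log 2 < 1 := by linarith [Real.log_two_lt_d9]
  have hL : -Real.log ε ≤ Real.logb 2 (1 / ε) := by
    rw [Real.logb, one_div, Real.log_inv, le_div_iff₀ hl2]
    nlinarith
  have hL0 : 0 ≤ 1 / β ^ 2 * Real.logb 2 (1 / ε) := mul_nonneg (by positivity) (by linarith)
  have hle : 2 ^ r ≤ 2 ^ ρ := by
    have : (2 : ℝ) ^ r ≤ (2 : ℝ) ^ ρ := by linarith
    exact_mod_cast this
  set d := 2 ^ ρ - 2 ^ r with hd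
  have hdc : (d : ℝ) = (2 : ℝ) ^ ρ - (2 : ℝ) ^ r := by rw [hd, Nat.cast_sub hle]; push_cast; ring
  have hβd : -Real.log ε ≤ β ^ 2 * d := by
    have : β ^ 2 * (1 / β ^ 2 * Real.logb 2 (1 / ε)) ≤ β ^ 2 * d :=
      mul_le_mul_of_nonneg_left (by rw [hdc]; linarith) (by positivity)
    have e : β ^ 2 * (1 / β ^ 2 * Real.logb 2 (1 / ε)) = Real.logb 2 (1 / ε) := by field_simp
    linarith
  rw [pow_mul, alpha_sq h0 h1]
  calc (1 - β ^ 2) ^ d ≤ Real.exp (-β ^ 2) ^ d := by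
        refine pow_le_pow_left₀ (by nlinarith) ?_ d
        linarith [Real.add_one_le_exp (-β ^ 2)]
    _ = Real.exp (-(β ^ 2 * d)) := by rw [← Real.exp_nat_mul]; congr 1; ring
    _ ≤ Real.exp (Real.log ε) := Real.exp_le_exp.mpr (by linarith)
    _ = ε := Real.exp_log hε

theorem sum_prepCoeff_sub_bitAmp_le_of_tail {β : ℝ} (h0 : 0 < β) (h1 : β < 1) (k ρ s r : ℕ)
    (hs : s ≤ r) {ε A : ℝ} (hA : β ^ 2 * (2 : ℝ) ^ r ≤ A) {t : ℝ}
    (ht : A ^ (k + 1) / (k + 1).factorial ≤ t)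
    (hθ : alpha β ^ (2 * (2 ^ ρ - 2 ^ r)) ≤ ε) :
    ∑ x : Bits (2 ^ s), ‖prepCoeff β k ρ (2 ^ s) 0 x - (bitAmp β x : ℂ)‖ ^ 2 ≤ ε ^ 2 + 4 * t := by
  refine (sum_prepCoeff_sub_bitAmp_le h0 h1 k ρ (2 ^ s)).trans ?_
  have hle : 2 ^ s ≤ 2 ^ r := Nat.pow_le_pow_right (by norm_num) hs
  have hle' : (2 : ℝ) ^ s ≤ 2 ^ r := by exact_mod_cast hle
  have h3 : alpha β ^ (2 * (2 ^ ρ - 2 ^ s)) ≤ ε :=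
    (pow_le_pow_of_le_one (alpha_nonneg β) (alpha_le_one (β := β)) (by omega)).trans hθ
  have h4 := tail_le (n := 2 ^ s) (p := fun x => bitAmp β x ^ 2) (fun x => sq_nonneg _)
      (sq_nonneg β)
    (fun S => (bitAmp_sq_marginal h0 h1 S).le) (k + 1)
  have h5 : (((2 ^ s : ℕ) : ℝ) * β ^ 2) ^ (k + 1) / (k + 1).factorial ≤ t := by
    refine le_trans ?_ ht
    gcongr
    push_cast
    nlinarith [sq_nonneg β]
  have h6 := pow_le_pow_left₀ (alpha_pow_nonneg β _) h3 2
  linarith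

end CompressedQuery

end

theorem theorem5 :
    ∃ a : ℝ, 0 < a ∧ ∀ B c : ℝ, ∃ C : ℝ,
      ∀ (r k k' cap ρ : ℕ) (β ε ε' : ℝ)
        (T : Type) [Fintype T] [DecidableEq T]
        (V : ℕ → Matrix T T ℂ) (Q : Matrix T T ℂ) (ζ : T → ℂ),
        1 ≤ r →
        0 < β → β < 1 → β ^ 2 * (2 : ℝ) ^ r ≤ B →
        0 < ε → ε < 1 / 2 → 0 < ε' → ε' < 1 / 2 →
        a * CompressedQuery.cutoff ε ≤ (k : ℝ) →
        a * CompressedQuery.cutoff ε' ≤ (k' : ℝ) →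
        k' ≤ cap →
        (2 : ℝ) ^ r + 1 / β ^ 2 * Real.logb 2 (1 / ε) ≤ (2 : ℝ) ^ ρ →
        ε * ((k' : ℝ) * Real.logb 2 ((2 : ℝ) ^ r)) ≤ c →
        (∀ j, V j ∈ Matrix.unitaryGroup T ℂ) → Q ∈ Matrix.unitaryGroup T ℂ →
        star ζ ⬝ᵥ ζ = 1 →
        CompressedQuery.Dav β k k' cap ρ r V Q ζ
          ≤ C * (ε' + ε * Real.logb 2 ((2 : ℝ) ^ r)) := by
  open CompressedQuery in
  refine ⟨8, by norm_num, fun B c => ?_⟩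
  set A : ℝ := 4 * |B| with hA
  have hA0 : 0 ≤ A := by positivity
  set t : ℝ := Real.exp (Real.exp 1 * A ^ 2 / 2) with ht
  have ht0 : 0 < t := Real.exp_pos _
  set s : ℝ := 1 + 4 * t with hs
  refine ⟨(6 * s + s ^ 2 + 2 * t)
    + ((24 * s + 8 * s ^ 2 + 4) * (1 + 2 * A) + (6 * s + s ^ 2 + 2)), ?_⟩
  intro r k k' cap ρ β ε ε' T _ _ V Q ζ hr h0 h1 hB hε hε1 hε' hε1' hk hk' hcap hq _ hV hQ hζ
  have hlogm : Real.logb 2 ((2 : ℝ) ^ r) = r := by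
    rw [Real.logb_pow, Real.logb_self_eq_one (by norm_num), mul_one]
  have hr1 : (1 : ℝ) ≤ r := by exact_mod_cast hr
  rw [hlogm]
  have hBA : β ^ 2 * (2 : ℝ) ^ r ≤ |B| := hB.trans (le_abs_self B)
  have hBA' : β ^ 2 * (2 : ℝ) ^ r ≤ A := by rw [hA]; linarith [abs_nonneg B]
  have hθ := alpha_pow_le h0 h1 hε hε1 hq
  have hk1 := pow_div_factorial_le_of_cutoff A hε hε1 hk
  have hk2 := pow_div_factorial_le_of_cutoff A hε' hε1' hk'
  have hs1 : 1 + 4 * t ≤ s ^ 2 := by rw [hs]; nlinarith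
  have hs0 : 0 < s := by rw [hs]; linarith
  have hu : ∀ j ≤ r, ∑ x : Bits (2 ^ j),
      ‖prepCoeff β k ρ (2 ^ j) 0 x - (bitAmp β x : ℂ)‖ ^ 2 ≤ (s * ε) ^ 2 := by
    intro j hj
    refine (sum_prepCoeff_sub_bitAmp_le_of_tail h0 h1 k ρ j r hj hBA' hk1 hθ).trans ?_
    have := mul_le_mul_of_nonneg_right hs1 (sq_nonneg ε)
    rw [mul_pow s ε]; linarith
  have hm : ((2 ^ r : ℕ) : ℝ) = (2 : ℝ) ^ r := by push_cast; rfl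
  have hτ : 4 * (∑ x : Bits (2 ^ r), if k' + 1 ≤ wt x then bitAmp β x ^ 2 else 0)
      ≤ (s * ε') ^ 2 := by
    have h4 := tail_le (n := 2 ^ r) (p := fun x => bitAmp β x ^ 2) (fun x => sq_nonneg _)
      (sq_nonneg β) (fun S => (bitAmp_sq_marginal h0 h1 S).le) (k' + 1)
    have h5 : (((2 ^ r : ℕ) : ℝ) * β ^ 2) ^ (k' + 1) / (k' + 1).factorial ≤ t * ε' ^ 2 := by
      refine le_trans ?_ hk2
      rw [hm]
      gcongr
      linarith
    have := mul_le_mul_of_nonneg_right hs1 (sq_nonneg ε')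
    rw [mul_pow s ε']
    nlinarith [sq_nonneg ε']
  have hmβ : (2 : ℝ) ^ r * (4 * β ^ 2) ≤ A := by rw [hA]; linarith
  have hπ : (((2 ^ r : ℕ) : ℝ) * (4 * β ^ 2)) ^ (k' + 1) / (k' + 1).factorial ≤ t * ε' ^ 2 := by
    refine le_trans ?_ hk2
    rw [hm]
    exact div_le_div_of_nonneg_right (pow_le_pow_left₀ (by positivity) hmβ _) (by positivity)
  refine (Dav_le h0 h1 k k' cap ρ r hV hQ hζ hcap (mul_pos hs0 hε) (mul_pos hs0 hε') hθ hu hτ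
    hπ).trans ?_
  rw [hm]
  have hsq : ε ^ 2 ≤ ε := by nlinarith
  have hsq' : ε' ^ 2 ≤ ε' := by nlinarith
  have b1 : 6 * (s * ε') + (s * ε') ^ 2 + 2 * (t * ε' ^ 2) ≤ (6 * s + s ^ 2 + 2 * t) * ε' := by
    have := mul_le_mul_of_nonneg_left hsq' (show 0 ≤ s ^ 2 + 2 * t by positivity)
    rw [mul_pow s ε']; linarith
  have b2 : 24 * (s * ε) + 8 * (s * ε) ^ 2 + 2 * (2 * ε) ≤ (24 * s + 8 * s ^ 2 + 4) * ε := by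
    have := mul_le_mul_of_nonneg_left hsq (show 0 ≤ 8 * s ^ 2 by positivity)
    rw [mul_pow s ε]; linarith
  have b3 : 1 + 2 * r * ((2 : ℝ) ^ r * (4 * β ^ 2)) ≤ (1 + 2 * A) * r := by
    have := mul_le_mul_of_nonneg_left hmβ (show (0 : ℝ) ≤ 2 * r by positivity)
    linarith
  have b4 : 6 * (s * ε) + (s * ε) ^ 2 + 2 * ε ≤ (6 * s + s ^ 2 + 2) * (ε * r) := by
    have e1 := mul_le_mul_of_nonneg_left hsq (show 0 ≤ s ^ 2 by positivity)
    have e2 := mul_le_mul_of_nonneg_left (le_mul_of_one_le_right hε.le hr1)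
      (show 0 ≤ 6 * s + s ^ 2 + 2 by positivity)
    rw [mul_pow s ε]; linarith
  have b5 : (24 * (s * ε) + 8 * (s * ε) ^ 2 + 2 * (2 * ε))
      * (1 + 2 * r * ((2 : ℝ) ^ r * (4 * β ^ 2)))
      ≤ (24 * s + 8 * s ^ 2 + 4) * (1 + 2 * A) * (ε * r) := by
    refine (mul_le_mul b2 b3 (by positivity) (by positivity)).trans (le_of_eq ?_)
    ring
  have hεr : 0 ≤ ε * r := by positivity
  have x1 : 0 ≤ (6 * s + s ^ 2 + 2 * t) * (ε * r) := by positivity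
  have x2 : 0 ≤ ((24 * s + 8 * s ^ 2 + 4) * (1 + 2 * A) + (6 * s + s ^ 2 + 2)) * ε' := by positivity
  linarith
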